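/- Throughout, $\lambda$ is the security parameter, QPT means quantum polynomial time, a function $\varepsilon:\mathbb N\to\mathbb R$ is negligible if $\lambda^k\varepsilon(\lambda)\to 0$ for every $k$, and all algorithms get $1^\lambda$ as an input. **Digital signatures with revocable signatures.** Let $M=(M_\lambda)_\lambda$, $M_\lambda\subseteq\{0,1\}^*$, be a message space. A digital signature scheme with revocable signatures for $M$ consists of QPT algorithms $\mathsf{KeyGen}(1^\lambda)\to(\mathsf{sigk},\mathsf{vk})$ (classical keys), $\mathsf{Sign}(\mathsf{sigk},m)\to(\psi,\mathsf{ck})$ (a quantum signature and a classical check key), $\mathsf{Ver}(\mathsf{vk},\psi,m)\to\top/\bot$, $\mathsf{Del}(\psi)\to\mathsf{cert}$ (a classical certificate) and $\mathsf{Cert}(\mathsf{ck},\mathsf{cert})\to\top/\bot$ such that, for every polynomial $p$, there is a negligible $\varepsilon$ such that for all $\lambda$ and all $m\in M_\lambda$ of length at most $p(\lambda)$, if $(\mathsf{sigk},\mathsf{vk})\leftarrow\mathsf{KeyGen}(1^\lambda)$ and $(\psi,\mathsf{ck})\leftarrow\mathsf{Sign}(\mathsf{sigk},m)$, then * (correctness)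 $\Pr[\mathsf{Ver}(\mathsf{vk},\psi,m)=\top]\ge 1-\varepsilon(\lambda)$; * (deletion correctness) $\Pr[\mathsf{Cert}(\mathsf{ck},\mathsf{Del}(\psi))=\top]\ge 1-\varepsilon(\lambda)$. The scheme satisfies *many-time deletion security* if for every pair $(\mathcal A_1,\mathcal A_2)$ of QPT algorithms $$\Pr\left[\begin{array}{l}\mathsf{Cert}(\mathsf{ck}^*,\mathsf{cert})=\top\ \wedge\\ \mathsf{Ver}(\mathsf{vk},\psi,m^*)=\top\end{array}:\begin{array}{l}(\mathsf{sigk},\mathsf{vk})\leftarrow\mathsf{KeyGen}(1^\lambda)\\(m^*,\mathsf{st})\leftarrow\mathcal A_1^{\mathsf{Sign}(\mathsf{sigk},\cdot)}(\mathsf{vk})\\(\psi^*,\mathsf{ck}^*)\leftarrow\mathsf{Sign}(\mathsf{sigk},m^*)\\(\mathsf{cert},\psi)\leftarrow\mathcal A_2^{\mathsf{Sign}(\mathsf{sigk},\cdot)}(\mathsf{st},\psi^*)\end{array}\right]$$ is negligible in $\lambda$, where $m^*\in M_\lambda$, the state $\mathsf{st}$ may be quantum, the oracle is queried on classical messages in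 $M_\lambda$ and returns both the signature and its check key, and neither $\mathcal A_1$ nor $\mathcal A_2$ may query $m^*$. It satisfies *no-query deletion security* if the same holds for all pairs $(\mathcal A_1,\mathcal A_2)$ that do not query the signing oracle at all. **EUF-CMA secure digital signatures.** A digital signature scheme (for messages in $\{0,1\}^*$) consists of QPT algorithms $\mathsf{KeyGen}(1^\lambda)\to(\mathsf{sigk},\mathsf{vk})$, $\mathsf{Sign}(\mathsf{sigk},m)\to\sigma$ and $\mathsf{Ver}(\mathsf{vk},\sigma,m)\to\top/\bot$ with classical keys and signatures, such that honest signatures on messages of polynomial length are accepted with probability at least $1-\varepsilon(\lambda)$ for a negligible $\varepsilon$. It is EUF-CMA secure if for every QPT algorithm $\mathcal A$ the probability that $(m^*,\sigma^*)\leftarrow\mathcal A^{\mathsf{Sign}(\mathsf{sigk},\cdot)}(\mathsf{vk})$ satisfies $\mathsf{Ver}(\mathsf{vk},\sigma^*,m^*)=\top$, although $\mathcal A$ did not query $m^*$, is negligible. **Lemma (many-time from no-query deletion security).** Assume that an EUF-CMA secure digital signature scheme exists. Then, for every message space $M$: if there is a digital signature scheme with revocable signatures for $M$ that satisfies no-query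 deletion security, then there is a digital signature scheme with revocable signatures for $M$ that satisfies many-time deletion security. This holds if all adversaries (in the hypotheses and in the conclusion) are uniform QPT algorithms, and also if all adversaries are QPT algorithms with classical advice of polynomial length. -/

import Mathlib

noncomputable section

namespace QSig

/-! ### Quantum memory and probabilistic branching -/

/-- Classical data: bit strings. -/
abbrev Bits := List Bool

/-- The joint (unnormalised) pure state of all qubits that have been allocated so far by all
parties. Qubits have addresses `0, …, next - 1`; the computational basis vector in which exactly
the qubits of `S` are `1` has amplitude `amp S`. -/
structure Env where
  next : ℕ
  amp : Finset ℕ → ℂ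

/-- The state without any qubit. -/
def Env.vac : Env := ⟨0, fun S => if S = ∅ then 1 else 0⟩

/-- Only allocated qubits can be `1`. -/
def Env.Valid (e : Env) : Prop := ∀ S, e.amp S ≠ 0 → S ⊆ Finset.range e.next

/-- The squared norm of the state, i.e. the probability of the branch that it describes. -/
def Env.weight (e : Env) : ℝ :=
  ∑ S ∈ (Finset.range e.next).powerset, ‖e.amp S‖ ^ 2

/-- The one-qubit gates. Together with CNOT they form a universal gate set. -/
inductive Gate where
  | H
  | T

/-- The matrix entry `⟨x| g |y⟩`. -/
def Gate.entry : Gate → Bool → Bool → ℂ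
  | .H, x, y => (if x && y then -1 else 1) / (Real.sqrt 2 : ℂ)
  | .T, x, y => if x = y then (if x then Complex.exp (Complex.I * Real.pi / 4) else 1) else 0

/-- Apply a one-qubit gate to qubit `a`. -/
def Env.gate (g : Gate) (a : ℕ) (e : Env) : Env :=
  { e with amp := fun S => g.entry (decide (a ∈ S)) false * e.amp (S.erase a)
      + g.entry (decide (a ∈ S)) true * e.amp (insert a S) }

/-- Apply CNOT with control qubit `a` and target qubit `b ≠ a`. -/
def Env.cnot (a b : ℕ) (e : Env) : Env :=
  { e with amp := fun S => if a ∈ S then e.amp (symmDiff S {b}) else e.amp S }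

/-- The unnormalised state after measuring qubit `a` in the computational basis with
outcome `x`. -/
def Env.proj (a : ℕ) (x : Bool) (e : Env) : Env :=
  { e with amp := fun S => if decide (a ∈ S) = x then e.amp S else 0 }

/-- A new qubit in state `|0⟩`. -/
def Env.alloc (e : Env) : Env := { e with next := e.next + 1 }

/-- A quantum experiment with a classical result: from a state of the quantum memory, the finite
list of its branches (one for each sequence of measurement outcomes), each with its classical
result and its unnormalised final state. The squared norm of that state is the probability of
the branch. A branch that is abandoned is missing in the list. -/
def QM (α : Type) : Type := Env → List (α × Env)

instance : Monad QM where
  pure a := fun e => [(a, e)]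
  bind x f := fun e => (x e).flatMap fun y => f y.1 y.2

/-- Abandon the current branch. -/
def QM.abort {α : Type} : QM α := fun _ => []

/-- Apply an operation to the quantum memory. -/
def QM.act (f : Env → Env) : QM Unit := fun e => [((), f e)]

/-- Allocate a qubit and return its address. -/
def QM.alloc : QM ℕ := fun e => [(e.next, e.alloc)]

/-- Measure qubit `a` in the computational basis. -/
def QM.measure (a : ℕ) : QM Bool := fun e => [(false, e.proj a false), (true, e.proj a true)]

/-- The total probability of all branches, from the given initial state. -/
def QM.total {α : Type} (x : QM α) (e : Env) : ℝ :=
  ((x e).map fun y => y.2.weight).sum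

open Classical in
/-- The probability that the experiment, started without any qubit, is not abandoned and has a
result in `E`. -/
def QM.prob {α : Type} (x : QM α) (E : α → Prop) : ℝ :=
  ((x Env.vac).map fun y => if E y.1 then y.2.weight else 0).sum

/-! ### A quantum programming language with a step count -/

/-- A self-delimiting code for pairs of strings. -/
def pairCode (a b : Bits) : Bits := (a.flatMap fun x => [true, x]) ++ false :: b

/-- Decoding of pairs. -/
def unpairCode : Bits → Bits × Bits
  | true :: x :: l => (x :: (unpairCode l).1, (unpairCode l).2)
  | false :: l => ([], l)
  | _ => ([], [])

theorem unpairCode_pairCode (a b : Bits) : unpairCode (pairCode a b) = (a, b) := by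
  induction a with
  | nil => simp [pairCode, unpairCode]
  | cons x a ih =>
    simp only [pairCode] at ih
    simp [pairCode, unpairCode, ih]

/-- The configuration of a running program: classical registers, each with a bit string, quantum
registers, each with a list of (addresses of) qubits, the number of steps that are left, and the
list of the oracle queries made so far. -/
structure Config where
  c : ℕ → Bits
  q : ℕ → List ℕ
  fuel : ℕ
  log : List Bits

/-- Set a classical register. -/
def Config.setC (s : Config) (r : ℕ) (x : Bits) : Config :=
  { s with c := Function.update s.c r x }

/-- Set a quantum register. -/
def Config.setQ (s : Config) (r : ℕ) (x : List ℕ) : Config :=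
  { s with q := Function.update s.q r x }

/-- The initial configuration: the classical inputs are in the classical registers `0, 1, 2, …`,
the quantum input is in the quantum register `0`. -/
def Config.start (ins : List Bits) (qs : List ℕ) (fuel : ℕ) : Config where
  c := fun i => ins.getD i []
  q := fun i => if i = 0 then qs else []
  fuel := fuel
  log := []

/-- Use `k` steps; the branch is abandoned if they are not available. -/
def spend (k : ℕ) (s : Config) : QM Config :=
  if k ≤ s.fuel then pure { s with fuel := s.fuel - k } else QM.abort

/-- Elementary instructions. Qubits can be moved but not copied. -/
inductive Instr where
  /-- push a bit onto the classical register `r` -/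
  | push (b : Bool) (r : ℕ)
  /-- remove the first bit of the classical register `r` -/
  | pop (r : ℕ)
  /-- copy the classical register `r` to `r'` -/
  | copy (r r' : ℕ)
  /-- store the code of the pair of the strings in `r₁`, `r₂` in `r'` -/
  | pair (r₁ r₂ r' : ℕ)
  /-- decode the string in `r` as a pair, and store its components in `r₁`, `r₂` -/
  | unpair (r r₁ r₂ : ℕ)
  /-- push a new qubit in state `|0⟩` onto the quantum register `p` -/
  | new (p : ℕ)
  /-- apply a one-qubit gate to the first qubit of `p` -/
  | gate (g : Gate) (p : ℕ)
  /-- apply CNOT, controlled by the first qubit of `p`, to the first qubit of `p'` -/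
  | cnot (p p' : ℕ)
  /-- remove and measure the first qubit of `p`, and push the outcome onto `r` -/
  | measure (p r : ℕ)
  /-- move the first qubit of `p` to the front of `p'` -/
  | move (p p' : ℕ)
  /-- move the whole content of `p` to `p'`, whose former content is discarded -/
  | moveAll (p p' : ℕ)
  /-- query the oracle on the string in `r`; the answer, which consists of two strings and a
  list of qubits, is stored in `r₁`, `r₂`, `p` -/
  | query (r r₁ r₂ p : ℕ)

/-- An oracle: it takes a string, and returns two strings and a list of qubits. -/
def Oracle : Type := Bits → QM (Bits × Bits × List ℕ)

/-- The effect of an instruction. An instruction that handles whole strings or lists of qubits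
costs as many steps as they are long, any other instruction one step. -/
def Instr.exec (O : Oracle) (s : Config) : Instr → QM Config
  | .push b r => spend 1 (s.setC r (b :: s.c r))
  | .pop r => spend 1 (s.setC r (s.c r).tail)
  | .copy r r' => spend (1 + (s.c r).length) (s.setC r' (s.c r))
  | .pair r₁ r₂ r' =>
      spend (1 + (s.c r₁).length + (s.c r₂).length) (s.setC r' (pairCode (s.c r₁) (s.c r₂)))
  | .unpair r r₁ r₂ =>
      spend (1 + (s.c r).length)
        ((s.setC r₁ (unpairCode (s.c r)).1).setC r₂ (unpairCode (s.c r)).2)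
  | .new p => do
      let s ← spend 1 s
      let a ← QM.alloc
      return s.setQ p (a :: s.q p)
  | .gate g p => do
      let s ← spend 1 s
      match s.q p with
      | [] => return s
      | a :: _ => do
          QM.act (Env.gate g a)
          return s
  | .cnot p p' => do
      let s ← spend 1 s
      match s.q p, s.q p' with
      | a :: _, b :: _ =>
          if a = b then return s
          else do
            QM.act (Env.cnot a b)
            return s
      | _, _ => return s
  | .measure p r => do
      let s ← spend 1 s
      match s.q p with
      | [] => return s
      | a :: l => do
          let x ← QM.measure a
          return (s.setQ p l).setC r (x :: s.c r)
  | .move p p' =>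
      match s.q p with
      | [] => spend 1 s
      | a :: l => spend 1 ((s.setQ p l).setQ p' (a :: (s.setQ p l).q p'))
  | .moveAll p p' => spend (1 + (s.q p).length) ((s.setQ p []).setQ p' (s.q p))
  | .query r r₁ r₂ p => do
      let s ← spend (1 + (s.c r).length) s
      let (x, y, l) ← O (s.c r)
      let s ← spend (x.length + y.length + l.length) { s with log := s.c r :: s.log }
      return ((s.setC r₁ x).setC r₂ y).setQ p l

/-- Conditions in programs. -/
inductive Test where
  /-- the classical register `r` is not empty -/
  | nonempty (r : ℕ)
  /-- the first bit of the classical register `r` is `1` -/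
  | head (r : ℕ)

/-- The value of a condition. -/
def Test.eval (s : Config) : Test → Bool
  | .nonempty r => !(s.c r).isEmpty
  | .head r => (s.c r).head? == some true

/-- Programs. -/
inductive Prog where
  | skip
  | instr (i : Instr)
  | seq (P Q : Prog)
  | ite (t : Test) (P Q : Prog)
  | loop (t : Test) (P : Prog)

/-- At most `k` rounds of a while loop. -/
def whileLoop (t : Test) (body : Config → QM Config) : ℕ → Config → QM Config
  | 0, s => if t.eval s then QM.abort else pure s
  | k + 1, s =>
      if t.eval s then do
        let s ← spend 1 s
        let s ← body s
        whileLoop t body k s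
      else pure s

/-- The execution of a program with an oracle. Each evaluation of a condition costs one step; the
branches that do not halt while there are steps left are abandoned. (A while loop cannot make
more rounds than there are steps left at its start.) -/
def Prog.exec (O : Oracle) : Prog → Config → QM Config
  | .skip, s => pure s
  | .instr i, s => i.exec O s
  | .seq P Q, s => do
      let s ← P.exec O s
      Q.exec O s
  | .ite t P Q, s => do
      let s ← spend 1 s
      if t.eval s then P.exec O s else Q.exec O s
  | .loop t P, s => do
      let s ← spend 1 s
      whileLoop t (P.exec O) s.fuel s

/-- No oracle: every query has the empty answer. -/
def nullOracle : Oracle := fun _ => pure ([], [], [])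

/-- The total length of the inputs of a program. -/
def inputSize (ins : List Bits) (qs : List ℕ) : ℕ := (ins.map List.length).sum + qs.length

/-- A (uniform) quantum polynomial-time algorithm: a program that, on all classical inputs and
on all quantum inputs (which may be entangled with other qubits), halts with certainty within a
number of steps that is polynomial in the length of the inputs. -/
structure QPTAlg where
  prog : Prog
  time : Polynomial ℕ
  halts : ∀ (ins : List Bits) (qs : List ℕ) (e : Env), e.Valid → qs.Nodup →
    (∀ a ∈ qs, a < e.next) →
    QM.total (prog.exec nullOracle (Config.start ins qs (time.eval (inputSize ins qs)))) e
      = e.weight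

/-- Run an algorithm on its inputs; the results are read off the registers of the final
configuration. Qubits that are not part of a result are never used again. -/
def QPTAlg.run (A : QPTAlg) (ins : List Bits) (qs : List ℕ) : QM Config :=
  A.prog.exec nullOracle (Config.start ins qs (A.time.eval (inputSize ins qs)))

/-- An algorithm accepts by writing `1` into the classical register `0`. -/
def Config.accepts (s : Config) : Prop := s.c 0 = [true]

/-- The security parameter in unary. -/
def unary (n : ℕ) : Bits := List.replicate n true

/-- Negligible functions. -/
def Negligible (f : ℕ → ℝ) : Prop :=
  Asymptotics.SuperpolynomialDecay Filter.atTop (fun n : ℕ => (n : ℝ)) f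

/-- Adversaries are uniform, or get a classical advice string of polynomial length that depends
only on the security parameter. -/
inductive Model where
  | uniform
  | nonuniform

/-- The advice that is available in the two models. -/
def Model.Advice (z : ℕ → Bits) : Model → Prop
  | .uniform => ∀ n, z n = []
  | .nonuniform => ∃ p : Polynomial ℕ, ∀ n, (z n).length ≤ p.eval n

/-! ### Digital signatures -/

/-- The algorithms of a digital signature scheme with classical keys and signatures, for messages
in `{0,1}^*`. All algorithms get the security parameter `1^n` as their first input.
* `keyGen(1^n)` returns `(sigk, vk)`,
* `sign(1^n, sigk, m)` returns `σ`,
* `ver(1^n, vk, σ, m)` accepts or rejects. -/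
structure Signature where
  keyGen : QPTAlg
  sign : QPTAlg
  ver : QPTAlg

/-- Key generation, signing of `m`, verification; the result is that of the verification. -/
def Signature.honest (S : Signature) (n : ℕ) (m : Bits) : QM Config := do
  let k ← S.keyGen.run [unary n] []
  let σ ← S.sign.run [unary n, k.c 0, m] []
  S.ver.run [unary n, k.c 1, σ.c 0, m] []

/-- Correctness: signatures on messages of polynomial length are accepted except with negligible
probability. -/
def Signature.Correct (S : Signature) : Prop :=
  ∀ p : Polynomial ℕ, ∃ ε : ℕ → ℝ, Negligible ε ∧ ∀ (n : ℕ) (m : Bits), m.length ≤ p.eval n →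
    1 - ε n ≤ (S.honest n m).prob Config.accepts

/-- The signing oracle. -/
def Signature.oracle (S : Signature) (n : ℕ) (sigk : Bits) : Oracle := fun m => do
  let σ ← S.sign.run [unary n, sigk, m] []
  return (σ.c 0, [], [])

/-- The chosen message attack of the program `A` with `t` steps and advice `z`. It gets
`(1^n, z, vk)` and access to the signing oracle, and returns `(m*, σ*)`. The result of the game
is the final configuration of `A` and that of the verification of `σ*`. -/
def Signature.forgeryGame (S : Signature) (A : Prog) (t : ℕ) (z : Bits) (n : ℕ) :
    QM (Config × Config) := do
  let k ← S.keyGen.run [unary n] []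
  let s ← A.exec (S.oracle n (k.c 0)) (Config.start [unary n, z, k.c 1] [] t)
  let v ← S.ver.run [unary n, k.c 1, s.c 1, s.c 0] []
  return (s, v)

/-- EUF-CMA security against quantum polynomial-time adversaries: programs that run for a
polynomial number of steps. The adversary wins if its signature on `m*` is accepted and it did
not query `m*`. -/
def Signature.EUFCMA (S : Signature) (μ : Model) : Prop :=
  ∀ (A : Prog) (t : Polynomial ℕ) (z : ℕ → Bits), μ.Advice z →
    Negligible fun n => (S.forgeryGame A (t.eval n) (z n) n).prob fun r =>
      r.2.accepts ∧ r.1.c 0 ∉ r.1.log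

/-! ### Digital signatures with revocable signatures -/

/-- The algorithms of a digital signature scheme with revocable signatures. A quantum signature
`ψ` is a list of qubits (in the quantum register `0`) together with a classical string. All
algorithms get the security parameter `1^n` as their first input.
* `keyGen(1^n)` returns `(sigk, vk)`,
* `sign(1^n, sigk, m)` returns `(ψ, ck)`; the classical part of `ψ` is in register `0`, and `ck`
  in register `1`,
* `ver(1^n, vk, ψ, m)` accepts or rejects,
* `del(1^n, ψ)` returns `cert`,
* `cert(1^n, ck, cert)` accepts or rejects. -/
structure RevocableSignature where
  keyGen : QPTAlg
  sign : QPTAlg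
  ver : QPTAlg
  del : QPTAlg
  cert : QPTAlg

namespace RevocableSignature

/-- Key generation, signing of `m`, verification; the result is that of the verification. -/
def honestVer (S : RevocableSignature) (n : ℕ) (m : Bits) : QM Config := do
  let k ← S.keyGen.run [unary n] []
  let ψ ← S.sign.run [unary n, k.c 0, m] []
  S.ver.run [unary n, k.c 1, ψ.c 0, m] (ψ.q 0)

/-- Key generation, signing of `m`, deletion, verification of the certificate; the result is that
of the latter. -/
def honestDel (S : RevocableSignature) (n : ℕ) (m : Bits) : QM Config := do
  let k ← S.keyGen.run [unary n] []
  let ψ ← S.sign.run [unary n, k.c 0, m] []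
  let d ← S.del.run [unary n, ψ.c 0] (ψ.q 0)
  S.cert.run [unary n, ψ.c 1, d.c 0] []

/-- Correctness, for messages of polynomial length in the message space `M`. -/
def Correct (S : RevocableSignature) (M : ℕ → Set Bits) : Prop :=
  ∀ p : Polynomial ℕ, ∃ ε : ℕ → ℝ, Negligible ε ∧ ∀ n, ∀ m ∈ M n, m.length ≤ p.eval n →
    1 - ε n ≤ (S.honestVer n m).prob Config.accepts

/-- Deletion correctness, for messages of polynomial length in the message space `M`. -/
def DeletionCorrect (S : RevocableSignature) (M : ℕ → Set Bits) : Prop :=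
  ∀ p : Polynomial ℕ, ∃ ε : ℕ → ℝ, Negligible ε ∧ ∀ n, ∀ m ∈ M n, m.length ≤ p.eval n →
    1 - ε n ≤ (S.honestDel n m).prob Config.accepts

/-- The signing oracle; it returns both the signature and the check key. -/
def oracle (S : RevocableSignature) (n : ℕ) (sigk : Bits) : Oracle := fun m => do
  let ψ ← S.sign.run [unary n, sigk, m] []
  return (ψ.c 0, ψ.c 1, ψ.q 0)

/-- What matters for the outcome of the deletion game. -/
structure Result where
  /-- the challenge message -/
  target : Bits
  /-- the messages that the adversary queried -/
  queries : List Bits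
  /-- the final configuration of the verification of the returned signature -/
  ver : Config
  /-- the final configuration of the verification of the certificate -/
  cert : Config

/-- The deletion game, with an adversary `(A₁, A₂)` whose two programs have `t` steps each, and
with advice `z`. Both have access to the signing oracle.
* `A₁` gets `(1^n, z, vk)` and returns `m*` in the classical register `0`.
* `A₂` continues with the whole memory of `A₁` (the state `st`) and gets the signature `ψ*` on
  `m*` in the classical and the quantum register `0`; the check key `ck*` is withheld. It returns
  `cert` in the classical register `0`, and `ψ` in the classical register `1` and the quantum
  register `0`. -/
def deletionGame (S : RevocableSignature) (A₁ A₂ : Prog) (t : ℕ) (z : Bits) (n : ℕ) :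
    QM Result := do
  let k ← S.keyGen.run [unary n] []
  let O := S.oracle n (k.c 0)
  let s₁ ← A₁.exec O (Config.start [unary n, z, k.c 1] [] t)
  let ψ ← S.sign.run [unary n, k.c 0, s₁.c 0] []
  let s₂ ← A₂.exec O { ((s₁.setC 0 (ψ.c 0)).setQ 0 (ψ.q 0)) with fuel := t }
  let v ← S.ver.run [unary n, k.c 1, s₂.c 1, s₁.c 0] (s₂.q 0)
  let d ← S.cert.run [unary n, ψ.c 1, s₂.c 0] []
  return { target := s₁.c 0, queries := s₂.log, ver := v, cert := d }

/-- Many-time deletion security, against quantum polynomial-time adversaries (programs that run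
for a polynomial number of steps) that query messages other than `m*`. -/
def ManyTimeSecure (S : RevocableSignature) (M : ℕ → Set Bits) (μ : Model) : Prop :=
  ∀ (A₁ A₂ : Prog) (t : Polynomial ℕ) (z : ℕ → Bits), μ.Advice z →
    Negligible fun n => (S.deletionGame A₁ A₂ (t.eval n) (z n) n).prob fun r =>
      r.cert.accepts ∧ r.ver.accepts ∧ r.target ∈ M n ∧
        ∀ m ∈ r.queries, m ∈ M n ∧ m ≠ r.target

/-- No-query deletion security: the same, against adversaries that do not query the signing
oracle at all. -/
def NoQuerySecure (S : RevocableSignature) (M : ℕ → Set Bits) (μ : Model) : Prop :=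
  ∀ (A₁ A₂ : Prog) (t : Polynomial ℕ) (z : ℕ → Bits), μ.Advice z →
    Negligible fun n => (S.deletionGame A₁ A₂ (t.eval n) (z n) n).prob fun r =>
      r.cert.accepts ∧ r.ver.accepts ∧ r.target ∈ M n ∧ r.queries = []

end RevocableSignature

end QSig

end

noncomputable section

namespace QSig

/-! ### The monad of quantum experiments -/

/-! The many-time scheme uses the key pair of the EUF-CMA scheme `S` as its long-term key and draws
a fresh key pair of the no-query scheme `N` for every signature. A signature on `m` consists of the
one-time key `vk'`, a classical `S`-signature on the pair `(vk', m)`, and the `N`-signature on `m`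
under `vk'`. Verification checks both signatures; deletion, check key and certificate are those of
`N`. Signing the pair, and not just `vk'`, ties each one-time key to one message, so a key that was
issued for a queried message is useless for `m*`.

A winning adversary returns a signature on `m*` with some one-time key. If this is not the key of
the challenge, the classical part is a forgery: all pairs signed by the oracle contain a queried
message, which differs from `m*`, and the one pair signed for the challenge contains another key
(`forge_le`). If it is the key of the challenge, the adversary has deleted an `N`-signature and
still holds a valid one under the same key. A reduction that draws the long-term key itself can
answer all queries and needs its challenger only for the challenge signature, so it makes no query
(`reuse_le`). `deletionGame_le_add` is the union bound over the two cases, and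
`manyTimeSecure_of_spec` collects the estimates. Both reductions pass on the advice unchanged, which
is why uniform and nonuniform adversaries are treated alike.

One probabilistic point remains: the many-time game draws the one-time key of the challenge after
the adversary has chosen `m*`, the no-query game draws it at the start. `QM.val_comm` exchanges
independent experiments. Since qubits have global addresses, this needs that programs do not notice
inserted foreign qubits (`Prog.exec_framed`), and that a closed experiment started in any memory
yields a tensor product (`Env.eq_embed_vac`, `Env.embed_comm`). The same independence gives
correctness, where the probabilities of the two honest verifications multiply.

Most of the work is that schemes and reductions are concrete programs with a step count. `Cov`
compares lists of branches: each branch of nonzero amplitude on the left recurs on the right with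
the same memory and a related result. A simulating program has more steps and may have more
branches, so one obtains inclusions, which suffice to bound winning probabilities from above.
`Prog.exec_inline` runs a program in renamed registers with its queries replaced by subprograms;
`QPTAlg.call_cov` and `exec_sim` apply it to subroutines and to adversaries. For the algorithms of
the new scheme both directions are needed: no program gains weight (`Prog.exec_total`), so if it
covers an experiment of full weight, it halts with certainty and its surplus branches have amplitude
zero (`Implements.exists_alg`, `Cov.reverse`). Polynomial running times rest on the length bounds
from `Prog.exec_short`. -/

theorem QM.bind_apply {α β : Type} (x : QM α) (f : α → QM β) (e : Env) :
    (x >>= f) e = (x e).flatMap fun y => f y.1 y.2 := rfl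

theorem QM.pure_apply {α : Type} (a : α) (e : Env) : (pure a : QM α) e = [(a, e)] := rfl

theorem QM.abort_apply {α : Type} (e : Env) : (QM.abort : QM α) e = [] := rfl

instance : LawfulMonad QM := LawfulMonad.mk'
  (id_map := fun x => by
    funext e
    change (x e).flatMap (fun y => [(y.1, y.2)]) = x e
    simp)
  (pure_bind := fun a f => by
    funext e
    simp [QM.bind_apply, QM.pure_apply])
  (bind_assoc := fun x f g => by
    funext e
    simp [QM.bind_apply, List.flatMap_assoc])

theorem QM.total_pure {α : Type} (a : α) (e : Env) : QM.total (pure a : QM α) e = e.weight := by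
  simp [QM.total, QM.pure_apply]

theorem QM.total_abort {α : Type} (e : Env) : QM.total (QM.abort : QM α) e = 0 := by
  simp [QM.total, QM.abort_apply]

theorem sum_map_flatMap {α β : Type*} (l : List α) (f : α → List β) (g : β → ℝ) :
    ((l.flatMap f).map g).sum = (l.map fun a => ((f a).map g).sum).sum := by
  induction l with
  | nil => simp
  | cons a l ih => simp [ih]

theorem QM.total_bind {α β : Type} (x : QM α) (f : α → QM β) (e : Env) :
    QM.total (x >>= f) e = ((x e).map fun y => QM.total (f y.1) y.2).sum := by
  simp only [QM.total, QM.bind_apply, sum_map_flatMap]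

/-- The postcondition `Q` holds in all branches of `x`, started in `e`. -/
def QM.All {α : Type} (x : QM α) (e : Env) (Q : α → Env → Prop) : Prop :=
  ∀ y ∈ x e, Q y.1 y.2

theorem QM.All.bind {α β : Type} {x : QM α} {f : α → QM β} {e : Env} {Q : α → Env → Prop}
    {Q' : β → Env → Prop} (hx : x.All e Q) (hf : ∀ a e', Q a e' → (f a).All e' Q') :
    (x >>= f).All e Q' := by
  intro y hy
  obtain ⟨z, hz, hy⟩ := List.mem_flatMap.1 hy
  exact hf _ _ (hx z hz) y hy

theorem QM.All.pure {α : Type} {a : α} {e : Env} {Q : α → Env → Prop} (h : Q a e) :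
    (Pure.pure a : QM α).All e Q := by
  intro y hy
  simp only [QM.pure_apply, List.mem_singleton] at hy
  subst hy
  exact h

theorem QM.All.abort {α : Type} {e : Env} {Q : α → Env → Prop} :
    (QM.abort : QM α).All e Q := by
  intro y hy
  simp [QM.abort_apply] at hy

theorem QM.All.mono {α : Type} {x : QM α} {e : Env} {Q Q' : α → Env → Prop}
    (hx : x.All e Q) (h : ∀ a e', Q a e' → Q' a e') : x.All e Q' :=
  fun y hy => h _ _ (hx y hy)

theorem QM.All.and {α : Type} {x : QM α} {e : Env} {Q Q' : α → Env → Prop}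
    (hx : x.All e Q) (hx' : x.All e Q') : x.All e (fun a e' => Q a e' ∧ Q' a e') :=
  fun y hy => ⟨hx y hy, hx' y hy⟩

theorem QM.total_bind_le {α β : Type} {x : QM α} {f : α → QM β} {e : Env}
    (h : x.All e fun a e' => QM.total (f a) e' ≤ e'.weight) :
    QM.total (x >>= f) e ≤ QM.total x e := by
  rw [QM.total_bind]
  exact List.sum_le_sum fun y hy => h y hy

theorem QM.total_bind_eq {α β : Type} {x : QM α} {f : α → QM β} {e : Env}
    (h : x.All e fun a e' => QM.total (f a) e' = e'.weight) :
    QM.total (x >>= f) e = QM.total x e := by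
  rw [QM.total_bind, QM.total]
  congr 1
  exact List.map_congr_left fun y hy => h y hy

theorem QM.All.spend {k : ℕ} {s : Config} {e : Env} {Q : Config → Env → Prop}
    (h : k ≤ s.fuel → Q { s with fuel := s.fuel - k } e) : (spend k s).All e Q := by
  unfold QSig.spend
  split_ifs with hk
  · exact .pure (h hk)
  · exact .abort

/-! ### Invariants of executions -/

/-- A property of configurations and quantum memories that is preserved by using up steps and by
all instructions is preserved by all programs. -/
theorem Prog.exec_all {O : Oracle} {I : Config → Env → Prop}
    (hspend : ∀ s e k, I s e → I { s with fuel := s.fuel - k } e)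
    (hinstr : ∀ (i : Instr) s e, I s e → (i.exec O s).All e I)
    (P : Prog) : ∀ s e, I s e → (P.exec O s).All e I := by
  have hsp : ∀ k s e, I s e → (spend k s).All e I := fun k s e h => .spend fun _ => hspend _ _ _ h
  induction P with
  | skip => exact fun s e h => .pure h
  | instr i => exact fun s e h => hinstr i s e h
  | seq P Q ihP ihQ => exact fun s e h => (ihP s e h).bind ihQ
  | ite t P Q ihP ihQ =>
    intro s e h
    refine (hsp 1 s e h).bind fun s' e' h' => ?_
    split_ifs
    · exact ihP _ _ h'
    · exact ihQ _ _ h'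
  | loop t P ihP =>
    intro s e h
    refine (hsp 1 s e h).bind fun s' e' h' => ?_
    have key : ∀ k s e, I s e → (whileLoop t (P.exec O) k s).All e I := by
      intro k
      induction k with
      | zero =>
        intro s e h
        unfold whileLoop
        split_ifs
        · exact .abort
        · exact .pure h
      | succ k ih =>
        intro s e h
        unfold whileLoop
        split_ifs
        · exact (hsp 1 s e h).bind fun s' e' h' => (ihP _ _ h').bind ih
        · exact .pure h
    exact key _ _ _ h'

/-! ### Branches of amplitude zero -/

/-- The experiment maps the zero vector to zero vectors. -/
def QM.Linear {α : Type} (x : QM α) : Prop :=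
  ∀ e : Env, e.amp = 0 → x.All e fun _ e' => e'.amp = 0

theorem QM.Linear.bind {α β : Type} {x : QM α} {f : α → QM β} (hx : x.Linear)
    (hf : ∀ a, (f a).Linear) : (x >>= f).Linear :=
  fun e he => (hx e he).bind fun a e' h => hf a e' h

theorem QM.Linear.pure {α : Type} (a : α) : (Pure.pure a : QM α).Linear :=
  fun _ he => .pure he

theorem QM.Linear.spend (k : ℕ) (s : Config) : (QSig.spend k s).Linear :=
  fun _ he => .spend fun _ => he

theorem QM.Linear.act {f : Env → Env} (h : ∀ e : Env, e.amp = 0 → (f e).amp = 0) :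
    (QM.act f).Linear := by
  intro e he y hy
  simp only [QM.act, List.mem_singleton] at hy
  subst hy
  exact h e he

theorem QM.Linear.alloc : QM.alloc.Linear := by
  intro e he y hy
  simp only [QM.alloc, List.mem_singleton] at hy
  subst hy
  exact he

theorem QM.Linear.measure (a : ℕ) : (QM.measure a).Linear := by
  intro e he y hy
  simp only [QM.measure, List.mem_cons, List.not_mem_nil, or_false] at hy
  rcases hy with rfl | rfl <;> (funext S; simp [Env.proj, he])

theorem Instr.exec_move (O : Oracle) (s : Config) (p p' : ℕ) :
    (Instr.move p p').exec O s = match s.q p with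
      | [] => spend 1 s
      | a :: l => spend 1 ((s.setQ p l).setQ p' (a :: (s.setQ p l).q p')) := rfl

/-- Comparisons of experiments ignore branches of amplitude zero. This is harmless because every
quantum operation is linear, so no later instruction can revive such a branch. -/
theorem Instr.exec_linear {O : Oracle} (hO : ∀ m, (O m).Linear) (i : Instr) (s : Config) :
    (i.exec O s).Linear := by
  cases i with
  | push b r => exact .spend _ _
  | pop r => exact .spend _ _
  | copy r r' => exact .spend _ _
  | pair r₁ r₂ r' => exact .spend _ _
  | unpair r r₁ r₂ => exact .spend _ _
  | new p => exact (QM.Linear.spend _ _).bind fun s => QM.Linear.alloc.bind fun a => .pure _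
  | gate g p =>
    refine (QM.Linear.spend _ _).bind fun s => ?_
    split
    · exact .pure _
    · refine (QM.Linear.act fun e he => ?_).bind fun _ => .pure _
      funext S
      simp [Env.gate, he]
  | cnot p p' =>
    refine (QM.Linear.spend _ _).bind fun s => ?_
    split
    · split_ifs
      · exact .pure _
      · refine (QM.Linear.act fun e he => ?_).bind fun _ => .pure _
        funext S
        simp [Env.cnot, he]
    · exact .pure _
  | measure p r =>
    refine (QM.Linear.spend _ _).bind fun s => ?_
    split
    · exact .pure _
    · exact (QM.Linear.measure _).bind fun x => .pure _
  | move p p' =>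
    rw [Instr.exec_move]
    split <;> exact .spend _ _
  | moveAll p p' => exact .spend _ _
  | query r r₁ r₂ p =>
    exact (QM.Linear.spend _ _).bind fun s => (hO _).bind fun t =>
      (QM.Linear.spend _ _).bind fun s => .pure _

theorem Prog.exec_linear {O : Oracle} (hO : ∀ m, (O m).Linear) (P : Prog) (s : Config) :
    (P.exec O s).Linear := fun e he =>
  Prog.exec_all (I := fun _ e => e.amp = 0) (fun _ _ _ h => h)
    (fun i s e h => Instr.exec_linear hO i s e h) P s e he

theorem nullOracle_linear (m : Bits) : (nullOracle m).Linear := .pure _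

theorem QPTAlg.run_linear (A : QPTAlg) (ins : List Bits) (qs : List ℕ) :
    (A.run ins qs).Linear := Prog.exec_linear nullOracle_linear _ _

/-! ### Well-formed configurations -/

/-- The quantum registers contain allocated qubits, and no qubit twice. -/
structure Good (s : Config) (e : Env) : Prop where
  valid : e.Valid
  lt : ∀ p, ∀ a ∈ s.q p, a < e.next
  nodup : ∀ p, (s.q p).Nodup
  disj : ∀ p p', p ≠ p' → ∀ a ∈ s.q p, a ∉ s.q p'

/-- The configuration `s'` is well-formed, and its qubits are among those of `s` and those that
have been allocated since `e`. -/
structure Reach (s : Config) (e : Env) (s' : Config) (e' : Env) : Prop where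
  good : Good s' e'
  next_le : e.next ≤ e'.next
  old : ∀ p, ∀ a ∈ s'.q p, e.next ≤ a ∨ ∃ p', a ∈ s.q p'

theorem Good.reach {s : Config} {e : Env} (h : Good s e) : Reach s e s e :=
  ⟨h, le_rfl, fun p _ ha => .inr ⟨p, ha⟩⟩

theorem Reach.trans {s s' s'' : Config} {e e' e'' : Env} (h : Reach s e s' e')
    (h' : Reach s' e' s'' e'') : Reach s e s'' e'' :=
  ⟨h'.good, h.next_le.trans h'.next_le, fun p a ha =>
    (h'.old p a ha).elim (fun h1 => .inl (h.next_le.trans h1)) fun ⟨p', hp'⟩ => h.old p' a hp'⟩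

/-- Well-formed configurations from the same qubits. -/
theorem Good.of_q {s s' : Config} {e : Env} (h : Good s e) (hq : s'.q = s.q) : Good s' e :=
  ⟨h.valid, by rw [hq]; exact h.lt, by rw [hq]; exact h.nodup, by rw [hq]; exact h.disj⟩

/-- What an oracle has to satisfy to preserve well-formedness: it returns fresh qubits. -/
def Oracle.Fresh (O : Oracle) : Prop :=
  ∀ m (e : Env), e.Valid → (O m).All e fun t e' =>
    e'.Valid ∧ e.next ≤ e'.next ∧ t.2.2.Nodup ∧ ∀ a ∈ t.2.2, e.next ≤ a ∧ a < e'.next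

theorem nullOracle_fresh : nullOracle.Fresh :=
  fun _ _ he => .pure ⟨he, le_rfl, List.nodup_nil, by simp⟩

theorem Env.alloc_valid {e : Env} (h : e.Valid) : e.alloc.Valid := fun S hS =>
  (h S hS).trans (Finset.range_subset_range.2 (Nat.le_succ _))

theorem Env.gate_valid {e : Env} (h : e.Valid) {g : Gate} {a : ℕ} (ha : a < e.next) :
    (e.gate g a).Valid := by
  intro S hS
  by_contra hn
  have h1 : e.amp (S.erase a) = 0 := by
    by_contra h1
    refine hn fun b hb => ?_
    by_cases hba : b = a
    · subst hba; exact Finset.mem_range.2 ha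
    · exact h _ h1 (Finset.mem_erase.2 ⟨hba, hb⟩)
  have h2 : e.amp (insert a S) = 0 := by
    by_contra h2
    exact hn fun b hb => h _ h2 (Finset.mem_insert_of_mem hb)
  exact hS (by simp [Env.gate, h1, h2])

theorem Env.cnot_valid {e : Env} (h : e.Valid) {a b : ℕ} (hb : b < e.next) :
    (e.cnot a b).Valid := by
  intro S hS
  simp only [Env.cnot] at hS ⊢
  split_ifs at hS
  · intro c hc
    by_cases hcb : c = b
    · subst hcb; exact Finset.mem_range.2 hb
    · exact h _ hS (Finset.mem_symmDiff.2 (.inl ⟨hc, by simpa using hcb⟩))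
  · exact h _ hS

theorem Env.proj_valid {e : Env} (h : e.Valid) (a : ℕ) (x : Bool) : (e.proj a x).Valid := by
  intro S hS
  simp only [Env.proj] at hS ⊢
  split_ifs at hS
  · exact h _ hS
  · exact absurd rfl hS

theorem Good.env {s : Config} {e e' : Env} (h : Good s e) (hv : e'.Valid)
    (hn : e.next ≤ e'.next) : Good s e' :=
  ⟨hv, fun p a ha => (h.lt p a ha).trans_le hn, h.nodup, h.disj⟩

theorem Good.reach_env {s : Config} {e e' : Env} (h : Good s e) (hv : e'.Valid)
    (hn : e.next ≤ e'.next) : Reach s e s e' :=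
  ⟨h.env hv hn, hn, fun p _ ha => .inr ⟨p, ha⟩⟩

theorem Good.reach_of_q {s s' : Config} {e : Env} (h : Good s e) (hq : s'.q = s.q) :
    Reach s e s' e :=
  ⟨h.of_q hq, le_rfl, fun p a ha => .inr ⟨p, by rwa [← hq]⟩⟩

/-- Fresh addresses are at least `e.next`, while all registers of `s` hold smaller ones; this
separates the new list from the other registers. -/
theorem Good.setQ_fresh {s : Config} {e e' : Env} (h : Good s e) (hv : e'.Valid)
    (hn : e.next ≤ e'.next) {l : List ℕ} (hl : l.Nodup)
    (hf : ∀ a ∈ l, e.next ≤ a ∧ a < e'.next) (p : ℕ) : Reach s e (s.setQ p l) e' := by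
  have hq : ∀ r a, a ∈ (s.setQ p l).q r → (r = p ∧ a ∈ l) ∨ (r ≠ p ∧ a ∈ s.q r) := by
    intro r a ha
    by_cases hr : r = p
    · subst hr
      exact .inl ⟨rfl, by simpa [Config.setQ] using ha⟩
    · exact .inr ⟨hr, by simpa [Config.setQ, hr] using ha⟩
  refine ⟨⟨hv, fun r a ha => ?_, fun r => ?_, fun r r' hr a ha ha' => ?_⟩, hn, fun r a ha => ?_⟩
  · rcases hq r a ha with ⟨_, h1⟩ | ⟨_, h1⟩
    · exact (hf a h1).2
    · exact (h.lt r a h1).trans_le hn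
  · by_cases hr : r = p
    · subst hr
      simpa [Config.setQ] using hl
    · simpa [Config.setQ, hr] using h.nodup r
  · rcases hq r a ha with ⟨h0, h1⟩ | ⟨h0, h1⟩ <;> rcases hq r' a ha' with ⟨h2, h3⟩ | ⟨h2, h3⟩
    · exact hr (h0.trans h2.symm)
    · exact absurd (h.lt r' a h3) (not_lt.2 (hf a h1).1)
    · exact absurd (h.lt r a h1) (not_lt.2 (hf a h3).1)
    · exact h.disj r r' hr a h1 h3
  · rcases hq r a ha with ⟨_, h1⟩ | ⟨_, h1⟩
    · exact .inl (hf a h1).1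
    · exact .inr ⟨r, h1⟩

/-- Rearranging qubits. -/
theorem Good.reach_perm {s s' : Config} {e : Env} (h : Good s e)
    (hs : ∀ p a, a ∈ s'.q p → ∃ p', a ∈ s.q p') (hn : ∀ p, (s'.q p).Nodup)
    (hd : ∀ p p', p ≠ p' → ∀ a ∈ s'.q p, a ∉ s'.q p') : Reach s e s' e :=
  ⟨⟨h.valid, fun p a ha => (hs p a ha).elim fun p' hp' => h.lt p' a hp', hn, hd⟩, le_rfl,
    fun p a ha => .inr (hs p a ha)⟩

theorem Good.setQ_sub {s : Config} {e : Env} (h : Good s e) (p : ℕ) {l : List ℕ}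
    (hl : l.Sublist (s.q p)) : Reach s e (s.setQ p l) e := by
  have hsub : ∀ r, ((s.setQ p l).q r).Sublist (s.q r) := by
    intro r
    by_cases hr : r = p
    · subst hr
      simpa [Config.setQ] using hl
    · simp [Config.setQ, hr]
  exact h.reach_perm (fun r a ha => ⟨r, (hsub r).subset ha⟩) (fun r => (h.nodup r).sublist (hsub r))
    fun r r' hr a ha ha' => h.disj r r' hr a ((hsub r).subset ha) ((hsub r').subset ha')

theorem Good.setQ_disj {s : Config} {e : Env} (h : Good s e) (p : ℕ) {l : List ℕ}
    (hl : l.Nodup) (hlt : ∀ a ∈ l, a < e.next) (hd : ∀ r, r ≠ p → ∀ a ∈ l, a ∉ s.q r) :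
    Good (s.setQ p l) e := by
  have hq : ∀ r a, a ∈ (s.setQ p l).q r → (r = p ∧ a ∈ l) ∨ (r ≠ p ∧ a ∈ s.q r) := by
    intro r a ha
    by_cases hr : r = p
    · subst hr
      exact .inl ⟨rfl, by simpa [Config.setQ] using ha⟩
    · exact .inr ⟨hr, by simpa [Config.setQ, hr] using ha⟩
  refine ⟨h.valid, fun r a ha => ?_, fun r => ?_, fun r r' hr a ha ha' => ?_⟩
  · rcases hq r a ha with ⟨_, h1⟩ | ⟨_, h1⟩
    · exact hlt a h1
    · exact h.lt r a h1
  · by_cases hr : r = p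
    · subst hr
      simpa [Config.setQ] using hl
    · simpa [Config.setQ, hr] using h.nodup r
  · rcases hq r a ha with ⟨h0, h1⟩ | ⟨h0, h1⟩ <;> rcases hq r' a ha' with ⟨h2, h3⟩ | ⟨h2, h3⟩
    · exact hr (h0.trans h2.symm)
    · exact hd r' h2 a h1 h3
    · exact hd r h0 a h3 h1
    · exact h.disj r r' hr a h1 h3

/-- Moving qubits from `p` to `p'`. -/
theorem Good.setQ_setQ {s : Config} {e : Env} (h : Good s e) {p p' : ℕ} {l l' : List ℕ}
    (hl : l.Sublist (s.q p)) (hn : l'.Nodup)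
    (hmem : ∀ a ∈ l', a ∈ (s.setQ p l).q p' ∨ a ∈ s.q p ∧ a ∉ l) :
    Reach s e ((s.setQ p l).setQ p' l') e := by
  have h1 := h.setQ_sub p hl
  have hm : ∀ a ∈ l', ∃ r, a ∈ s.q r := by
    intro a ha
    rcases hmem a ha with h2 | h2
    · exact (h1.old p' a h2).elim
        (fun h3 => absurd (h1.good.lt p' a h2) (not_lt.2 h3)) id
    · exact ⟨p, h2.1⟩
  refine ⟨h1.good.setQ_disj p' hn (fun a ha => ?_) fun r hr a ha har => ?_, le_rfl,
    fun r a ha => .inr ?_⟩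
  · obtain ⟨r, hr⟩ := hm a ha
    exact h.lt r a hr
  · rcases hmem a ha with h2 | h2
    · exact h1.good.disj p' r (Ne.symm hr) a h2 har
    · by_cases hrp : r = p
      · subst hrp
        exact h2.2 (by simpa [Config.setQ] using har)
      · exact h.disj r p hrp a (by simpa [Config.setQ, hrp] using har) h2.1
  · by_cases hr : r = p'
    · subst hr
      exact hm a (by simpa [Config.setQ] using ha)
    · have ha' : a ∈ (s.setQ p l).q r := by simpa [Config.setQ, hr] using ha
      exact (h1.old r a ha').elim (fun h3 => absurd (h1.good.lt r a ha') (not_lt.2 h3)) id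

/-- Qubits can only be moved, discarded or freshly created, so no address ever occurs twice. A query
is covered because the oracle answers with fresh qubits. -/
theorem Instr.exec_reach {O : Oracle} (hO : O.Fresh) (i : Instr) (s : Config) (e : Env)
    (h : Good s e) : (i.exec O s).All e (Reach s e) := by
  have sp : ∀ k, (spend k s).All e fun s' e' => e' = e ∧ s'.q = s.q := fun k =>
    .spend fun _ => ⟨rfl, rfl⟩
  cases i with
  | push b r => exact .spend fun _ => h.reach_of_q rfl
  | pop r => exact .spend fun _ => h.reach_of_q rfl
  | copy r r' => exact .spend fun _ => h.reach_of_q rfl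
  | pair r₁ r₂ r' => exact .spend fun _ => h.reach_of_q rfl
  | unpair r r₁ r₂ => exact .spend fun _ => h.reach_of_q rfl
  | new p =>
    refine (sp 1).bind fun s' e' ⟨he, hs⟩ => ?_
    subst he
    have h' := h.reach_of_q hs
    intro y hy
    simp only [QM.bind_apply, QM.alloc, List.flatMap_singleton, QM.pure_apply,
      List.mem_singleton] at hy
    subst hy
    refine h'.trans ?_
    have hg := h'.good
    have h1 : Good s' e'.alloc := hg.env (Env.alloc_valid h.valid) (Nat.le_succ _)
    refine ⟨h1.setQ_disj p (List.nodup_cons.2 ⟨fun ha => lt_irrefl _ (hg.lt p _ ha), hg.nodup p⟩)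
      ?_ ?_, Nat.le_succ _, ?_⟩
    · intro a ha
      rcases List.mem_cons.1 ha with rfl | ha
      · exact Nat.lt_succ_self _
      · exact h1.lt p a ha
    · intro r hr a ha har
      rcases List.mem_cons.1 ha with rfl | ha
      · exact lt_irrefl _ (hg.lt r _ har)
      · exact hg.disj p r (Ne.symm hr) a ha har
    · intro r a ha
      by_cases hr : r = p
      · subst hr
        simp only [Config.setQ, Function.update_self, List.mem_cons] at ha
        rcases ha with rfl | ha
        · exact .inl le_rfl
        · exact .inr ⟨r, ha⟩
      · exact .inr ⟨r, by simpa [Config.setQ, hr] using ha⟩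
  | gate g p =>
    refine (sp 1).bind fun s' e' ⟨he, hs⟩ => ?_
    subst he
    have h' := h.reach_of_q hs
    split
    · exact .pure h'
    · rename_i a l hq
      intro y hy
      simp only [QM.bind_apply, QM.act, List.flatMap_singleton, QM.pure_apply,
        List.mem_singleton] at hy
      subst hy
      exact h'.trans (h'.good.reach_env (Env.gate_valid h.valid
        (h'.good.lt p a (by simp [hq]))) le_rfl)
  | cnot p p' =>
    refine (sp 1).bind fun s' e' ⟨he, hs⟩ => ?_
    subst he
    have h' := h.reach_of_q hs
    split
    · rename_i a l b l' hq hq'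
      split_ifs
      · exact .pure h'
      · intro y hy
        simp only [QM.bind_apply, QM.act, List.flatMap_singleton, QM.pure_apply,
          List.mem_singleton] at hy
        subst hy
        exact h'.trans (h'.good.reach_env (Env.cnot_valid h.valid
          (h'.good.lt p' b (by simp [hq']))) le_rfl)
    · exact .pure h'
  | measure p r =>
    refine (sp 1).bind fun s' e' ⟨he, hs⟩ => ?_
    subst he
    have h' := h.reach_of_q hs
    split
    · exact .pure h'
    · rename_i a l hq
      have h2 : ∀ x : Bool, ∀ b : List Bool,
          Reach s e' ((s'.setQ p l).setC r b) (e'.proj a x) := by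
        intro x b
        have h3 := h'.good.setQ_sub p (l := l) (by simp [hq])
        exact h'.trans (h3.trans ((h3.good.reach_env (Env.proj_valid h.valid a x)
          le_rfl).trans ((h3.good.env (Env.proj_valid h.valid a x) le_rfl).reach_of_q rfl)))
      intro y hy
      simp only [QM.bind_apply, QM.measure, List.flatMap_cons, List.flatMap_nil, QM.pure_apply,
        List.mem_append, List.mem_singleton, List.not_mem_nil, or_false] at hy
      rcases hy with rfl | rfl
      · exact h2 _ _
      · exact h2 _ _
  | move p p' =>
    rw [Instr.exec_move]
    split
    · exact .spend fun _ => h.reach_of_q rfl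
    · rename_i a l hq
      have hnd : (a :: l).Nodup := hq ▸ h.nodup p
      have h2 := h.setQ_setQ (p := p) (p' := p') (l := l) (l' := a :: (s.setQ p l).q p')
        (by simp [hq]) (List.nodup_cons.2 ⟨fun ha => ?_, (h.setQ_sub p (by simp [hq])).good.nodup _⟩)
        (fun b hb => ?_)
      · exact .spend fun _ => h2.trans (h2.good.reach_of_q rfl)
      -- If `p' = p`, the qubit is taken off and put back on the same register, and the claim is
      -- that it does not recur in the tail.
      · by_cases hp : p' = p
        · subst hp
          exact (List.nodup_cons.1 hnd).1 (by simpa [Config.setQ] using ha)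
        · exact h.disj p' p hp a (by simpa [Config.setQ, hp] using ha) (by simp [hq])
      · rcases List.mem_cons.1 hb with rfl | hb
        · exact .inr ⟨by simp [hq], (List.nodup_cons.1 hnd).1⟩
        · exact .inl hb
  | moveAll p p' =>
    have h2 := h.setQ_setQ (p := p) (p' := p') (l := []) (l' := s.q p) (by simp) (h.nodup p)
      (fun b hb => .inr ⟨hb, by simp⟩)
    exact .spend fun _ => h2.trans (h2.good.reach_of_q rfl)
  | query r r₁ r₂ p =>
    refine (sp _).bind fun s' e' ⟨he, hs⟩ => ?_
    subst he
    have h' := h.reach_of_q hs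
    refine (hO _ _ h.valid).bind fun t e'' ⟨h1, h2, h3, h4⟩ => ?_
    refine QM.All.bind (Q := fun s'' e3 => e3 = e'' ∧ s''.q = s'.q) (.spend fun _ => ⟨rfl, rfl⟩)
      fun s'' e3 ⟨h5, h6⟩ => .pure ?_
    subst h5
    have h7 : Good ((s''.setC r₁ t.1).setC r₂ t.2.1) e' := h.of_q (h6.trans hs)
    exact (h.reach_of_q (s' := (s''.setC r₁ t.1).setC r₂ t.2.1) (h6.trans hs)).trans (h7.setQ_fresh h1 h2 h3 h4 p)

theorem Prog.exec_reach {O : Oracle} (hO : O.Fresh) (P : Prog) (s : Config) (e : Env)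
    (h : Good s e) : (P.exec O s).All e (Reach s e) :=
  Prog.exec_all (I := Reach s e) (fun _ _ _ h => h.trans (h.good.reach_of_q rfl))
    (fun i s' e' h' => (Instr.exec_reach hO i s' e' h'.good).mono fun _ _ h2 => h'.trans h2)
    P s e h.reach

theorem Good.start {e : Env} (he : e.Valid) (ins : List Bits) {qs : List ℕ} (hn : qs.Nodup)
    (hl : ∀ a ∈ qs, a < e.next) (t : ℕ) : Good (Config.start ins qs t) e := by
  refine ⟨he, fun p a ha => ?_, fun p => ?_, fun p p' hp a ha ha' => ?_⟩
  · simp only [Config.start] at ha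
    split_ifs at ha
    · exact hl a ha
    · simp at ha
  · simp only [Config.start]
    split_ifs
    · exact hn
    · exact List.nodup_nil
  · simp only [Config.start] at ha ha'
    split_ifs at ha ha' <;> simp_all

/-- Without quantum input all qubits in the result are new, which is what makes signing oracles
`Fresh`. -/
theorem QPTAlg.run_reach (A : QPTAlg) {e : Env} (he : e.Valid) (ins : List Bits) {qs : List ℕ}
    (hn : qs.Nodup) (hl : ∀ a ∈ qs, a < e.next) :
    (A.run ins qs).All e fun s' e' => Good s' e' ∧ e.next ≤ e'.next ∧
      ∀ p, ∀ a ∈ s'.q p, e.next ≤ a ∨ a ∈ qs :=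
  (Prog.exec_reach nullOracle_fresh A.prog _ e (Good.start he ins hn hl _)).mono
    fun s' e' h => ⟨h.good, h.next_le, fun p a ha => (h.old p a ha).imp id fun ⟨p', hp'⟩ => by
      simp only [Config.start] at hp'
      split_ifs at hp'
      · exact hp'
      · simp at hp'⟩

/-! ### The length of strings -/

/-- All strings and lists of qubits have length at most `K - 2 * fuel`. -/
def Config.Short (K : ℕ) (s : Config) : Prop :=
  (∀ r, (s.c r).length + 2 * s.fuel ≤ K) ∧ ∀ p, (s.q p).length + 2 * s.fuel ≤ K

theorem pairCode_length (a b : Bits) : (pairCode a b).length = 2 * a.length + 1 + b.length := by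
  have : (a.flatMap fun x => [true, x]).length = 2 * a.length := by
    induction a with
    | nil => rfl
    | cons x a ih => simp only [List.flatMap_cons, List.length_append, ih, List.length_cons,
        List.length_nil]; omega
  simp only [pairCode, List.length_append, this, List.length_cons]
  omega

theorem unpairCode_length (a : Bits) :
    (unpairCode a).1.length + (unpairCode a).2.length ≤ a.length := by
  induction a using unpairCode.induct with
  | case1 x l ih => simp only [unpairCode, List.length_cons]; omega
  | case2 l => simp [unpairCode]
  | case3 l h1 h2 =>
    unfold unpairCode
    split
    · exact absurd rfl (h1 _ _)
    · exact absurd rfl (h2 _)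
    · simp

/-- Each step releases two units of the budget `K`. The factor two is dictated by `pair`: at cost `1
+ |a| + |b|` it produces a string of length `2|a| + 1 + |b|`. -/
theorem Config.Short.spend {K k : ℕ} {s s' : Config} {e : Env} (h : s.Short K)
    (hf : s'.fuel = s.fuel)
    (hc : ∀ r, (s'.c r).length ≤ (s.c r).length + 2 * k ∨ (s'.c r).length ≤ 2 * k)
    (hq : ∀ r, (s'.q r).length ≤ (s.q r).length + 2 * k ∨ (s'.q r).length ≤ 2 * k) :
    (QSig.spend k s').All e fun s'' _ => s''.Short K := by
  refine .spend fun hk => ⟨fun r => ?_, fun r => ?_⟩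
  · have h1 := h.1 r
    have h2 := hc r
    dsimp only
    omega
  · have h1 := h.2 r
    have h2 := hq r
    dsimp only
    omega

theorem length_update_le {α : Type*} (f : ℕ → List α) (r : ℕ) (x : List α) (r' : ℕ) (K : ℕ)
    (h : x.length ≤ (f r).length + K ∨ x.length ≤ K) :
    (Function.update f r x r').length ≤ (f r').length + K ∨
      (Function.update f r x r').length ≤ K := by
  by_cases hr : r' = r
  · subst hr; simpa using h
  · left; simp [hr]

theorem Instr.exec_short {O : Oracle} {K : ℕ} (i : Instr) (s : Config) (e : Env)
    (h : s.Short K) : (i.exec O s).All e fun s' _ => s'.Short K := by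
  have triv : ∀ (k : ℕ) (f : ℕ → Bits) (r : ℕ),
      (f r).length ≤ (f r).length + k ∨ (f r).length ≤ k := fun _ _ _ => by simp
  have trivq : ∀ (k : ℕ) (f : ℕ → List ℕ) (r : ℕ),
      (f r).length ≤ (f r).length + k ∨ (f r).length ≤ k := fun _ _ _ => by simp
  -- `new` and `measure` lengthen a register after paying for it; the bound `K - 2` records the room
  -- that the payment has created.
  have sp1 : (QSig.spend 1 s).All e fun s' _ => s'.Short K ∧ s'.Short (K - 2) ∧
      2 ≤ K ∧ s'.c = s.c ∧ s'.q = s.q :=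
    .spend fun hk => ⟨⟨fun r => by have := h.1 r; dsimp only; omega,
      fun r => by have := h.2 r; dsimp only; omega⟩, ⟨fun r => by have := h.1 r; dsimp only; omega,
      fun r => by have := h.2 r; dsimp only; omega⟩, by have := h.1 0; omega, rfl, rfl⟩
  cases i with
  | push b r =>
    exact h.spend rfl (fun r' => length_update_le _ _ _ _ _ (by simp)) (fun r => by simp [Config.setC])
  | pop r =>
    exact h.spend rfl (fun r' => length_update_le _ _ _ _ _ (by simp; omega)) (fun r => by simp [Config.setC])
  | copy r r' =>
    exact h.spend rfl (fun r' => length_update_le _ _ _ _ _ (by omega)) (fun r => by simp [Config.setC])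
  | pair r₁ r₂ r' =>
    exact h.spend rfl (fun r' => length_update_le _ _ _ _ _ (by rw [pairCode_length]; omega))
      (fun r => by simp [Config.setC])
  | unpair r r₁ r₂ =>
    have := unpairCode_length (s.c r)
    refine h.spend rfl (fun r' => ?_) (fun r => by simp [Config.setC])
    by_cases hr : r' = r₂
    · right
      simp [Config.setC, hr]; omega
    · by_cases hr' : r' = r₁
      · right
        simp only [Config.setC, Function.update_apply, hr', if_true]; split_ifs <;> omega
      · left
        simp [Config.setC, hr, hr']
  | new p =>
    refine sp1.bind fun s' e' h' => ?_
    intro y hy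
    simp only [QM.bind_apply, QM.alloc, List.flatMap_singleton, QM.pure_apply,
      List.mem_singleton] at hy
    subst hy
    refine ⟨h'.1.1, fun r => ?_⟩
    have h2 := h'.2.1.2 p
    have h3 := h'.1.2 r
    by_cases hr : r = p
    · subst hr
      simp [Config.setQ]
      omega
    · simpa [Config.setQ, hr] using h3
  | gate g p =>
    refine sp1.bind fun s' e' h' => ?_
    split
    · exact .pure h'.1
    · intro y hy
      simp only [QM.bind_apply, QM.act, List.flatMap_singleton, QM.pure_apply,
        List.mem_singleton] at hy
      subst hy
      exact h'.1
  | cnot p p' =>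
    refine sp1.bind fun s' e' h' => ?_
    split
    · split_ifs
      · exact .pure h'.1
      · intro y hy
        simp only [QM.bind_apply, QM.act, List.flatMap_singleton, QM.pure_apply,
          List.mem_singleton] at hy
        subst hy
        exact h'.1
    · exact .pure h'.1
  | measure p r =>
    refine sp1.bind fun s' e' h' => ?_
    split
    · exact .pure h'.1
    · rename_i a l hq
      have hS : ∀ x, ((s'.setQ p l).setC r (x :: s'.c r)).Short K := by
        refine fun x => ⟨fun r' => ?_, fun p' => ?_⟩
        · have h2 := h'.2.1.1 r
          have h3 := h'.1.1 r'
          by_cases hr : r' = r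
          · subst hr
            simp [Config.setQ, Config.setC]
            omega
          · simpa [Config.setQ, Config.setC, hr] using h3
        · have h3 := h'.1.2 p'
          by_cases hr : p' = p
          · subst hr
            rw [hq] at h3
            simp [Config.setQ, Config.setC] at h3 ⊢
            omega
          · simpa [Config.setQ, Config.setC, hr] using h3
      intro y hy
      simp only [QM.bind_apply, QM.measure, List.flatMap_cons, List.flatMap_nil, QM.pure_apply,
        List.mem_append, List.mem_singleton, List.not_mem_nil, or_false] at hy
      rcases hy with rfl | rfl
      · exact hS _
      · exact hS _
  | move p p' =>
    rw [Instr.exec_move]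
    split
    · exact h.spend rfl (fun _ => by simp) (fun _ => by simp)
    · rename_i a l hq
      refine h.spend rfl (fun r => by simp [Config.setQ]) (fun r => ?_)
      by_cases hr : r = p' <;> by_cases hp : r = p <;>
        simp_all [Config.setQ] <;> grind
  | moveAll p p' =>
    refine h.spend rfl (fun r => by simp [Config.setQ]) (fun r => ?_)
    by_cases hr : r = p' <;> by_cases hp : r = p <;>
      simp_all [Config.setQ]; omega
  | query r r₁ r₂ p =>
    refine QM.All.bind (Q := fun s' _ => s'.Short K ∧ s'.c = s.c)
      (.spend fun hk => ⟨⟨fun r => by have := h.1 r; dsimp only; omega,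
        fun r => by have := h.2 r; dsimp only; omega⟩, rfl⟩) fun s' e' h' => ?_
    -- Nothing has to be known about the length of the oracle's answer, since storing it costs as
    -- many steps as it is long.
    refine QM.All.bind (Q := fun _ _ => True) (fun _ _ => trivial) fun t e'' _ => ?_
    obtain ⟨x, y, l⟩ := t
    refine QM.All.bind (Q := fun s'' _ => s''.Short K ∧ x.length + y.length + l.length +
      s''.fuel ≤ s'.fuel) (.spend fun hk => ⟨⟨fun r => by have := h'.1.1 r; dsimp only; omega,
        fun r => by have := h'.1.2 r; dsimp only; omega⟩, by dsimp only at hk ⊢; omega⟩)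
      fun s'' e3 h3 => .pure ⟨fun r' => ?_, fun p' => ?_⟩
    · have h4 := h3.1.1 r'
      have h5 := h'.1.1 0
      have h6 := h3.2
      by_cases hr : r' = r₂
      · simp [Config.setC, Config.setQ, hr]; omega
      · by_cases hr' : r' = r₁
        · simp only [Config.setC, Config.setQ, Function.update_apply, hr', if_true]
          split_ifs <;> omega
        · simpa [Config.setC, Config.setQ, hr, hr'] using h4
    · have h4 := h3.1.2 p'
      have h5 := h'.1.1 0
      have h6 := h3.2
      by_cases hr : p' = p
      · simp [Config.setC, Config.setQ, hr]; omega
      · simpa [Config.setC, Config.setQ, hr] using h4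

theorem Prog.exec_short {O : Oracle} {K : ℕ} (P : Prog) (s : Config) (e : Env)
    (h : s.Short K) : (P.exec O s).All e fun s' _ => s'.Short K :=
  Prog.exec_all (I := fun s _ => s.Short K)
    (fun s e k h => ⟨fun r => by have := h.1 r; dsimp only; omega,
        fun r => by have := h.2 r; dsimp only; omega⟩)
    (fun i s' e' h' => Instr.exec_short i s' e' h') P s e h

theorem length_getD_le (ins : List Bits) (i : ℕ) :
    (ins.getD i []).length ≤ (ins.map List.length).sum := by
  induction ins generalizing i with
  | nil => simp
  | cons a l ih =>
    cases i with
    | zero => simp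
    | succ i => have := ih i; simp at this ⊢; omega

/-- The budget is the one of the initial configuration: the inputs plus twice the available steps.
-/
theorem QPTAlg.run_length (A : QPTAlg) (ins : List Bits) (qs : List ℕ) (e : Env) :
    (A.run ins qs).All e fun s' _ =>
      (∀ r, (s'.c r).length ≤ inputSize ins qs + 2 * A.time.eval (inputSize ins qs)) ∧
      ∀ r, (s'.q r).length ≤ inputSize ins qs + 2 * A.time.eval (inputSize ins qs) := by
  refine QM.All.mono (Prog.exec_short (K := inputSize ins qs + 2 * A.time.eval (inputSize ins qs))
    A.prog _ e ⟨fun r => ?_, fun r => ?_⟩) fun s' _ h => ⟨fun r => (Nat.le_add_right _ _).trans (h.1 r),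
      fun r => (Nat.le_add_right _ _).trans (h.2 r)⟩
  · have := length_getD_le ins r
    simp only [Config.start, inputSize]
    omega
  · simp only [Config.start, inputSize]
    split_ifs
    · omega
    · simp

/-! ### The total weight -/

theorem Env.weight_nonneg (e : Env) : 0 ≤ e.weight := Finset.sum_nonneg fun _ _ => by positivity

/-- Validity confines the support to the sets over which the weight sums, so vanishing weight leaves
no amplitude elsewhere. -/
theorem Env.amp_eq_zero {e : Env} (h : e.Valid) (h0 : e.weight = 0) : e.amp = 0 := by
  funext S
  by_contra hS
  have := (Finset.sum_eq_zero_iff_of_nonneg (fun _ _ => by positivity)).1 h0 S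
    (Finset.mem_powerset.2 (h S hS))
  simp only [pow_eq_zero_iff, ne_eq, OfNat.ofNat_ne_zero, not_false_eq_true, norm_eq_zero] at this
  exact hS this

theorem Env.weight_of_amp {e : Env} (h : e.amp = 0) : e.weight = 0 := by
  simp [Env.weight, h]

theorem Env.weight_alloc {e : Env} (h : e.Valid) : e.alloc.weight = e.weight := by
  simp only [Env.weight, Env.alloc]
  rw [Finset.range_add_one, Finset.sum_powerset_insert Finset.notMem_range_self]
  simp only [add_eq_left]
  refine Finset.sum_eq_zero fun S _ => ?_
  have : e.amp (insert e.next S) = 0 := by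
    by_contra hS
    exact absurd (h _ hS (Finset.mem_insert_self _ _)) Finset.notMem_range_self
  simp [this]

theorem Env.weight_proj (e : Env) (a : ℕ) :
    (e.proj a false).weight + (e.proj a true).weight = e.weight := by
  simp only [Env.weight, Env.proj]
  rw [← Finset.sum_add_distrib]
  refine Finset.sum_congr rfl fun S _ => ?_
  by_cases h : a ∈ S <;> simp [h]

/-- Unitarity of the two matrices: the parallelogram law for `H`, a phase of modulus one for `T`. -/
theorem Gate.normSq_entry (g : Gate) (α β : ℂ) :
    ‖g.entry false false * α + g.entry false true * β‖ ^ 2 +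
      ‖g.entry true false * α + g.entry true true * β‖ ^ 2 = ‖α‖ ^ 2 + ‖β‖ ^ 2 := by
  cases g with
  | H =>
    simp only [Gate.entry, Bool.and_true, Bool.and_false, if_true, Bool.false_eq_true, if_false]
    have h2 : (Real.sqrt 2) ^ 2 = 2 := Real.sq_sqrt (by norm_num)
    have e1 : (1 / (Real.sqrt 2 : ℂ)) * α + (1 / (Real.sqrt 2 : ℂ)) * β
        = (α + β) / (Real.sqrt 2 : ℂ) := by ring
    have e2 : (1 / (Real.sqrt 2 : ℂ)) * α + (-1 / (Real.sqrt 2 : ℂ)) * β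
        = (α - β) / (Real.sqrt 2 : ℂ) := by ring
    rw [e1, e2, norm_div, norm_div, div_pow, div_pow, Complex.norm_real, Real.norm_eq_abs, sq_abs, h2]
    have := parallelogram_law_with_norm ℝ α β
    nlinarith [this]
  | T =>
    have : ‖Complex.exp (Complex.I * Real.pi / 4)‖ = 1 := by
      rw [show Complex.I * (Real.pi : ℂ) / 4 = ((Real.pi / 4 : ℝ) : ℂ) * Complex.I by push_cast; ring]
      exact Complex.norm_exp_ofReal_mul_I _
    simp [Gate.entry, this]

/-- The basis sets are grouped into pairs `S`, `insert a S` with `a ∉ S`; the gate acts on each pair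
of amplitudes by its unitary matrix. -/
theorem Env.weight_gate (e : Env) (g : Gate) {a : ℕ} (ha : a < e.next) :
    (e.gate g a).weight = e.weight := by
  have hr : Finset.range e.next = insert a ((Finset.range e.next).erase a) :=
    (Finset.insert_erase (Finset.mem_range.2 ha)).symm
  simp only [Env.weight, Env.gate]
  rw [hr, Finset.sum_powerset_insert (Finset.notMem_erase _ _),
    Finset.sum_powerset_insert (Finset.notMem_erase _ _), ← Finset.sum_add_distrib,
    ← Finset.sum_add_distrib]
  refine Finset.sum_congr rfl fun S hS => ?_
  have haS : a ∉ S := fun h => Finset.notMem_erase _ _ (Finset.mem_powerset.1 hS h)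
  simp only [haS, decide_false, Finset.erase_eq_of_notMem haS, Finset.mem_insert_self, decide_true,
    Finset.erase_insert haS, Finset.insert_idem]
  exact g.normSq_entry _ _

/-- CNOT permutes the basis sets by an involution: as `a ≠ b`, flipping the target leaves the
control unchanged. -/
theorem Env.weight_cnot (e : Env) {a b : ℕ} (hab : a ≠ b) (hb : b < e.next) :
    (e.cnot a b).weight = e.weight := by
  simp only [Env.weight, Env.cnot]
  let φ : Finset ℕ → Finset ℕ := fun S => if a ∈ S then symmDiff S {b} else S
  have hmem : ∀ S : Finset ℕ, a ∈ symmDiff S {b} ↔ a ∈ S := fun S => by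
    simp [Finset.mem_symmDiff, hab]
  have hφ : ∀ S, φ (φ S) = S := by
    intro S
    by_cases h : a ∈ S
    · simp only [φ, h, if_true, (hmem S).2 h]
      rw [symmDiff_assoc, symmDiff_self, symmDiff_bot]
    · simp [φ, h]
  have hr : ∀ S ∈ (Finset.range e.next).powerset, φ S ∈ (Finset.range e.next).powerset := by
    intro S hS
    simp only [φ, Finset.mem_powerset] at hS ⊢
    split_ifs
    · intro c hc
      rcases Finset.mem_symmDiff.1 hc with ⟨h, _⟩ | ⟨h, _⟩
      · exact hS h
      · rw [Finset.mem_singleton] at h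
        subst h
        exact Finset.mem_range.2 hb
    · exact hS
  refine Finset.sum_nbij' φ φ hr hr (fun S _ => hφ S) (fun S _ => hφ S) fun S _ => ?_
  change _ = ‖e.amp (if a ∈ S then symmDiff S {b} else S)‖ ^ 2
  split_ifs <;> rfl

/-- Oracles that do not increase the weight. -/
def Oracle.Contracts (O : Oracle) : Prop :=
  ∀ m (e : Env), e.Valid → QM.total (O m) e ≤ e.weight

theorem nullOracle_contracts : nullOracle.Contracts := fun _ e _ => (QM.total_pure _ e).le

theorem QM.total_spend_le (k : ℕ) (s : Config) (e : Env) : QM.total (spend k s) e ≤ e.weight := by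
  unfold spend
  split_ifs
  · exact (QM.total_pure _ _).le
  · rw [QM.total_abort]
    exact e.weight_nonneg

theorem QM.total_bind_le_weight {α β : Type} {x : QM α} {f : α → QM β} {e : Env}
    (hx : QM.total x e ≤ e.weight) (h : x.All e fun a e' => QM.total (f a) e' ≤ e'.weight) :
    QM.total (x >>= f) e ≤ e.weight := (QM.total_bind_le h).trans hx

theorem QM.total_act (f : Env → Env) (e : Env) : QM.total (QM.act f) e = (f e).weight := by
  simp [QM.total, QM.act]

/-- Only an inequality can hold, because a branch that runs out of steps is abandoned and its weight
is lost. -/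
theorem Instr.exec_total {O : Oracle} (hO : O.Contracts) (i : Instr) (s : Config) (e : Env)
    (h : Good s e) : QM.total (i.exec O s) e ≤ e.weight := by
  have sp : ∀ k, (spend k s).All e fun s' e' => e' = e ∧ s'.q = s.q := fun k =>
    .spend fun _ => ⟨rfl, rfl⟩
  cases i with
  | push b r => exact QM.total_spend_le _ _ _
  | pop r => exact QM.total_spend_le _ _ _
  | copy r r' => exact QM.total_spend_le _ _ _
  | pair r₁ r₂ r' => exact QM.total_spend_le _ _ _
  | unpair r r₁ r₂ => exact QM.total_spend_le _ _ _
  | new p =>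
    refine QM.total_bind_le_weight (QM.total_spend_le _ _ _) ((sp 1).mono fun s' e' ⟨he, hs⟩ => ?_)
    subst he
    refine QM.total_bind_le_weight ?_ fun y _ => (QM.total_pure _ _).le
    simp [QM.total, QM.alloc, Env.weight_alloc h.valid]
  | gate g p =>
    refine QM.total_bind_le_weight (QM.total_spend_le _ _ _) ((sp 1).mono fun s' e' ⟨he, hs⟩ => ?_)
    subst he
    split
    · exact (QM.total_pure _ _).le
    · rename_i a l hq
      refine QM.total_bind_le_weight ?_ fun y _ => (QM.total_pure _ _).le
      rw [QM.total_act, Env.weight_gate]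
      exact h.lt p a (by rw [← hs, hq]; simp)
  | cnot p p' =>
    refine QM.total_bind_le_weight (QM.total_spend_le _ _ _) ((sp 1).mono fun s' e' ⟨he, hs⟩ => ?_)
    subst he
    split
    · rename_i a l b l' hq hq'
      split_ifs with hab
      · exact (QM.total_pure _ _).le
      · refine QM.total_bind_le_weight ?_ fun y _ => (QM.total_pure _ _).le
        rw [QM.total_act, Env.weight_cnot _ hab]
        exact h.lt p' b (by rw [← hs, hq']; simp)
    · exact (QM.total_pure _ _).le
  | measure p r =>
    refine QM.total_bind_le_weight (QM.total_spend_le _ _ _) ((sp 1).mono fun s' e' ⟨he, hs⟩ => ?_)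
    subst he
    split
    · exact (QM.total_pure _ _).le
    · refine QM.total_bind_le_weight ?_ fun y _ => (QM.total_pure _ _).le
      simpa [QM.total, QM.measure] using (Env.weight_proj e' _).le
  | move p p' =>
    rw [Instr.exec_move]
    split <;> exact QM.total_spend_le _ _ _
  | moveAll p p' => exact QM.total_spend_le _ _ _
  | query r r₁ r₂ p =>
    refine QM.total_bind_le_weight (QM.total_spend_le _ _ _) ((sp _).mono fun s' e' ⟨he, hs⟩ => ?_)
    subst he
    exact QM.total_bind_le_weight (hO _ _ h.valid) fun y _ =>
      QM.total_bind_le_weight (QM.total_spend_le _ _ _) fun y _ => (QM.total_pure _ _).le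

/-- This is the upper half of the proof that a program halts with certainty; the lower half comes
from covering an experiment of full weight. -/
theorem Prog.exec_total {O : Oracle} (hO : O.Contracts) (hO' : O.Fresh) (P : Prog) :
    ∀ (s : Config) (e : Env), Good s e → QM.total (P.exec O s) e ≤ e.weight := by
  have sp : ∀ s e k, Good s e → (spend k s).All e Good := fun s e k h =>
    .spend fun _ => h.of_q rfl
  induction P with
  | skip => exact fun s e _ => (QM.total_pure _ _).le
  | instr i => exact fun s e h => Instr.exec_total hO i s e h
  | seq P Q ihP ihQ =>
    exact fun s e h => QM.total_bind_le_weight (ihP s e h)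
      ((Prog.exec_reach hO' P s e h).mono fun s' e' h' => ihQ s' e' h'.good)
  | ite t P Q ihP ihQ =>
    intro s e h
    refine QM.total_bind_le_weight (QM.total_spend_le _ _ _) ((sp s e 1 h).mono fun s' e' h' => ?_)
    split_ifs
    · exact ihP _ _ h'
    · exact ihQ _ _ h'
  | loop t P ihP =>
    intro s e h
    refine QM.total_bind_le_weight (QM.total_spend_le _ _ _) ((sp s e 1 h).mono fun s' e' h' => ?_)
    have key : ∀ k s e, Good s e → QM.total (whileLoop t (P.exec O) k s) e ≤ e.weight := by
      intro k
      induction k with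
      | zero =>
        intro s e h
        unfold whileLoop
        split_ifs
        · rw [QM.total_abort]; exact e.weight_nonneg
        · exact (QM.total_pure _ _).le
      | succ k ih =>
        intro s e h
        unfold whileLoop
        split_ifs
        · exact QM.total_bind_le_weight (QM.total_spend_le _ _ _) ((sp s e 1 h).mono fun s' e' h' =>
            QM.total_bind_le_weight (ihP _ _ h')
              ((Prog.exec_reach hO' P _ _ h').mono fun s'' e'' h'' => ih _ _ h''.good))
        · exact (QM.total_pure _ _).le
    exact key _ _ _ h'

theorem QPTAlg.run_total (A : QPTAlg) {e : Env} (he : e.Valid) (ins : List Bits) {qs : List ℕ}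
    (hn : qs.Nodup) (hl : ∀ a ∈ qs, a < e.next) : QM.total (A.run ins qs) e = e.weight :=
  A.halts ins qs e he hn hl

/-! ### Additional qubits that are not used -/

/-- The new addresses of the qubits after the insertion of `d` qubits at address `N`. -/
def shift (N d a : ℕ) : ℕ := if a < N then a else a + d

theorem shift_injective (N d : ℕ) : Function.Injective (shift N d) := by
  intro a b h
  simp only [shift] at h
  split_ifs at h <;> omega

/-- The part of a set of qubits that consists of the inserted qubits. -/
def inserted (N d : ℕ) (S : Finset ℕ) : Finset ℕ := S.filter fun a => N ≤ a ∧ a < N + d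

/-- The part of a set of qubits that consists of the old qubits, with their old addresses. -/
def original (N d : ℕ) (S : Finset ℕ) : Finset ℕ := S.preimage (shift N d) (shift_injective N d).injOn

theorem mem_original {N d a : ℕ} {S : Finset ℕ} : a ∈ original N d S ↔ shift N d a ∈ S :=
  Finset.mem_preimage

theorem mem_inserted {N d a : ℕ} {S : Finset ℕ} :
    a ∈ inserted N d S ↔ a ∈ S ∧ N ≤ a ∧ a < N + d := Finset.mem_filter

theorem shift_not_inserted (N d a : ℕ) : ¬(N ≤ shift N d a ∧ shift N d a < N + d) := by
  simp only [shift]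
  split_ifs <;> omega

/-- Insert `d` qubits in the state `J` at address `N`. -/
def Env.embed (N d : ℕ) (J : Finset ℕ → ℂ) (e : Env) : Env where
  next := e.next + d
  amp := fun S => e.amp (original N d S) * J (inserted N d S)

/-- Rename the qubits. -/
def Config.mapQ (f : ℕ → ℕ) (s : Config) : Config := { s with q := fun p => (s.q p).map f }

theorem original_erase (N d a : ℕ) (S : Finset ℕ) :
    original N d (S.erase (shift N d a)) = (original N d S).erase a := by
  ext b
  simp [mem_original, (shift_injective N d).eq_iff]

theorem original_insert (N d a : ℕ) (S : Finset ℕ) :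
    original N d (insert (shift N d a) S) = insert a (original N d S) := by
  ext b
  simp [mem_original, (shift_injective N d).eq_iff]

theorem original_symmDiff (N d a : ℕ) (S : Finset ℕ) :
    original N d (symmDiff S {shift N d a}) = symmDiff (original N d S) {a} := by
  ext b
  simp [mem_original, Finset.mem_symmDiff, (shift_injective N d).eq_iff]

theorem inserted_erase (N d a : ℕ) (S : Finset ℕ) :
    inserted N d (S.erase (shift N d a)) = inserted N d S := by
  ext b
  simp only [mem_inserted, Finset.mem_erase]
  refine ⟨fun h => ⟨h.1.2, h.2⟩, fun h => ⟨⟨fun hb => ?_, h.1⟩, h.2⟩⟩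
  exact shift_not_inserted N d a (hb ▸ h.2)

theorem inserted_insert (N d a : ℕ) (S : Finset ℕ) :
    inserted N d (insert (shift N d a) S) = inserted N d S := by
  ext b
  simp only [mem_inserted, Finset.mem_insert]
  refine ⟨fun h => ⟨h.1.resolve_left fun hb => shift_not_inserted N d a (hb ▸ h.2), h.2⟩,
    fun h => ⟨.inr h.1, h.2⟩⟩

theorem inserted_symmDiff (N d a : ℕ) (S : Finset ℕ) :
    inserted N d (symmDiff S {shift N d a}) = inserted N d S := by
  ext b
  simp only [mem_inserted, Finset.mem_symmDiff, Finset.mem_singleton]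
  refine ⟨fun h => ⟨?_, h.2⟩, fun h => ⟨.inl ⟨h.1, fun hb => ?_⟩, h.2⟩⟩
  · rcases h.1 with h1 | h1
    · exact h1.1
    · exact absurd (h1.1 ▸ h.2) (shift_not_inserted N d a)
  · exact shift_not_inserted N d a (hb ▸ h.2)

section
variable {N d : ℕ} {J : Finset ℕ → ℂ}

/-- A shifted address is never one of the inserted ones, so the operation acts on the old tensor
factor alone and `J` is carried along unchanged. -/
theorem Env.embed_gate (g : Gate) (a : ℕ) (e : Env) :
    (e.embed N d J).gate g (shift N d a) = (e.gate g a).embed N d J := by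
  simp only [Env.embed, Env.gate, Env.mk.injEq, true_and]
  funext S
  simp only [original_erase, original_insert, inserted_erase, inserted_insert, mem_original]
  ring

theorem Env.embed_cnot (a b : ℕ) (e : Env) :
    (e.embed N d J).cnot (shift N d a) (shift N d b) = (e.cnot a b).embed N d J := by
  simp only [Env.embed, Env.cnot, Env.mk.injEq, true_and]
  funext S
  simp only [original_symmDiff, inserted_symmDiff, mem_original]
  split_ifs <;> rfl

theorem Env.embed_proj (a : ℕ) (x : Bool) (e : Env) :
    (e.embed N d J).proj (shift N d a) x = (e.proj a x).embed N d J := by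
  simp only [Env.embed, Env.proj, Env.mk.injEq, true_and]
  funext S
  simp only [mem_original]
  split_ifs <;> simp

theorem Env.embed_alloc (e : Env) : (e.embed N d J).alloc = e.alloc.embed N d J := by
  simp only [Env.embed, Env.alloc, Env.mk.injEq, and_true]
  omega

/-- The experiment `x'` behaves like `x` if `d` qubits in the state `J` are inserted at
address `N`, and results are renamed by `φ`. -/
def QM.Framed {α β : Type} (N d : ℕ) (J : Finset ℕ → ℂ) (φ : α → β) (x : QM α) (x' : QM β) : Prop :=
  ∀ e : Env, N ≤ e.next → (x' (e.embed N d J) = (x e).map fun y => (φ y.1, y.2.embed N d J)) ∧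
    ∀ y ∈ x e, N ≤ y.2.next

theorem QM.Framed.bind {α β γ δ : Type} {φ : α → β} {ψ : γ → δ} {x : QM α} {x' : QM β}
    {f : α → QM γ} {f' : β → QM δ} (hx : QM.Framed N d J φ x x')
    (hf : ∀ a, QM.Framed N d J ψ (f a) (f' (φ a))) :
    QM.Framed N d J ψ (x >>= f) (x' >>= f') := by
  intro e he
  obtain ⟨h1, h2⟩ := hx e he
  refine ⟨?_, fun y hy => ?_⟩
  · simp only [QM.bind_apply, h1, List.flatMap_map, List.map_flatMap]
    exact List.flatMap_congr fun y hy => (hf y.1 y.2 (h2 y hy)).1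
  · obtain ⟨z, hz, hy⟩ := List.mem_flatMap.1 hy
    exact (hf z.1 z.2 (h2 z hz)).2 y hy

theorem QM.Framed.pure {α β : Type} {φ : α → β} {a : α} {b : β} (h : φ a = b) :
    QM.Framed N d J φ (Pure.pure a) (Pure.pure b) := by
  intro e he
  subst h
  refine ⟨rfl, fun y hy => ?_⟩
  simp only [QM.pure_apply, List.mem_singleton] at hy
  subst hy
  exact he

theorem QM.Framed.abort {α β : Type} {φ : α → β} :
    QM.Framed N d J φ QM.abort QM.abort := fun _ _ => ⟨rfl, fun y hy => by cases hy⟩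

theorem QM.Framed.spend {k : ℕ} {s s' : Config} {f : ℕ → ℕ} (h : s.mapQ f = s') :
    QM.Framed N d J (Config.mapQ f) (QSig.spend k s) (QSig.spend k s') := by
  subst h
  unfold QSig.spend
  by_cases hk : k ≤ s.fuel
  · rw [if_pos hk, if_pos (show k ≤ (s.mapQ f).fuel from hk)]
    exact .pure rfl
  · rw [if_neg hk, if_neg (show ¬k ≤ (s.mapQ f).fuel from hk)]
    exact .abort

theorem QM.Framed.act {f f' : Env → Env} (hn : ∀ e, (f e).next = e.next)
    (h : ∀ e : Env, f' (e.embed N d J) = (f e).embed N d J) :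
    QM.Framed N d J id (QM.act f) (QM.act f') := by
  intro e he
  refine ⟨by simp [QM.act, h], fun y hy => ?_⟩
  simp only [QM.act, List.mem_singleton] at hy
  subst hy
  simpa [hn] using he

/-- This is the reason for the condition `N ≤ e.next` in `Framed`: a qubit allocated later lies
beyond the inserted ones, so its address `e.next + d` is the shift of `e.next`. -/
theorem QM.Framed.alloc : QM.Framed N d J (shift N d) QM.alloc QM.alloc := by
  intro e he
  refine ⟨?_, fun y hy => ?_⟩
  · simp only [QM.alloc, Env.embed_alloc, List.map_cons, List.map_nil, shift, not_lt.2 he, if_false]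
    rfl
  · simp only [QM.alloc, List.mem_singleton] at hy
    subst hy
    exact he.trans (Nat.le_succ _)

theorem QM.Framed.measure (a : ℕ) :
    QM.Framed N d J id (QM.measure a) (QM.measure (shift N d a)) := by
  intro e he
  refine ⟨by simp [QM.measure, Env.embed_proj], fun y hy => ?_⟩
  simp only [QM.measure, List.mem_cons, List.not_mem_nil, or_false] at hy
  rcases hy with rfl | rfl <;> exact he

theorem Config.mapQ_setC (f : ℕ → ℕ) (s : Config) (r : ℕ) (x : Bits) :
    (s.setC r x).mapQ f = (s.mapQ f).setC r x := rfl

theorem Config.mapQ_setQ (f : ℕ → ℕ) (s : Config) (p : ℕ) (l : List ℕ) :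
    (s.setQ p l).mapQ f = (s.mapQ f).setQ p (l.map f) := by
  simp only [Config.mapQ, Config.setQ, Config.mk.injEq, true_and, and_true]
  funext r
  simp only [Function.update_apply]
  split_ifs <;> rfl

/-- Oracles that do not use the inserted qubits. -/
def Oracle.Framed (N d : ℕ) (J : Finset ℕ → ℂ) (O : Oracle) : Prop :=
  ∀ m, QM.Framed N d J (fun t => (t.1, t.2.1, t.2.2.map (shift N d))) (O m) (O m)

theorem nullOracle_framed : nullOracle.Framed N d J := fun _ => .pure rfl

theorem Instr.exec_framed {O : Oracle} (hO : O.Framed N d J) (i : Instr) (s : Config) :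
    QM.Framed N d J (Config.mapQ (shift N d)) (i.exec O s) (i.exec O (s.mapQ (shift N d))) := by
  have hq : ∀ (s : Config) p, (s.mapQ (shift N d)).q p = (s.q p).map (shift N d) := fun _ _ => rfl
  cases i with
  | push b r => exact .spend rfl
  | pop r => exact .spend rfl
  | copy r r' => exact .spend rfl
  | pair r₁ r₂ r' => exact .spend rfl
  | unpair r r₁ r₂ => exact .spend rfl
  | new p =>
    exact (QM.Framed.spend rfl).bind fun s => QM.Framed.alloc.bind fun a =>
      .pure (by rw [Config.mapQ_setQ]; rfl)
  | gate g p =>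
    refine (QM.Framed.spend rfl).bind fun s => ?_
    rw [hq]
    cases h : s.q p with
    | nil => exact .pure rfl
    | cons a l =>
      exact (QM.Framed.act (f := Env.gate g a) (f' := Env.gate g (shift N d a)) (fun _ => rfl)
        (Env.embed_gate g a)).bind fun _ => .pure rfl
  | cnot p p' =>
    refine (QM.Framed.spend rfl).bind fun s => ?_
    rw [hq, hq]
    cases h : s.q p with
    | nil => exact .pure rfl
    | cons a l =>
      cases h' : s.q p' with
      | nil => exact .pure rfl
      | cons b l' =>
        simp only [List.map_cons, (shift_injective N d).eq_iff]
        split_ifs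
        · exact .pure rfl
        · exact (QM.Framed.act (f := Env.cnot a b)
            (f' := Env.cnot (shift N d a) (shift N d b)) (fun _ => rfl) (Env.embed_cnot a b)).bind fun _ => .pure rfl
  | measure p r =>
    refine (QM.Framed.spend rfl).bind fun s => ?_
    rw [hq]
    cases h : s.q p with
    | nil => exact .pure rfl
    | cons a l =>
      exact (QM.Framed.measure a).bind fun x => .pure (by
        rw [Config.mapQ_setC, Config.mapQ_setQ]; rfl)
  | move p p' =>
    rw [Instr.exec_move, Instr.exec_move, hq]
    cases h : s.q p with
    | nil => exact .spend rfl
    | cons a l =>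
      refine .spend ?_
      rw [Config.mapQ_setQ, Config.mapQ_setQ, List.map_cons, ← Config.mapQ_setQ, hq]
  | moveAll p p' =>
    have : (List.map (shift N d) (s.q p)).length = (s.q p).length := List.length_map _
    simp only [Instr.exec, hq, this]
    exact .spend (by rw [Config.mapQ_setQ, Config.mapQ_setQ]; rfl)
  | query r r₁ r₂ p =>
    refine (QM.Framed.spend rfl).bind fun s => ?_
    refine (hO _).bind fun t => ?_
    obtain ⟨x, y, l⟩ := t
    simp only [List.length_map]
    exact (QM.Framed.spend rfl).bind fun s => .pure (by rw [Config.mapQ_setQ]; rfl)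

theorem Test.eval_mapQ (t : Test) (f : ℕ → ℕ) (s : Config) : t.eval (s.mapQ f) = t.eval s := by
  cases t <;> rfl

/-- A program reaches qubits only through the addresses in its registers, and neither its tests nor
its costs depend on the values of these addresses. -/
theorem Prog.exec_framed {O : Oracle} (hO : O.Framed N d J) (P : Prog) : ∀ s : Config,
    QM.Framed N d J (Config.mapQ (shift N d)) (P.exec O s) (P.exec O (s.mapQ (shift N d))) := by
  induction P with
  | skip => exact fun s => .pure rfl
  | instr i => exact fun s => Instr.exec_framed hO i s
  | seq P Q ihP ihQ => exact fun s => (ihP s).bind ihQ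
  | ite t P Q ihP ihQ =>
    refine fun s => (QM.Framed.spend rfl).bind fun s => ?_
    rw [Test.eval_mapQ]
    split_ifs
    · exact ihP s
    · exact ihQ s
  | loop t P ihP =>
    refine fun s => (QM.Framed.spend rfl).bind fun s => ?_
    have key : ∀ k s, QM.Framed N d J (Config.mapQ (shift N d)) (whileLoop t (P.exec O) k s)
        (whileLoop t (P.exec O) k (s.mapQ (shift N d))) := by
      intro k
      induction k with
      | zero =>
        intro s
        unfold whileLoop
        rw [Test.eval_mapQ]
        split_ifs
        · exact .abort
        · exact .pure rfl
      | succ k ih =>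
        intro s
        unfold whileLoop
        rw [Test.eval_mapQ]
        split_ifs
        · exact (QM.Framed.spend rfl).bind fun s => (ihP s).bind ih
        · exact .pure rfl
    exact key _ _

theorem QPTAlg.run_framed (A : QPTAlg) (ins : List Bits) (qs : List ℕ) :
    QM.Framed N d J (Config.mapQ (shift N d)) (A.run ins qs) (A.run ins (qs.map (shift N d))) := by
  have h := Prog.exec_framed (J := J) (nullOracle_framed (N := N) (d := d)) A.prog
    (Config.start ins qs (A.time.eval (inputSize ins qs)))
  have hs : (Config.start ins qs (A.time.eval (inputSize ins qs))).mapQ (shift N d) =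
      Config.start ins (qs.map (shift N d))
        (A.time.eval (inputSize ins (qs.map (shift N d)))) := by
    simp only [Config.mapQ, Config.start, inputSize, List.length_map, Config.mk.injEq, true_and,
      and_true]
    funext p
    split_ifs <;> rfl
  rw [hs] at h
  exact h

/-- An algorithm without quantum input. -/
theorem QPTAlg.run_framed_nil (A : QPTAlg) (ins : List Bits) :
    QM.Framed N d J (Config.mapQ (shift N d)) (A.run ins []) (A.run ins []) :=
  A.run_framed ins []

/-- The squared norm of the state of the inserted qubits. -/
def insertedWeight (N d : ℕ) (J : Finset ℕ → ℂ) : ℝ :=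
  ∑ T ∈ (Finset.Ico N (N + d)).powerset, ‖J T‖ ^ 2

/-- The norm of a tensor product is multiplicative: a set of qubits corresponds to the pair of its
old and its inserted part. -/
theorem Env.weight_embed {e : Env} (he : N ≤ e.next) :
    (e.embed N d J).weight = insertedWeight N d J * e.weight := by
  rw [mul_comm, Env.weight, Env.weight, insertedWeight, Finset.sum_mul_sum, ← Finset.sum_product']
  refine Finset.sum_bij' (fun S _ => (original N d S, inserted N d S))
    (fun p _ => p.1.map ⟨shift N d, shift_injective N d⟩ ∪ p.2) ?_ ?_ ?_ ?_ ?_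
  · intro S hS
    simp only [Finset.mem_powerset, Env.embed] at hS
    simp only [Finset.mem_product, Finset.mem_powerset]
    refine ⟨fun a ha => ?_, fun a ha => ?_⟩
    · have h1 := Finset.mem_range.1 (hS (mem_original.1 ha))
      simp only [shift] at h1
      rw [Finset.mem_range]
      split_ifs at h1 <;> omega
    · exact Finset.mem_Ico.2 (mem_inserted.1 ha).2
  · intro p hp
    simp only [Finset.mem_product, Finset.mem_powerset] at hp
    simp only [Finset.mem_powerset, Env.embed]
    intro a ha
    rcases Finset.mem_union.1 ha with ha | ha
    · obtain ⟨b, hb, rfl⟩ := Finset.mem_map.1 ha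
      have := Finset.mem_range.1 (hp.1 hb)
      rw [Finset.mem_range]
      simp only [Function.Embedding.coeFn_mk, shift]
      split_ifs <;> omega
    · have := Finset.mem_Ico.1 (hp.2 ha)
      rw [Finset.mem_range]
      omega
  · intro S hS
    ext a
    simp only [Finset.mem_union, Finset.mem_map, mem_original, Function.Embedding.coeFn_mk,
      mem_inserted]
    constructor
    · rintro (⟨b, hb, rfl⟩ | h)
      · exact hb
      · exact h.1
    · intro ha
      by_cases h1 : a < N
      · exact .inl ⟨a, by simpa [shift, h1] using ha, by simp [shift, h1]⟩
      · by_cases h2 : a < N + d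
        · exact .inr ⟨ha, by omega, h2⟩
        · have h3 : shift N d (a - d) = a := by
            simp only [shift]
            split_ifs <;> omega
          exact .inl ⟨a - d, by rwa [h3], h3⟩
  · intro p hp
    simp only [Finset.mem_product, Finset.mem_powerset] at hp
    refine Prod.ext ?_ ?_
    · ext a
      simp only [mem_original, Finset.mem_union, Finset.mem_map, Function.Embedding.coeFn_mk]
      refine ⟨?_, fun h => .inl ⟨a, h, rfl⟩⟩
      rintro (⟨b, hb, h⟩ | h)
      · rwa [← shift_injective N d h]
      · exact absurd (Finset.mem_Ico.1 (hp.2 h)) (shift_not_inserted N d a)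
    · ext a
      simp only [mem_inserted, Finset.mem_union, Finset.mem_map, Function.Embedding.coeFn_mk]
      refine ⟨?_, fun h => ⟨.inr h, Finset.mem_Ico.1 (hp.2 h)⟩⟩
      rintro ⟨⟨b, _, rfl⟩ | h, h'⟩
      · exact absurd h' (shift_not_inserted N d b)
      · exact h
  · intro S _
    simp only [Env.embed, norm_mul, mul_pow]

end

/-! ### Probabilities of events, and independence of closed experiments. -/

open Classical in
/-- The probability that the result is true, from the given initial state. -/
def QM.val (x : QM Prop) (e : Env) : ℝ :=
  ((x e).map fun y => if y.1 then y.2.weight else 0).sum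

/-- Making the event the result of the experiment lets probabilities be rewritten with the monad
laws and estimated bind by bind. -/
theorem QM.prob_eq_val {α : Type} (x : QM α) (E : α → Prop) :
    x.prob E = QM.val (x >>= fun a => pure (E a)) Env.vac := by
  classical
  simp only [QM.prob, QM.val, QM.bind_apply, QM.pure_apply, sum_map_flatMap, List.map_cons,
    List.map_nil, List.sum_cons, List.sum_nil, add_zero]

theorem QM.val_bind {α : Type} (x : QM α) (f : α → QM Prop) (e : Env) :
    QM.val (x >>= f) e = ((x e).map fun y => QM.val (f y.1) y.2).sum := by
  classical
  simp only [QM.val, QM.bind_apply, sum_map_flatMap]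

theorem QM.val_pure (p : Prop) [Decidable p] (e : Env) :
    QM.val (pure p) e = if p then e.weight else 0 := by
  classical
  simp [QM.val, QM.pure_apply]

theorem QM.val_nonneg (x : QM Prop) (e : Env) : 0 ≤ QM.val x e := by
  classical
  refine List.sum_nonneg fun r hr => ?_
  obtain ⟨y, _, rfl⟩ := List.mem_map.1 hr
  split_ifs
  · exact y.2.weight_nonneg
  · exact le_rfl

theorem QM.val_le_total (x : QM Prop) (e : Env) : QM.val x e ≤ QM.total x e := by
  classical
  refine List.sum_le_sum fun y _ => ?_
  split_ifs
  · exact le_rfl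
  · exact y.2.weight_nonneg

theorem QM.val_bind_congr {α : Type} {x : QM α} {f g : α → QM Prop} {e : Env}
    (h : x.All e fun a e' => QM.val (f a) e' = QM.val (g a) e') :
    QM.val (x >>= f) e = QM.val (x >>= g) e := by
  rw [QM.val_bind, QM.val_bind]
  congr 1
  exact List.map_congr_left fun y hy => h y hy

theorem QM.val_bind_mono {α : Type} {x : QM α} {f g : α → QM Prop} {e : Env}
    (h : x.All e fun a e' => QM.val (f a) e' ≤ QM.val (g a) e') :
    QM.val (x >>= f) e ≤ QM.val (x >>= g) e := by
  rw [QM.val_bind, QM.val_bind]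
  exact List.sum_le_sum fun y hy => h y hy

/-- Qubits that the experiment does not touch contribute only their squared norm as a factor. -/
theorem QM.val_framed {N d : ℕ} {J : Finset ℕ → ℂ} {x : QM Prop}
    (h : QM.Framed N d J id x x) {e : Env} (he : N ≤ e.next) :
    QM.val x (e.embed N d J) = insertedWeight N d J * QM.val x e := by
  classical
  obtain ⟨h1, h2⟩ := h e he
  simp only [QM.val, h1, List.map_map]
  rw [← List.sum_map_mul_left]
  congr 1
  refine List.map_congr_left fun y hy => ?_
  simp only [Function.comp_apply, id_eq]
  split_ifs
  · exact Env.weight_embed (h2 y hy)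
  · simp

theorem Env.vac_valid : Env.vac.Valid := by
  intro S hS
  simp only [Env.vac] at hS ⊢
  split_ifs at hS with h
  · simp [h]
  · exact absurd rfl hS

theorem Env.weight_vac : Env.vac.weight = 1 := by
  simp [Env.weight, Env.vac]

/-- Any memory arises from the vacuum by inserting all of its qubits. Hence the run of a closed
experiment in any memory is determined by its run from the vacuum. -/
theorem Env.eq_embed_vac {e : Env} (he : e.Valid) : e = Env.vac.embed 0 e.next e.amp := by
  cases e with
  | mk n amp =>
  simp only [Env.embed, Env.vac, Env.mk.injEq, Nat.zero_add, true_and]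
  funext S
  by_cases hS : S ⊆ Finset.range n
  · have h1 : original 0 n S = ∅ := by
      rw [Finset.eq_empty_iff_forall_notMem]
      intro a ha
      have := Finset.mem_range.1 (hS (mem_original.1 ha))
      simp [shift] at this
    have h2 : inserted 0 n S = S := Finset.filter_true_of_mem fun a ha =>
      ⟨Nat.zero_le a, by simpa using hS ha⟩
    simp [h1, h2]
  · have h0 : amp S = 0 := by
      by_contra h
      exact hS (he S h)
    rw [h0, eq_comm, mul_eq_zero, or_iff_not_imp_left]
    intro h
    split_ifs at h with h1
    · obtain ⟨a, ha, ha'⟩ := Finset.not_subset.1 hS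
      rw [Finset.mem_range, not_lt] at ha'
      have : a - n ∈ original 0 n S := mem_original.2 (by
        simpa [shift, Nat.sub_add_cancel ha'] using ha)
      rw [h1] at this
      exact absurd this (Finset.notMem_empty _)
    · exact absurd rfl h

/-- The state of a second memory `e'`, whose qubits follow those of a first memory with `N`
qubits. -/
def Env.behind (N : ℕ) (e' : Env) (T : Finset ℕ) : ℂ := e'.amp (original 0 N T)

theorem Env.insertedWeight_behind (N : ℕ) (e' : Env) :
    insertedWeight N e'.next (e'.behind N) = e'.weight := by
  rw [insertedWeight, Env.weight]
  refine Finset.sum_bij' (fun T _ => original 0 N T)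
    (fun S _ => S.map ⟨shift 0 N, shift_injective 0 N⟩) ?_ ?_ ?_ ?_ ?_
  · intro T hT
    rw [Finset.mem_powerset] at hT ⊢
    intro a ha
    have := Finset.mem_Ico.1 (hT (mem_original.1 ha))
    simp only [shift, Nat.not_lt_zero, if_false] at this
    rw [Finset.mem_range]
    omega
  · intro S hS
    rw [Finset.mem_powerset] at hS ⊢
    intro a ha
    obtain ⟨b, hb, rfl⟩ := Finset.mem_map.1 ha
    have := Finset.mem_range.1 (hS hb)
    rw [Finset.mem_Ico]
    simp only [Function.Embedding.coeFn_mk, shift, Nat.not_lt_zero, if_false]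
    omega
  · intro T hT
    rw [Finset.mem_powerset] at hT
    ext a
    simp only [Finset.mem_map, mem_original, Function.Embedding.coeFn_mk]
    refine ⟨by rintro ⟨b, hb, rfl⟩; exact hb, fun ha => ?_⟩
    have h1 := Finset.mem_Ico.1 (hT ha)
    have h3 : shift 0 N (a - N) = a := by
      simp only [shift, Nat.not_lt_zero, if_false]; omega
    exact ⟨a - N, by rwa [h3], h3⟩
  · intro S _
    ext a
    simp [mem_original]
  · intro T _
    rfl

/-- Both sides are the tensor product with the qubits of `e` before those of `e'`, seen as `e` put
in front of `e'` or as `e'` appended to `e`. -/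
theorem Env.embed_comm {e e' : Env} (he : e.Valid) (he' : e'.Valid) :
    e'.embed 0 e.next e.amp = e.embed e.next e'.next (e'.behind e.next) := by
  simp only [Env.embed, Env.mk.injEq]
  refine ⟨add_comm _ _, ?_⟩
  funext S
  by_cases hS : S ⊆ Finset.range (e.next + e'.next)
  · have h1 : inserted 0 e.next S = original e.next e'.next S := by
      ext a
      rw [mem_inserted, mem_original]
      simp only [shift]
      by_cases ha : a < e.next
      · simp [ha]
      · simp only [ha, if_false, Nat.zero_le, zero_add, and_false, false_iff]
        intro h
        have := Finset.mem_range.1 (hS h)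
        omega
    have h2 : original 0 e.next S = original 0 e.next (inserted e.next e'.next S) := by
      ext a
      rw [mem_original, mem_original, mem_inserted, iff_self_and]
      intro h
      have := Finset.mem_range.1 (hS h)
      simp only [shift, Nat.not_lt_zero, if_false] at this ⊢
      omega
    rw [Env.behind, h1, ← h2, mul_comm]
  · obtain ⟨a, ha, ha'⟩ := Finset.not_subset.1 hS
    rw [Finset.mem_range, not_lt] at ha'
    have h1 : e'.amp (original 0 e.next S) = 0 := by
      by_contra h
      have h3 : shift 0 e.next (a - e.next) = a := by
        simp only [shift, Nat.not_lt_zero, if_false]; omega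
      have := Finset.mem_range.1 (he' _ h (mem_original.2 (h3.symm ▸ ha)))
      omega
    have h2 : e.amp (original e.next e'.next S) = 0 := by
      by_contra h
      have h3 : shift e.next e'.next (a - e'.next) = a := by
        simp only [shift]
        split_ifs <;> omega
      have := Finset.mem_range.1 (he _ h (mem_original.2 (h3.symm ▸ ha)))
      omega
    rw [h1, h2, zero_mul, zero_mul]

/-- An experiment with a classical result that does not use the qubits that exist before. -/
def QM.Closed {α : Type} (x : QM α) : Prop :=
  (∀ N d J, QM.Framed N d J id x x) ∧ x.All Env.vac fun _ e => e.Valid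

/-- The result of a closed experiment is independent of the rest of the memory. -/
theorem QM.val_closed_bind {β : Type} {y : QM β} (hy : y.Closed) {f : β → QM Prop} {e : Env}
    (he : e.Valid) (hf : y.All Env.vac fun b _ => ∀ d J, QM.Framed e.next d J id (f b) (f b)) :
    QM.val (y >>= f) e = ((y Env.vac).map fun b => b.2.weight * QM.val (f b.1) e).sum := by
  -- The run of `y` in `e` is its run from the vacuum with the qubits of `e` inserted at address
  -- `0`.
  have h1 := (hy.1 0 e.next e.amp Env.vac (Nat.zero_le _)).1
  rw [← Env.eq_embed_vac he] at h1
  rw [QM.val_bind, h1, List.map_map]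
  congr 1
  refine List.map_congr_left fun b hb => ?_
  simp only [Function.comp_apply, id_eq]
  -- For the continuation, the qubits of `y` are appended behind those of `e`. It does not touch
  -- them, so they only contribute the weight of the branch.
  rw [Env.embed_comm he (hy.2 b hb), QM.val_framed (hf b hb _ _) le_rfl, Env.insertedWeight_behind]

/-- A closed experiment commutes with others. -/
theorem QM.val_comm {α β : Type} {x : QM α} {y : QM β} (hy : y.Closed) {f : α → β → QM Prop}
    {e : Env} (he : e.Valid)
    (hf : x.All e fun a e' => e'.Valid ∧ y.All Env.vac fun b _ =>
      ∀ d J, QM.Framed e'.next d J id (f a b) (f a b))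
    (hxf : y.All Env.vac fun b _ => ∀ d J,
      QM.Framed e.next d J id (x >>= fun a => f a b) (x >>= fun a => f a b)) :
    QM.val (x >>= fun a => y >>= fun b => f a b) e =
      QM.val (y >>= fun b => x >>= fun a => f a b) e := by
  -- Both sides become the same double sum, over the branches of `x` from `e` and the branches of
  -- `y` from the vacuum.
  rw [QM.val_bind, QM.val_closed_bind hy he hxf]
  have h1 : ((x e).map fun a => QM.val (y >>= fun b => f a.1 b) a.2) =
      (x e).map fun a => ((y Env.vac).map fun b => b.2.weight * QM.val (f a.1 b.1) a.2).sum :=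
    List.map_congr_left fun a ha => QM.val_closed_bind hy (hf a ha).1 (hf a ha).2
  rw [h1]
  simp only [QM.val_bind, ← List.sum_map_mul_left]
  generalize x e = l
  generalize y Env.vac = l'
  induction l with
  | nil => simp
  | cons a l ih => simp [ih, List.sum_map_add]

/-! ### Comparison of experiments -/

/-- Each branch in the first list, except those of amplitude zero, has a counterpart in the second
list, with the same state of the quantum memory and with a related result. -/
inductive Cov {α β : Type} (R : α → β → Prop) : List (α × Env) → List (β × Env) → Prop
  | nil (l : List (β × Env)) : Cov R [] l
  | zero {a : α} {e : Env} {l : List (α × Env)} {l' : List (β × Env)} (he : e.amp = 0)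
      (h : Cov R l l') : Cov R ((a, e) :: l) l'
  | skip {b : β × Env} {l : List (α × Env)} {l' : List (β × Env)} (h : Cov R l l') :
      Cov R l (b :: l')
  | cons {a : α} {b : β} {e : Env} {l : List (α × Env)} {l' : List (β × Env)} (hab : R a b)
      (h : Cov R l l') : Cov R ((a, e) :: l) ((b, e) :: l')

namespace Cov

variable {α β γ δ : Type} {R : α → β → Prop}

theorem skip_append {l : List (α × Env)} {l' : List (β × Env)} (h : Cov R l l')
    (l'' : List (β × Env)) : Cov R l (l'' ++ l') := by
  induction l'' with
  | nil => exact h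
  | cons b l'' ih => exact .skip ih

theorem zero_append {l : List (α × Env)} {l' : List (β × Env)} (h : Cov R l l') :
    ∀ l'' : List (α × Env), (∀ y ∈ l'', y.2.amp = 0) → Cov R (l'' ++ l) l'
  | [], _ => h
  | (a, e) :: l'', h0 => .zero (h0 (a, e) (by simp))
      (zero_append h l'' fun y hy => h0 y (List.mem_cons_of_mem _ hy))

theorem append {l₁ l₂ : List (α × Env)} {l₁' l₂' : List (β × Env)} (h₁ : Cov R l₁ l₁')
    (h₂ : Cov R l₂ l₂') : Cov R (l₁ ++ l₂) (l₁' ++ l₂') := by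
  induction h₁ with
  | nil l => exact h₂.skip_append l
  | zero he _ ih => exact .zero he ih
  | skip _ ih => exact .skip ih
  | cons hab _ ih => exact .cons hab ih

theorem mono {R' : α → β → Prop} {l : List (α × Env)} {l' : List (β × Env)} (h : Cov R l l')
    (hR : ∀ a b, R a b → R' a b) : Cov R' l l' := by
  induction h with
  | nil l => exact .nil l
  | zero he _ ih => exact .zero he ih
  | skip _ ih => exact .skip ih
  | cons hab _ ih => exact .cons (hR _ _ hab) ih

/-- Matched branches share their memory, so whatever is known about all branches of either list can
be added to the relation. -/
theorem with_mem {l : List (α × Env)} {l' : List (β × Env)} (h : Cov R l l') :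
    Cov (fun a b => R a b ∧ ∃ e, (a, e) ∈ l ∧ (b, e) ∈ l') l l' := by
  induction h with
  | nil l => exact .nil l
  | zero he _ ih =>
    exact .zero he (ih.mono fun a b ⟨h, e, h1, h2⟩ => ⟨h, e, List.mem_cons_of_mem _ h1, h2⟩)
  | skip _ ih =>
    exact .skip (ih.mono fun a b ⟨h, e, h1, h2⟩ => ⟨h, e, h1, List.mem_cons_of_mem _ h2⟩)
  | cons hab _ ih =>
    exact .cons ⟨hab, _, List.mem_cons_self, List.mem_cons_self⟩ (ih.mono fun a b ⟨h, e, h1, h2⟩ =>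
      ⟨h, e, List.mem_cons_of_mem _ h1, List.mem_cons_of_mem _ h2⟩)

theorem refl {R : α → α → Prop} : ∀ l : List (α × Env), (∀ y ∈ l, R y.1 y.1) → Cov R l l
  | [], _ => .nil _
  | (a, e) :: l, h => .cons (h (a, e) (by simp)) (refl l fun y hy => h y (List.mem_cons_of_mem _ hy))

/-- A branch of the middle list that is dropped for having amplitude zero also has amplitude zero in
the first list, since matched branches have the same memory. -/
theorem trans {R' : β → γ → Prop} {l : List (α × Env)} {l' : List (β × Env)}
    {l'' : List (γ × Env)} (h : Cov R l l') (h' : Cov R' l' l'') :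
    Cov (fun a c => ∃ b, R a b ∧ R' b c) l l'' := by
  induction h' generalizing l with
  | nil l' =>
    generalize hm : ([] : List (β × Env)) = m at h
    induction h with
    | nil l => exact .nil _
    | zero he _ ih => exact .zero he (ih hm)
    | skip _ _ => cases hm
    | cons _ _ _ => cases hm
  | @zero b e m m' he _ ih =>
    generalize hm : (b, e) :: m = n at h
    induction h with
    | nil l => exact .nil _
    | zero he' _ ih' => exact .zero he' (ih' hm)
    | skip h _ => cases hm; exact ih h
    | cons _ h _ => cases hm; exact .zero he (ih h)
  | skip _ ih => exact .skip (ih h)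
  | @cons b c e m m' hbc _ ih =>
    generalize hm : (b, e) :: m = n at h
    induction h with
    | nil l => exact .nil _
    | zero he' _ ih' => exact .zero he' (ih' hm)
    | skip h _ => cases hm; exact .skip (ih h)
    | cons hab h _ => cases hm; exact .cons ⟨b, hab, hbc⟩ (ih h)

/-- Linearity of `f` serves the branches of amplitude zero in the first list: all their
continuations have to be dropped as well. -/
theorem flatMap {R' : γ → δ → Prop} {l : List (α × Env)} {l' : List (β × Env)} {f : α → QM γ}
    {g : β → QM δ} (h : Cov R l l') (hf : ∀ a, (f a).Linear)
    (hfg : ∀ a b e, (a, e) ∈ l → (b, e) ∈ l' → R a b → Cov R' (f a e) (g b e)) :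
    Cov R' (l.flatMap fun y => f y.1 y.2) (l'.flatMap fun y => g y.1 y.2) := by
  induction h with
  | nil l => exact .nil _
  | @zero a e l l' he _ ih =>
    exact (ih fun a b e h1 h2 => hfg a b e (List.mem_cons_of_mem _ h1) h2).zero_append _ (hf a e he)
  | skip _ ih =>
    exact (ih fun a b e h1 h2 => hfg a b e h1 (List.mem_cons_of_mem _ h2)).skip_append _
  | @cons a b e l l' hab _ ih =>
    exact (hfg a b e List.mem_cons_self List.mem_cons_self hab).append
      (ih fun a b e h1 h2 => hfg a b e (List.mem_cons_of_mem _ h1) (List.mem_cons_of_mem _ h2))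

theorem bind {R' : γ → δ → Prop} {x : QM α} {y : QM β} {e : Env} {f : α → QM γ}
    {g : β → QM δ} (h : Cov R (x e) (y e)) (hf : ∀ a, (f a).Linear)
    (hfg : ∀ a b e', (a, e') ∈ x e → (b, e') ∈ y e → R a b → Cov R' (f a e') (g b e')) :
    Cov R' ((x >>= f) e) ((y >>= g) e) := h.flatMap hf hfg

theorem bind_refl {R' : γ → δ → Prop} {x : QM α} {e : Env} {f : α → QM γ} {g : α → QM δ}
    (hf : ∀ a, (f a).Linear) (hfg : ∀ a e', (a, e') ∈ x e → Cov R' (f a e') (g a e')) :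
    Cov R' ((x >>= f) e) ((x >>= g) e) :=
  (Cov.refl (R := Eq) (x e) fun _ _ => rfl).flatMap hf fun a _ e' h1 _ hab => hab ▸ hfg a e' h1

theorem total_le {l : List (α × Env)} {l' : List (β × Env)} (h : Cov R l l') :
    (l.map fun y => y.2.weight).sum ≤ (l'.map fun y => y.2.weight).sum := by
  induction h with
  | nil l =>
    refine List.sum_nonneg fun r hr => ?_
    obtain ⟨y, _, rfl⟩ := List.mem_map.1 hr
    exact y.2.weight_nonneg
  | zero he _ ih => simpa [Env.weight_of_amp he] using ih
  | @skip b _ _ _ ih =>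
    simp only [List.map_cons, List.sum_cons]
    have := b.2.weight_nonneg
    linarith
  | cons _ _ ih => simpa using ih

/-- Dropped branches contribute nothing, and additional branches of the second list contribute a
nonnegative amount. -/
theorem val_le {x y : QM Prop} {e : Env} (h : Cov (fun p q => p → q) (x e) (y e)) :
    QM.val x e ≤ QM.val y e := by
  classical
  unfold QM.val
  generalize x e = l at h
  generalize y e = l' at h
  induction h with
  | nil l =>
    refine List.sum_nonneg fun r hr => ?_
    obtain ⟨y, _, rfl⟩ := List.mem_map.1 hr
    split_ifs
    · exact y.2.weight_nonneg
    · exact le_rfl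
  | zero he _ ih => simpa [Env.weight_of_amp he] using ih
  | @skip b _ _ _ ih =>
    simp only [List.map_cons, List.sum_cons]
    have := b.2.weight_nonneg
    split_ifs <;> linarith
  | @cons a b e _ _ hab _ ih =>
    simp only [List.map_cons, List.sum_cons]
    have := e.weight_nonneg
    refine add_le_add ?_ ih
    split_ifs with h1 h2
    · exact le_rfl
    · exact absurd (hab h1) h2
    · exact this
    · exact le_rfl

/-- If the second list has no greater total weight, the additional branches there have amplitude
zero. -/
theorem reverse {l : List (α × Env)} {l' : List (β × Env)} (h : Cov R l l')
    (hv : ∀ y ∈ l', y.2.Valid)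
    (hw : (l'.map fun y => y.2.weight).sum ≤ (l.map fun y => y.2.weight).sum) :
    Cov (fun b a => R a b) l' l := by
  induction h with
  | nil l =>
    have : ∀ y ∈ l, y.2.amp = 0 := by
      intro y hy
      refine Env.amp_eq_zero (hv y hy) (le_antisymm ?_ y.2.weight_nonneg)
      have h1 : y.2.weight ≤ (l.map fun y => y.2.weight).sum :=
        List.single_le_sum (fun r hr => by
          obtain ⟨y, _, rfl⟩ := List.mem_map.1 hr
          exact y.2.weight_nonneg) _ (List.mem_map.2 ⟨y, hy, rfl⟩)
      simpa using h1.trans hw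
    simpa using (Cov.nil (R := fun b a => R a b) []).zero_append l this
  | zero he _ ih => exact .skip (ih hv (by simpa [Env.weight_of_amp he] using hw))
  | @skip b l l' h ih =>
    have h1 := h.total_le
    have h2 := b.2.weight_nonneg
    simp only [List.map_cons, List.sum_cons] at hw
    -- The rest of the second list already weighs at least as much as the first list, so nothing is
    -- left for the skipped branch.
    exact .zero (Env.amp_eq_zero (hv b List.mem_cons_self) (by linarith))
      (ih (fun y hy => hv y (List.mem_cons_of_mem _ hy)) (by linarith))
  | cons hab _ ih =>
    exact .cons hab (ih (fun y hy => hv y (List.mem_cons_of_mem _ hy)) (by simpa using hw))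

end Cov

theorem spend_eq {k : ℕ} {s : Config} (h : k ≤ s.fuel) :
    spend k s = pure { s with fuel := s.fuel - k } := if_pos h

theorem Prog.exec_seq (O : Oracle) (P Q : Prog) (s : Config) :
    (Prog.seq P Q).exec O s = P.exec O s >>= Q.exec O := rfl

theorem Prog.exec_seq_pure {O : Oracle} {P Q : Prog} {s s' : Config}
    (h : P.exec O s = pure s') : (Prog.seq P Q).exec O s = Q.exec O s' := by
  rw [Prog.exec_seq, h, pure_bind]

/-! ### Programs in other registers -/

/-- A number that is greater than those of all registers that are used. -/
def Instr.bound : Instr → ℕ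
  | .push _ r => r + 1
  | .pop r => r + 1
  | .copy r r' => r + r' + 1
  | .pair r₁ r₂ r' => r₁ + r₂ + r' + 1
  | .unpair r r₁ r₂ => r + r₁ + r₂ + 1
  | .new p => p + 1
  | .gate _ p => p + 1
  | .cnot p p' => p + p' + 1
  | .measure p r => p + r + 1
  | .move p p' => p + p' + 1
  | .moveAll p p' => p + p' + 1
  | .query r r₁ r₂ p => r + r₁ + r₂ + p + 1

def Test.bound : Test → ℕ
  | .nonempty r => r + 1
  | .head r => r + 1

def Prog.bound : Prog → ℕ
  | .skip => 0
  | .instr i => i.bound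
  | .seq P Q => P.bound + Q.bound
  | .ite t P Q => t.bound + P.bound + Q.bound
  | .loop t P => t.bound + P.bound

/-- Rename the registers by `f`, and replace queries by the programs `Q`. -/
def Instr.inline (f : ℕ → ℕ) (Q : ℕ → ℕ → ℕ → ℕ → Prog) : Instr → Prog
  | .push b r => .instr (.push b (f r))
  | .pop r => .instr (.pop (f r))
  | .copy r r' => .instr (.copy (f r) (f r'))
  | .pair r₁ r₂ r' => .instr (.pair (f r₁) (f r₂) (f r'))
  | .unpair r r₁ r₂ => .instr (.unpair (f r) (f r₁) (f r₂))
  | .new p => .instr (.new (f p))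
  | .gate g p => .instr (.gate g (f p))
  | .cnot p p' => .instr (.cnot (f p) (f p'))
  | .measure p r => .instr (.measure (f p) (f r))
  | .move p p' => .instr (.move (f p) (f p'))
  | .moveAll p p' => .instr (.moveAll (f p) (f p'))
  | .query r r₁ r₂ p => Q r r₁ r₂ p

def Test.inline (f : ℕ → ℕ) : Test → Test
  | .nonempty r => .nonempty (f r)
  | .head r => .head (f r)

def Prog.inline (f : ℕ → ℕ) (Q : ℕ → ℕ → ℕ → ℕ → Prog) : Prog → Prog
  | .skip => .skip
  | .instr i => i.inline f Q
  | .seq P P' => .seq (P.inline f Q) (P'.inline f Q)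
  | .ite t P P' => .ite (t.inline f) (P.inline f Q) (P'.inline f Q)
  | .loop t P => .loop (t.inline f) (P.inline f Q)

/-- The configuration `s'` contains `s` in the registers `f 0, …, f (B - 1)`; it has `C` steps for
each step of `s`, and `D` additional steps, and satisfies the invariant `I`, which may depend on
the queries in `s`. -/
structure Hosts (f : ℕ → ℕ) (B C D T : ℕ) (I : List Bits → Config → Prop) (s s' : Config) :
    Prop where
  c : ∀ r < B, s'.c (f r) = s.c r
  q : ∀ r < B, s'.q (f r) = s.q r
  fuel : C * s.fuel + D ≤ s'.fuel
  le : s.fuel ≤ T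
  inv : I s.log s'

/-- The invariant does not depend on the registers `f r`. -/
def Outer (f : ℕ → ℕ) (I : List Bits → Config → Prop) : Prop :=
  ∀ l s s', (∀ r, (∀ i, r ≠ f i) → s'.c r = s.c r) → (∀ r, (∀ i, r ≠ f i) → s'.q r = s.q r) →
    s'.log = s.log → I l s → I l s'

section
variable {f : ℕ → ℕ} {B C D T : ℕ} {I : List Bits → Config → Prop}

theorem Hosts.setC {s s' : Config} (h : Hosts f B C D T I s s') (hf : f.Injective)
    (hI : Outer f I) (r : ℕ) (x : Bits) : Hosts f B C D T I (s.setC r x) (s'.setC (f r) x) := by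
  refine ⟨fun r' hr' => ?_, h.q, h.fuel, h.le,
    hI s.log s' _ (fun r' hr' => ?_) (fun _ _ => rfl) rfl h.inv⟩
  · have := h.c r' hr'
    simp only [Config.setC, Function.update_apply, hf.eq_iff, this]
  · simp [Config.setC, hr' r]

theorem Hosts.setQ {s s' : Config} (h : Hosts f B C D T I s s') (hf : f.Injective)
    (hI : Outer f I) (r : ℕ) (x : List ℕ) : Hosts f B C D T I (s.setQ r x) (s'.setQ (f r) x) := by
  refine ⟨h.c, fun r' hr' => ?_, h.fuel, h.le,
    hI s.log s' _ (fun _ _ => rfl) (fun r' hr' => ?_) rfl h.inv⟩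
  · have := h.q r' hr'
    simp only [Config.setQ, Function.update_apply, hf.eq_iff, this]
  · simp [Config.setQ, hr' r]

/-- Since `C ≥ 1`, the host can pay whatever the guest can pay. If the guest cannot pay, it has no
branch that would need a counterpart. -/
theorem Hosts.spend {s s' : Config} (h : Hosts f B C D T I s s') (hC : 1 ≤ C) (hI : Outer f I)
    (k : ℕ) (e : Env) : Cov (Hosts f B C D T I) (QSig.spend k s e) (QSig.spend k s' e) := by
  by_cases hk : k ≤ s.fuel
  · have h1 : C * k ≤ C * s.fuel := Nat.mul_le_mul_left C hk
    have h2 : k ≤ C * k := Nat.le_mul_of_pos_left k hC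
    have h3 := h.fuel
    rw [spend_eq hk, spend_eq (show k ≤ s'.fuel by omega)]
    refine .cons ⟨h.c, h.q, ?_, (Nat.sub_le _ _).trans h.le,
      hI s.log s' _ (fun _ _ => rfl) (fun _ _ => rfl) rfl h.inv⟩ (.nil _)
    dsimp only
    rw [Nat.mul_sub]
    omega
  · rw [QSig.spend, if_neg hk]
    exact .nil _

theorem Hosts.eval {s s' : Config} (h : Hosts f B C D T I s s') (t : Test) (ht : t.bound ≤ B) :
    (t.inline f).eval s' = t.eval s := by
  cases t with
  | nonempty r => simp [Test.inline, Test.eval, h.c r ht]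
  | head r => simp [Test.inline, Test.eval, h.c r ht]

theorem Hosts.spend_bind {s s' : Config} (h : Hosts f B C D T I s s') (hC : 1 ≤ C)
    (hI : Outer f I) {k : ℕ} {e : Env} (hg : Good s e) {g g' : Config → QM Config}
    (hl : ∀ s, (g s).Linear)
    (hgg : ∀ s s', Good s e → Hosts f B C D T I s s' →
      Cov (Hosts f B C D T I) (g s e) (g' s' e)) :
    Cov (Hosts f B C D T I) ((QSig.spend k s >>= g) e) ((QSig.spend k s' >>= g') e) := by
  refine (h.spend hC hI k e).bind hl fun a b e' ha _ hab => ?_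
  have : a.q = s.q ∧ e' = e := by
    exact (QM.All.spend (Q := fun s' e' => s'.q = s.q ∧ e' = e) (k := k)
      fun _ => ⟨rfl, rfl⟩) _ ha
  obtain ⟨h1, rfl⟩ := this
  exact hgg a b (hg.of_q h1) hab

/-- Every instruction other than a query is executed literally and at the same cost; the surplus of
steps is there for the queries only. -/
theorem Instr.exec_inline {O O' : Oracle} {Q : ℕ → ℕ → ℕ → ℕ → Prog}
    (hf : f.Injective) (hC : 1 ≤ C) (hI : Outer f I)
    (hQ : ∀ s s' e r r₁ r₂ p, Good s e → Hosts f B C D T I s s' → r < B → r₁ < B → r₂ < B → p < B →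
      Cov (Hosts f B C D T I) ((Instr.query r r₁ r₂ p).exec O s e) ((Q r r₁ r₂ p).exec O' s' e))
    (i : Instr) (hi : i.bound ≤ B) (s s' : Config) (e : Env) (hg : Good s e)
    (h : Hosts f B C D T I s s') :
    Cov (Hosts f B C D T I) (i.exec O s e) ((i.inline f Q).exec O' s' e) := by
  cases i with
  | push b r =>
    simp only [Instr.bound] at hi
    have := (h.setC hf hI r (b :: s.c r)).spend hC hI 1 e
    simpa only [Instr.inline, Prog.exec, Instr.exec, h.c r (by omega)] using this
  | pop r =>
    simp only [Instr.bound] at hi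
    have := (h.setC hf hI r (s.c r).tail).spend hC hI 1 e
    simpa only [Instr.inline, Prog.exec, Instr.exec, h.c r (by omega)] using this
  | copy r r' =>
    simp only [Instr.bound] at hi
    have := (h.setC hf hI r' (s.c r)).spend hC hI (1 + (s.c r).length) e
    simpa only [Instr.inline, Prog.exec, Instr.exec, h.c r (by omega)] using this
  | pair r₁ r₂ r' =>
    simp only [Instr.bound] at hi
    have := (h.setC hf hI r' (pairCode (s.c r₁) (s.c r₂))).spend hC hI
      (1 + (s.c r₁).length + (s.c r₂).length) e
    simpa only [Instr.inline, Prog.exec, Instr.exec, h.c r₁ (by omega), h.c r₂ (by omega)] using this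
  | unpair r r₁ r₂ =>
    simp only [Instr.bound] at hi
    have := ((h.setC hf hI r₁ (unpairCode (s.c r)).1).setC hf hI r₂ (unpairCode (s.c r)).2).spend
      hC hI (1 + (s.c r).length) e
    simpa only [Instr.inline, Prog.exec, Instr.exec, h.c r (by omega)] using this
  | new p =>
    simp only [Instr.bound] at hi
    refine h.spend_bind hC hI hg (fun s => QM.Linear.alloc.bind fun _ => .pure _)
      fun s s' hg h => ?_
    refine Cov.bind_refl (fun _ => .pure _) fun a e' _ => ?_
    rw [h.q p (by omega)]
    exact .cons (h.setQ hf hI p _) (.nil _)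
  | gate g p =>
    simp only [Instr.bound] at hi
    refine h.spend_bind hC hI hg (fun s => ?_) fun s s' hg h => ?_
    · split
      · exact .pure _
      · refine (QM.Linear.act fun e he => ?_).bind fun _ => .pure _
        funext S
        simp [Env.gate, he]
    · simp only [h.q p (by omega)]
      cases s.q p
      · exact .cons h (.nil _)
      · exact Cov.bind_refl (fun _ => .pure _) fun a e' _ => .cons h (.nil _)
  | cnot p p' =>
    simp only [Instr.bound] at hi
    refine h.spend_bind hC hI hg (fun s => ?_) fun s s' hg h => ?_
    · split
      · split_ifs
        · exact .pure _
        · refine (QM.Linear.act fun e he => ?_).bind fun _ => .pure _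
          funext S
          simp [Env.cnot, he]
      · exact .pure _
    · simp only [h.q p (by omega), h.q p' (by omega)]
      cases s.q p
      · exact .cons h (.nil _)
      · cases s.q p'
        · exact .cons h (.nil _)
        · dsimp only
          split_ifs
          · exact .cons h (.nil _)
          · exact Cov.bind_refl (fun _ => .pure _) fun a e' _ => .cons h (.nil _)
  | measure p r =>
    simp only [Instr.bound] at hi
    refine h.spend_bind hC hI hg (fun s => ?_) fun s s' hg h => ?_
    · split
      · exact .pure _
      · exact (QM.Linear.measure _).bind fun x => .pure _
    · simp only [h.q p (by omega)]
      cases s.q p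
      · exact .cons h (.nil _)
      · refine Cov.bind_refl (fun _ => .pure _) fun a e' _ => ?_
        rw [h.c r (by omega)]
        exact .cons ((h.setQ hf hI p _).setC hf hI r _) (.nil _)
  | move p p' =>
    simp only [Instr.bound] at hi
    simp only [Instr.inline, Prog.exec]
    rw [Instr.exec_move, Instr.exec_move, h.q p (by omega)]
    cases hq : s.q p with
    | nil => exact h.spend hC hI 1 e
    | cons a l =>
      have h1 := h.setQ hf hI p l
      have h2 := (h1.setQ hf hI p' (a :: (s.setQ p l).q p')).spend hC hI 1 e
      simp only [h1.q p' (by omega)]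
      exact h2
  | moveAll p p' =>
    simp only [Instr.bound] at hi
    have := ((h.setQ hf hI p []).setQ hf hI p' (s.q p)).spend hC hI (1 + (s.q p).length) e
    simpa only [Instr.inline, Prog.exec, Instr.exec, h.q p (by omega)] using this
  | query r r₁ r₂ p =>
    simp only [Instr.bound] at hi
    exact hQ s s' e r r₁ r₂ p hg h (by omega) (by omega) (by omega) (by omega)

theorem Prog.exec_inline {O O' : Oracle} {Q : ℕ → ℕ → ℕ → ℕ → Prog} (hO : O.Fresh)
    (hO' : ∀ m, (O m).Linear) (hf : f.Injective) (hC : 1 ≤ C) (hI : Outer f I)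
    (hQ : ∀ s s' e r r₁ r₂ p, Good s e → Hosts f B C D T I s s' → r < B → r₁ < B → r₂ < B → p < B →
      Cov (Hosts f B C D T I) ((Instr.query r r₁ r₂ p).exec O s e) ((Q r r₁ r₂ p).exec O' s' e))
    (P : Prog) (hP : P.bound ≤ B) : ∀ (s s' : Config) (e : Env), Good s e →
    Hosts f B C D T I s s' →
    Cov (Hosts f B C D T I) (P.exec O s e) ((P.inline f Q).exec O' s' e) := by
  induction P with
  | skip => exact fun s s' e hg h => .cons h (.nil _)
  | instr i => exact fun s s' e hg h => Instr.exec_inline hf hC hI hQ i hP s s' e hg h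
  | seq P P' ih ih' =>
    simp only [Prog.bound] at hP
    intro s s' e hg h
    exact (ih (by omega) s s' e hg h).bind (Prog.exec_linear hO' P') fun a b e' ha _ hab =>
      ih' (by omega) a b e' (Prog.exec_reach hO P s e hg _ ha).good hab
  | ite t P P' ih ih' =>
    simp only [Prog.bound] at hP
    intro s s' e hg h
    refine h.spend_bind hC hI hg (fun s => ?_) fun s s' hg h => ?_
    · split_ifs
      · exact Prog.exec_linear hO' _ _
      · exact Prog.exec_linear hO' _ _
    · rw [h.eval t (by omega)]
      split_ifs
      · exact ih (by omega) s s' e hg h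
      · exact ih' (by omega) s s' e hg h
  | loop t P ih =>
    simp only [Prog.bound] at hP
    intro s s' e hg h
    have lin : ∀ k s, (whileLoop t (P.exec O) k s).Linear := by
      intro k
      induction k with
      | zero =>
        intro s
        unfold whileLoop
        split_ifs
        · exact fun _ _ => .abort
        · exact .pure _
      | succ k ih =>
        intro s
        unfold whileLoop
        split_ifs
        · exact (QM.Linear.spend _ _).bind fun s => (Prog.exec_linear hO' _ _).bind ih
        · exact .pure _
    -- The number of rounds allowed to a loop is the number of steps left, which is larger for the
    -- host; hence the two bounds `k ≤ k'`.
    have key : ∀ k k' s s' e, k ≤ k' → Good s e → Hosts f B C D T I s s' →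
        Cov (Hosts f B C D T I) (whileLoop t (P.exec O) k s e)
          (whileLoop (t.inline f) ((P.inline f Q).exec O') k' s' e) := by
      intro k
      induction k with
      | zero =>
        intro k' s s' e _ hg h
        have ht := h.eval t (by omega)
        cases ht' : t.eval s with
        | true =>
          unfold whileLoop
          rw [ht', if_pos rfl]
          exact .nil _
        | false =>
          rw [ht'] at ht
          cases k' <;>
          · unfold whileLoop
            rw [ht', ht]
            exact .cons h (.nil _)
      | succ k ihk =>
        intro k' s s' e hk hg h
        have ht := h.eval t (by omega)
        obtain ⟨k', rfl⟩ : ∃ m, k' = m + 1 := ⟨k' - 1, by omega⟩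
        unfold whileLoop
        rw [ht]
        split_ifs
        · refine h.spend_bind hC hI hg (fun s => (Prog.exec_linear hO' _ _).bind (lin k))
            fun s s' hg h => ?_
          exact (ih (by omega) s s' e hg h).bind (lin k) fun a b e' ha _ hab =>
            ihk k' a b e' (by omega) (Prog.exec_reach hO P s e hg _ ha).good hab
        · exact .cons h (.nil _)
    refine h.spend_bind hC hI hg (fun s => lin _ s) fun s s' hg h => key _ _ s s' e ?_ hg h
    have h1 := h.fuel
    have h2 : s.fuel ≤ C * s.fuel := Nat.le_mul_of_pos_left _ hC
    omega

end

/-! ### Calls of algorithms -/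

/-- The register `r` of the block `k`, one of eight blocks. The registers below `16` belong to no
block. -/
def reg (k r : ℕ) : ℕ := 16 + 8 * r + k

/-- The block to which a register belongs; `8` if it belongs to none. -/
def blk (r : ℕ) : ℕ := if r < 16 then 8 else (r - 16) % 8

theorem reg_injective (k : ℕ) : (reg k).Injective := by
  intro a b h
  simp only [reg] at h
  omega

theorem blk_reg {k : ℕ} (hk : k < 8) (r : ℕ) : blk (reg k r) = k := by
  rw [blk, reg, if_neg (by omega)]
  omega

theorem blk_small {r : ℕ} (h : r < 16) : blk r = 8 := if_pos h

theorem ne_reg_of_blk {k r : ℕ} (hk : k < 8) (h : blk r ≠ k) (i : ℕ) : r ≠ reg k i := by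
  rintro rfl
  exact h (blk_reg hk i)

/-- The effect is given field by field, with the steps in additive form, so that the accounting of
programs reduces to linear arithmetic. -/
theorem exec_copy (O : Oracle) {s : Config} {r r' : ℕ} (h : 1 + (s.c r).length ≤ s.fuel) :
    ∃ s', (Prog.instr (.copy r r')).exec O s = pure s' ∧
      s'.fuel + (1 + (s.c r).length) = s.fuel ∧ s'.c = Function.update s.c r' (s.c r) ∧
      s'.q = s.q ∧ s'.log = s.log :=
  ⟨_, spend_eq h, Nat.sub_add_cancel h, rfl, rfl, rfl⟩

theorem exec_pair (O : Oracle) {s : Config} {r₁ r₂ r' : ℕ}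
    (h : 1 + (s.c r₁).length + (s.c r₂).length ≤ s.fuel) :
    ∃ s', (Prog.instr (.pair r₁ r₂ r')).exec O s = pure s' ∧
      s'.fuel + (1 + (s.c r₁).length + (s.c r₂).length) = s.fuel ∧
      s'.c = Function.update s.c r' (pairCode (s.c r₁) (s.c r₂)) ∧
      s'.q = s.q ∧ s'.log = s.log :=
  ⟨_, spend_eq h, Nat.sub_add_cancel h, rfl, rfl, rfl⟩

theorem exec_unpair (O : Oracle) {s : Config} {r r₁ r₂ : ℕ}
    (h : 1 + (s.c r).length ≤ s.fuel) :
    ∃ s', (Prog.instr (.unpair r r₁ r₂)).exec O s = pure s' ∧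
      s'.fuel + (1 + (s.c r).length) = s.fuel ∧
      s'.c = Function.update (Function.update s.c r₁ (unpairCode (s.c r)).1) r₂
        (unpairCode (s.c r)).2 ∧
      s'.q = s.q ∧ s'.log = s.log :=
  ⟨_, spend_eq h, Nat.sub_add_cancel h, rfl, rfl, rfl⟩

theorem exec_pop (O : Oracle) {s : Config} {r : ℕ} (h : 1 ≤ s.fuel) :
    ∃ s', (Prog.instr (.pop r)).exec O s = pure s' ∧ s'.fuel + 1 = s.fuel ∧
      s'.c = Function.update s.c r (s.c r).tail ∧ s'.q = s.q ∧ s'.log = s.log :=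
  ⟨_, spend_eq h, Nat.sub_add_cancel h, rfl, rfl, rfl⟩

theorem exec_moveAll (O : Oracle) {s : Config} {p p' : ℕ} (h : 1 + (s.q p).length ≤ s.fuel) :
    ∃ s', (Prog.instr (.moveAll p p')).exec O s = pure s' ∧
      s'.fuel + (1 + (s.q p).length) = s.fuel ∧ s'.c = s.c ∧
      s'.q = Function.update (Function.update s.q p []) p' (s.q p) ∧ s'.log = s.log :=
  ⟨_, spend_eq h, Nat.sub_add_cancel h, rfl, rfl, rfl⟩

/-- With the empty oracle, a query can be used to clear registers. -/
theorem exec_query_null {s : Config} {r r₁ r₂ p : ℕ} (h : 1 + (s.c r).length ≤ s.fuel) :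
    ∃ s', (Prog.instr (.query r r₁ r₂ p)).exec nullOracle s = pure s' ∧
      s'.fuel + (1 + (s.c r).length) = s.fuel ∧
      s'.c = Function.update (Function.update s.c r₁ []) r₂ [] ∧
      s'.q = Function.update s.q p [] := by
  refine ⟨⟨Function.update (Function.update s.c r₁ []) r₂ [], Function.update s.q p [],
    s.fuel - (1 + (s.c r).length), s.c r :: s.log⟩, ?_, Nat.sub_add_cancel h, rfl, rfl⟩
  simp only [Prog.exec, Instr.exec, spend_eq h, nullOracle, pure_bind, List.length_nil]
  rw [spend_eq (Nat.zero_le _), pure_bind]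
  rfl

theorem exec_ite (O : Oracle) {s : Config} {t : Test} {P Q : Prog} (h : 1 ≤ s.fuel) :
    ∃ s', (Prog.ite t P Q).exec O s = (if t.eval s then P.exec O s' else Q.exec O s') ∧
      s'.fuel + 1 = s.fuel ∧ s'.c = s.c ∧ s'.q = s.q ∧ s'.log = s.log := by
  refine ⟨{ s with fuel := s.fuel - 1 }, ?_, Nat.sub_add_cancel h, rfl, rfl, rfl⟩
  simp only [Prog.exec, spend_eq h, pure_bind]
  rfl

/-- Make the first registers of the block `k` empty. -/
def clearBlock (k : ℕ) : ℕ → Prog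
  | 0 => .skip
  | B + 1 => .seq (clearBlock k B) (.seq (.instr (.copy 15 (reg k B))) (.instr (.moveAll 15 (reg k B))))

/-- Copy strings to the registers `i, i + 1, …` of the block `k`. -/
def copyIn (k : ℕ) : List ℕ → ℕ → Prog
  | [], _ => .skip
  | r :: l, i => .seq (.instr (.copy r (reg k i))) (copyIn k l (i + 1))

theorem exec_clearBlock (O : Oracle) {k : ℕ} (hk : k < 8) : ∀ (B : ℕ) {s : Config},
    s.c 15 = [] → s.q 15 = [] → 2 * B ≤ s.fuel →
    ∃ s', (clearBlock k B).exec O s = pure s' ∧ s'.fuel + 2 * B = s.fuel ∧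
      (∀ r < B, s'.c (reg k r) = [] ∧ s'.q (reg k r) = []) ∧
      (∀ r, blk r ≠ k → s'.c r = s.c r) ∧ (∀ r, blk r ≠ k → s'.q r = s.q r) ∧ s'.log = s.log
  | 0, s, _, _, _ => ⟨s, rfl, rfl, by simp, fun _ _ => rfl, fun _ _ => rfl, rfl⟩
  | B + 1, s, hc, hq, hB => by
    obtain ⟨s₁, h1, f1, b1, c1, q1, l1⟩ := exec_clearBlock O hk B (s := s) hc hq (by omega)
    have h15 : blk 15 ≠ k := by rw [blk_small (by omega)]; omega
    have hc1 : s₁.c 15 = [] := by rw [c1 15 h15, hc]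
    have hq1 : s₁.q 15 = [] := by rw [q1 15 h15, hq]
    obtain ⟨s₂, h2, f2, c2, q2, l2⟩ := exec_copy O (s := s₁) (r := 15) (r' := reg k B)
      (by rw [hc1, List.length_nil]; omega)
    rw [hc1] at f2 c2
    obtain ⟨s₃, h3, f3, c3, q3, l3⟩ := exec_moveAll O (s := s₂) (p := 15) (p' := reg k B)
      (by rw [q2, hq1]; simp at f2 ⊢; omega)
    rw [q2, hq1] at f3 q3
    -- Moving everything out of an empty register does not change it, so register `15` stays
    -- available as a source of emptiness.
    have e15 : Function.update s₁.q 15 [] = s₁.q := by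
      rw [← hq1]; exact Function.update_eq_self _ _
    rw [e15] at q3
    refine ⟨s₃, ?_, ?_, fun r hr => ?_, fun r hr => ?_, fun r hr => ?_, by rw [l3, l2, l1]⟩
    · rw [clearBlock, Prog.exec_seq_pure h1, Prog.exec_seq_pure h2, h3]
    · simp only [List.length_nil] at f2 f3
      omega
    · rw [c3, c2, q3]
      by_cases hrB : r = B
      · subst hrB; simp
      · have := b1 r (by omega)
        simpa [(reg_injective k).eq_iff, hrB] using this
    · rw [c3, c2, Function.update_of_ne (ne_reg_of_blk hk hr B), c1 r hr]
    · rw [q3, Function.update_of_ne (ne_reg_of_blk hk hr B), q1 r hr]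

/-- The sources lie outside the block, so no copy affects a later source. Registers beyond the list
keep their contents, which is the default value of `getD`. -/
theorem exec_copyIn (O : Oracle) {k : ℕ} (hk : k < 8) : ∀ (l : List ℕ) (i : ℕ) {s : Config},
    (∀ r ∈ l, blk r ≠ k) → l.length + ((l.map s.c).map List.length).sum ≤ s.fuel →
    ∃ s', (copyIn k l i).exec O s = pure s' ∧
      s'.fuel + (l.length + ((l.map s.c).map List.length).sum) = s.fuel ∧
      (∀ r, i ≤ r → s'.c (reg k r) = (l.map s.c).getD (r - i) (s.c (reg k r))) ∧
      (∀ r < i, s'.c (reg k r) = s.c (reg k r)) ∧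
      (∀ r, blk r ≠ k → s'.c r = s.c r) ∧ s'.q = s.q ∧ s'.log = s.log
  | [], i, s, _, _ => ⟨s, rfl, rfl, by simp, fun _ _ => rfl, fun _ _ => rfl, rfl, rfl⟩
  | r :: l, i, s, hl, hf => by
    simp only [List.length_cons, List.map_cons, List.sum_cons] at hf
    obtain ⟨s₁, h1, f1, c1, q1, l1⟩ := exec_copy O (s := s) (r := r) (r' := reg k i) (by omega)
    have hmap : l.map s₁.c = l.map s.c := List.map_congr_left fun a ha => by
      rw [c1, Function.update_of_ne (ne_reg_of_blk hk (hl a (List.mem_cons_of_mem _ ha)) i)]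
    obtain ⟨s₂, h2, f2, c2, d2, e2, q2, l2⟩ := exec_copyIn O hk l (i + 1) (s := s₁)
      (fun a ha => hl a (List.mem_cons_of_mem _ ha)) (by rw [hmap]; omega)
    rw [hmap] at f2 c2
    refine ⟨s₂, ?_, ?_, fun j hj => ?_, fun j hj => ?_, fun j hj => ?_, by rw [q2, q1],
      by rw [l2, l1]⟩
    · rw [copyIn, Prog.exec_seq_pure h1, h2]
    · simp only [List.length_cons, List.map_cons, List.sum_cons]
      omega
    · by_cases hji : j = i
      · subst hji
        rw [d2 j (by omega), c1]
        simp
      · rw [c2 j (by omega), c1, Function.update_of_ne (fun h => hji (reg_injective k h)),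
          show j - i = (j - (i + 1)) + 1 by omega, List.map_cons, List.getD_cons_succ]
    · rw [d2 j (by omega), c1, Function.update_of_ne (fun h => by
        have := reg_injective k h; omega)]
    · rw [e2 j hj, c1, Function.update_of_ne (ne_reg_of_blk hk hj i)]

/-- What replaces queries to the empty oracle. -/
def noQuery (k : ℕ) (_ r₁ r₂ p : ℕ) : Prog :=
  .seq (.instr (.copy 15 (reg k r₁))) (.seq (.instr (.copy 15 (reg k r₂)))
    (.instr (.moveAll 15 (reg k p))))

/-- Run an algorithm in the block `k`, on the strings in the registers `ins` and the qubits in the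
register `p`. The registers `15` have to be empty. -/
def QPTAlg.call (A : QPTAlg) (k : ℕ) (ins : List ℕ) (p : ℕ) : Prog :=
  .seq (clearBlock k (A.prog.bound + ins.length + 2)) <| .seq (copyIn k ins 0) <|
    .seq (.instr (.moveAll p (reg k 0))) (A.prog.inline (reg k) (noQuery k))

/-- The number of steps of a call with `j` strings, if the total length of the inputs is `x`. -/
def QPTAlg.callCost (A : QPTAlg) (j x : ℕ) : ℕ :=
  2 * (A.prog.bound + j + 2) + (j + x + 1) + 3 * A.time.eval x

/-- A bound for the length of the results, if the total length of the inputs is `x`. -/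
def QPTAlg.outLen (A : QPTAlg) (x : ℕ) : ℕ := x + 2 * A.time.eval x

theorem Polynomial_eval_mono (p : Polynomial ℕ) : Monotone fun x => p.eval x := by
  intro x y h
  simp only [Polynomial.eval_eq_sum_range]
  exact Finset.sum_le_sum fun i _ => Nat.mul_le_mul_left _ (Nat.pow_le_pow_left h i)

theorem QPTAlg.callCost_mono (A : QPTAlg) (j : ℕ) : Monotone (A.callCost j) := by
  intro x y h
  have := Polynomial_eval_mono A.time h
  simp only [QPTAlg.callCost] at this ⊢
  omega

theorem QPTAlg.outLen_mono (A : QPTAlg) : Monotone A.outLen := by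
  intro x y h
  have := Polynomial_eval_mono A.time h
  simp only [QPTAlg.outLen] at this ⊢
  omega

/-- The configuration after a call in the block `k` with result `a`. -/
structure CallPost (k p : ℕ) (s : Config) (D L : ℕ) (a s' : Config) : Prop where
  c0 : s'.c (reg k 0) = a.c 0
  c1 : s'.c (reg k 1) = a.c 1
  q0 : s'.q (reg k 0) = a.q 0
  c : ∀ r, blk r ≠ k → s'.c r = s.c r
  q : ∀ r, blk r ≠ k → r ≠ p → s'.q r = s.q r
  qp : s'.q p = []
  log : s'.log = s.log
  fuel : D ≤ s'.fuel
  len0 : (a.c 0).length ≤ L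
  len1 : (a.c 1).length ≤ L
  lenq : (a.q 0).length ≤ L

/-- Clearing the block and filling in the inputs reproduces the initial configuration of `A` inside
the block; `Prog.exec_inline` does the rest. The queries of `A`, which expect the empty oracle, must
not reach the actual oracle `O` and are replaced by clearing the answer registers. -/
theorem QPTAlg.call_cov (A : QPTAlg) (O : Oracle) {k : ℕ} (hk : k < 8) {ins : List ℕ} {p : ℕ}
    (hins : ∀ r ∈ ins, blk r ≠ k) (hp : blk p ≠ k) {s : Config} {e : Env} {D x : ℕ}
    (hc15 : s.c 15 = []) (hq15 : s.q 15 = []) (hx : inputSize (ins.map s.c) (s.q p) ≤ x)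
    (hf : D + A.callCost ins.length x ≤ s.fuel) (he : e.Valid) (hn : (s.q p).Nodup)
    (hl : ∀ a ∈ s.q p, a < e.next) :
    Cov (CallPost k p s D (A.outLen x)) (A.run (ins.map s.c) (s.q p) e)
      ((A.call k ins p).exec O s e) := by
  have h15 : blk 15 ≠ k := by rw [blk_small (by omega)]; omega
  -- The summand `2` keeps the result registers `0` and `1` in the hosted range even if the program
  -- never mentions them.
  set B := A.prog.bound + ins.length + 2 with hB
  set N := inputSize (ins.map s.c) (s.q p) with hN
  have hN' : (List.map List.length (List.map s.c ins)).sum + (s.q p).length = N := rfl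
  have hf' : D + (2 * B + (ins.length + N + 1) + 3 * A.time.eval N) ≤ s.fuel := by
    have := A.callCost_mono ins.length hx
    simp only [QPTAlg.callCost] at this hf
    omega
  obtain ⟨s₁, h1, f1, b1, c1, q1, l1⟩ := exec_clearBlock O hk B (s := s) hc15 hq15 (by omega)
  have hmap : ins.map s₁.c = ins.map s.c := List.map_congr_left fun a ha => c1 a (hins a ha)
  have hN1 : (List.map List.length (List.map s₁.c ins)).sum + (s.q p).length = N := by
    rw [hmap, hN']
  obtain ⟨s₂, h2, f2, c2, d2, e2, q2, l2⟩ := exec_copyIn O hk ins 0 (s := s₁) hins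
    (by omega)
  obtain ⟨s₃, h3, f3, c3, q3, l3⟩ := exec_moveAll O (s := s₂) (p := p) (p' := reg k 0)
    (by rw [q2, q1 p hp]; omega)
  rw [q2, q1 p hp] at f3 q3
  rw [QPTAlg.call, Prog.exec_seq_pure h1, Prog.exec_seq_pure h2, Prog.exec_seq_pure h3]
  have hc3 : ∀ r, blk r ≠ k → s₃.c r = s.c r := fun r hr => by rw [c3, e2 r hr, c1 r hr]
  have hq3 : ∀ r, blk r ≠ k → r ≠ p → s₃.q r = s.q r := fun r hr hrp => by
    rw [q3, Function.update_of_ne (ne_reg_of_blk hk hr 0), Function.update_of_ne hrp, q1 r hr]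
  have hqp : s₃.q p = [] := by
    rw [q3, Function.update_of_ne (ne_reg_of_blk hk hp 0), Function.update_self]
  have hq3' : s₃.q 15 = [] := by
    by_cases h : 15 = p
    · rw [h, hqp]
    · rw [hq3 15 h15 h, hq15]
  have hc3' : s₃.c 15 = [] := by rw [hc3 15 h15, hc15]
  -- Outside the block nothing changes while the algorithm runs; in particular register `15` stays
  -- empty for the replaced queries.
  let I : List Bits → Config → Prop := fun _ s' => (∀ r, blk r ≠ k → s'.c r = s₃.c r) ∧
    (∀ r, blk r ≠ k → s'.q r = s₃.q r) ∧ s'.log = s₃.log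
  have hI : Outer (reg k) I := by
    intro l s s' h h' hl ⟨i1, i2, i3⟩
    exact ⟨fun r hr => by rw [h r (ne_reg_of_blk hk hr), i1 r hr],
      fun r hr => by rw [h' r (ne_reg_of_blk hk hr), i2 r hr], by rw [hl, i3]⟩
  set t := A.time.eval N
  -- The rate is `3`: a query costs at least one step and is replaced by three instructions of one
  -- step each.
  have hH : Hosts (reg k) B 3 D t I (Config.start (ins.map s.c) (s.q p) t) s₃ := by
    refine ⟨fun r hr => ?_, fun r hr => ?_, ?_, le_rfl, fun _ _ => rfl, fun _ _ => rfl, rfl⟩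
    · rw [c3, c2 r (Nat.zero_le _), (b1 r hr).1, hmap]
      rfl
    · simp only [q3, Config.start]
      by_cases hr0 : r = 0
      · subst hr0; simp
      · rw [Function.update_of_ne (fun h => hr0 (reg_injective k h)),
          Function.update_of_ne (ne_reg_of_blk hk hp r).symm, (b1 r hr).2, if_neg hr0]
    · simp only [Config.start]
      omega
  have hQ : ∀ s s' e r r₁ r₂ p, Good s e → Hosts (reg k) B 3 D t I s s' → r < B → r₁ < B →
      r₂ < B → p < B → Cov (Hosts (reg k) B 3 D t I)
        ((Instr.query r r₁ r₂ p).exec nullOracle s e) ((noQuery k r r₁ r₂ p).exec O s' e) := by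
    intro s s' e r r₁ r₂ p _ h hr hr₁ hr₂ hp
    by_cases hfu : 1 + (s.c r).length ≤ s.fuel
    · obtain ⟨t₁, g1, i1, j1, m1⟩ := exec_query_null (r₁ := r₁) (r₂ := r₂) (p := p) hfu
      rw [Prog.exec] at g1
      have hfuel := h.fuel
      have hs'c : s'.c 15 = [] := by rw [h.inv.1 15 h15, hc3']
      have hs'q : s'.q 15 = [] := by rw [h.inv.2.1 15 h15, hq3']
      obtain ⟨u₁, g2, i2, j2, m2, n2⟩ := exec_copy O (s := s') (r := 15) (r' := reg k r₁)
        (by rw [hs'c, List.length_nil]; omega)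
      rw [hs'c, List.length_nil] at i2
      rw [hs'c] at j2
      have hu1 : u₁.c 15 = [] := by
        rw [j2, Function.update_of_ne (ne_reg_of_blk hk h15 _), hs'c]
      obtain ⟨u₂, g3, i3, j3, m3, n3⟩ := exec_copy O (s := u₁) (r := 15) (r' := reg k r₂)
        (by rw [hu1, List.length_nil]; omega)
      rw [hu1, List.length_nil] at i3
      rw [hu1] at j3
      have hu2 : u₂.q 15 = [] := by rw [m3, m2, hs'q]
      obtain ⟨u₃, g4, i4, j4, m4, n4⟩ := exec_moveAll O (s := u₂) (p := 15) (p' := reg k p)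
        (by rw [hu2, List.length_nil]; omega)
      rw [hu2, List.length_nil] at i4
      have e15 : Function.update u₂.q 15 [] = u₂.q := by
        rw [← hu2]; exact Function.update_eq_self _ _
      rw [hu2, e15, m3, m2] at m4
      rw [noQuery, g1, Prog.exec_seq_pure g2, Prog.exec_seq_pure g3, g4]
      refine .cons ⟨fun r' hr' => ?_, fun r' hr' => ?_, ?_, ?_, fun r' hr' => ?_,
        fun r' hr' => ?_, ?_⟩ (.nil _)
      · rw [j1, j4, j3, j2]
        simp only [Function.update_apply, (reg_injective k).eq_iff, h.c r' hr']
      · rw [m1, m4]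
        simp only [Function.update_apply, (reg_injective k).eq_iff, h.q r' hr']
      · omega
      · have := h.le
        omega
      · rw [j4, j3, j2, Function.update_of_ne (ne_reg_of_blk hk hr' _),
          Function.update_of_ne (ne_reg_of_blk hk hr' _), h.inv.1 r' hr']
      · rw [m4, Function.update_of_ne (ne_reg_of_blk hk hr' _), h.inv.2.1 r' hr']
      · rw [n4, n3, n2, h.inv.2.2]
    · simp only [Instr.exec, spend, if_neg hfu]
      exact .nil _
  have hmain := Prog.exec_inline nullOracle_fresh nullOracle_linear (reg_injective k) (by omega) hI hQ
    A.prog (by omega) _ s₃ e (Good.start he (ins.map s.c) hn hl t) hH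
  refine (show Cov _ (A.run (ins.map s.c) (s.q p) e) _ from hmain).with_mem.mono ?_
  rintro a s' ⟨h, e', ha, _⟩
  have hlen := A.run_length (ins.map s.c) (s.q p) e (a, e') ha
  have hout := A.outLen_mono hx
  rw [show A.outLen (inputSize (ins.map s.c) (s.q p)) = inputSize (ins.map s.c) (s.q p) +
    2 * A.time.eval (inputSize (ins.map s.c) (s.q p)) from rfl] at hout
  have hfuel := h.fuel
  exact ⟨h.c 0 (by omega), h.c 1 (by omega), h.q 0 (by omega),
    fun r hr => by rw [h.inv.1 r hr, hc3 r hr],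
    fun r hr hrp => by rw [h.inv.2.1 r hr, hq3 r hr hrp], by rw [h.inv.2.1 p hp, hqp],
    by rw [h.inv.2.2, l3, l2, l1], by omega,
    (hlen.1 0).trans hout, (hlen.1 1).trans hout, (hlen.2 0).trans hout⟩

/-- A call without qubits. -/
theorem QPTAlg.call_cov_nil (A : QPTAlg) (O : Oracle) {k : ℕ} (hk : k < 8) {ins : List ℕ}
    (hins : ∀ r ∈ ins, blk r ≠ k) {s : Config} {e : Env} {D x : ℕ}
    (hc15 : s.c 15 = []) (hq15 : s.q 15 = []) (hx : ((ins.map s.c).map List.length).sum ≤ x)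
    (hf : D + A.callCost ins.length x ≤ s.fuel) (he : e.Valid) :
    Cov (CallPost k 15 s D (A.outLen x)) (A.run (ins.map s.c) [] e)
      ((A.call k ins 15).exec O s e) := by
  have h := A.call_cov O hk hins (p := 15) (by rw [blk_small (by omega)]; omega) (s := s) (e := e)
    (D := D) (x := x) hc15 hq15 (by rw [hq15]; simpa [inputSize] using hx) hf he
    (by rw [hq15]; exact List.nodup_nil) (by rw [hq15]; simp)
  rw [hq15] at h
  exact h

/-! ### Algorithms from programs -/

/-- Functions that are given by polynomials. -/
def IsPoly (g : ℕ → ℕ) : Prop := ∃ p : Polynomial ℕ, ∀ x, p.eval x = g x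

namespace IsPoly

theorem const (n : ℕ) : IsPoly fun _ => n := ⟨Polynomial.C n, by simp⟩

theorem id : IsPoly fun x => x := ⟨Polynomial.X, by simp⟩

theorem add {f g : ℕ → ℕ} (hf : IsPoly f) (hg : IsPoly g) : IsPoly fun x => f x + g x := by
  obtain ⟨p, hp⟩ := hf
  obtain ⟨q, hq⟩ := hg
  exact ⟨p + q, by simp [hp, hq]⟩

theorem mul {f g : ℕ → ℕ} (hf : IsPoly f) (hg : IsPoly g) : IsPoly fun x => f x * g x := by
  obtain ⟨p, hp⟩ := hf
  obtain ⟨q, hq⟩ := hg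
  exact ⟨p * q, by simp [hp, hq]⟩

theorem eval (p : Polynomial ℕ) {g : ℕ → ℕ} (hg : IsPoly g) : IsPoly fun x => p.eval (g x) := by
  obtain ⟨q, hq⟩ := hg
  exact ⟨p.comp q, by simp [Polynomial.eval_comp, hq]⟩

theorem callCost (A : QPTAlg) (j : ℕ) {g : ℕ → ℕ} (hg : IsPoly g) :
    IsPoly fun x => A.callCost j (g x) :=
  ((const _).add (((const _).add hg).add (const _))).add ((const _).mul (hg.eval _))

theorem outLen (A : QPTAlg) {g : ℕ → ℕ} (hg : IsPoly g) : IsPoly fun x => A.outLen (g x) :=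
  hg.add ((const _).mul (hg.eval _))

theorem comp {f g : ℕ → ℕ} (hf : IsPoly f) (hg : IsPoly g) : IsPoly fun x => f (g x) := by
  obtain ⟨p, hp⟩ := hf
  obtain ⟨q, hq⟩ := hg
  exact ⟨p.comp q, by simp [Polynomial.eval_comp, hp, hq]⟩

end IsPoly

/-- The program `P` implements the experiment `M` in time `T`. -/
def Implements {α : Type} (P : Prog) (T : ℕ → ℕ) (R : α → Config → Prop)
    (M : List Bits → List ℕ → QM α) : Prop :=
  ∀ (ins : List Bits) (qs : List ℕ) (e : Env), e.Valid → qs.Nodup → (∀ a ∈ qs, a < e.next) →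
    QM.total (M ins qs) e = e.weight ∧
    Cov R (M ins qs e) (P.exec nullOracle (Config.start ins qs (T (inputSize ins qs))) e)

/-- The branches of `M` carry the full weight and recur in the program, which cannot exceed that
weight. So it halts with certainty, and since nothing remains for its other branches, the inclusion
can be reversed. -/
theorem Implements.exists_alg {α : Type} {P : Prog} {T : ℕ → ℕ} {R : α → Config → Prop}
    {M : List Bits → List ℕ → QM α} (h : Implements P T R M) (hT : IsPoly T) :
    ∃ A : QPTAlg, ∀ (ins : List Bits) (qs : List ℕ) (e : Env), e.Valid → qs.Nodup →
      (∀ a ∈ qs, a < e.next) →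
      Cov R (M ins qs e) (A.run ins qs e) ∧ Cov (fun s a => R a s) (A.run ins qs e) (M ins qs e) := by
  obtain ⟨p, hp⟩ := hT
  have hle : ∀ (ins : List Bits) (qs : List ℕ) (e : Env), e.Valid → qs.Nodup →
      (∀ a ∈ qs, a < e.next) →
      QM.total (P.exec nullOracle (Config.start ins qs (p.eval (inputSize ins qs)))) e
        ≤ e.weight := fun ins qs e he hn hl =>
    Prog.exec_total nullOracle_contracts nullOracle_fresh P _ e (Good.start he ins hn hl _)
  refine ⟨⟨P, p, fun ins qs e he hn hl => le_antisymm (hle ins qs e he hn hl) ?_⟩,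
    fun ins qs e he hn hl => ?_⟩
  · obtain ⟨h1, h2⟩ := h ins qs e he hn hl
    rw [← h1, hp]
    exact h2.total_le
  · obtain ⟨h1, h2⟩ := h ins qs e he hn hl
    rw [← hp] at h2
    refine ⟨h2, h2.reverse (fun y hy => ?_) ?_⟩
    · exact (Prog.exec_reach nullOracle_fresh P _ e (Good.start he ins hn hl _) y hy).good.valid
    · exact (hle ins qs e he hn hl).trans h1.ge

/-! ### Certified one-time keys -/

/-- The signature that consists of a one-time verification key, a classical signature on it, and
the classical part of a one-time signature. -/
def sigCode (v σ c : Bits) : Bits := pairCode v (pairCode σ c)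

/-- Sign `m` with a new one-time key, which is certified by `mt`. The result consists of the
verification key, the result of the one-time signing algorithm, and the certificate of the key. -/
def signM (N : RevocableSignature) (mt : Bits → QM Bits) (n m : Bits) :
    QM (Bits × Config × Bits) := do
  let k ← N.keyGen.run [n] []
  let ψ ← N.sign.run [n, k.c 0, m] []
  let σ ← mt (pairCode (k.c 1) m)
  return (k.c 1, ψ, σ)

/-- The program for `signM`, where the program `P` signs the string in register `3` and stores the
result in register `4`. The inputs are in the registers `0` and `2`. -/
def signProg (N : RevocableSignature) (P : Prog) : Prog :=
  .seq (N.keyGen.call 1 [0] 15) <| .seq (N.sign.call 2 [0, reg 1 0, 2] 15) <|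
  .seq (.instr (.pair (reg 1 1) 2 3)) <| .seq P <|
  .seq (.instr (.pair 4 (reg 2 0) 5)) (.instr (.pair (reg 1 1) 5 6))

/-- The contract for a subprogram that certifies the string in register `3`. The function `upd` is
the effect on the query log: none if the key is known, one more entry if the certificate comes from
an oracle. The freed registers are those that either variant may overwrite. -/
structure CertPost (upd : Bits → List Bits → List Bits) (s : Config) (D L : ℕ) (σ : Bits)
    (s' : Config) : Prop where
  c4 : s'.c 4 = σ
  len : σ.length ≤ L
  c : ∀ r, r ≠ 4 → r ≠ 5 → blk r ≠ 3 → s'.c r = s.c r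
  q : ∀ r, r ≠ 0 → blk r ≠ 3 → s'.q r = s.q r
  log : s'.log = upd (s.c 3) s.log
  fuel : D ≤ s'.fuel

/-- Signing may overwrite the classical registers `3` to `6`, the quantum register `0` and the
blocks `1`, `2`, `3`; a simulated adversary in block `4` and the saved data are safe. -/
structure SignPost (upd : Bits → List Bits → List Bits) (m : Bits) (s : Config) (D L : ℕ)
    (t : Bits × Config × Bits) (s' : Config) : Prop where
  c6 : s'.c 6 = sigCode t.1 t.2.2 (t.2.1.c 0)
  ck : s'.c (reg 2 1) = t.2.1.c 1
  q2 : s'.q (reg 2 0) = t.2.1.q 0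
  c : ∀ r, r < 3 ∨ 7 ≤ r → blk r ≠ 1 → blk r ≠ 2 → blk r ≠ 3 → s'.c r = s.c r
  q : ∀ r, r ≠ 0 → blk r ≠ 1 → blk r ≠ 2 → blk r ≠ 3 → s'.q r = s.q r
  log : s'.log = upd (pairCode t.1 m) s.log
  fuel : D ≤ s'.fuel
  len6 : (s'.c 6).length ≤ L
  lenck : (t.2.1.c 1).length ≤ L
  lenq : (t.2.1.q 0).length ≤ L

theorem signM_linear (N : RevocableSignature) {mt : Bits → QM Bits} (h : ∀ m, (mt m).Linear)
    (n m : Bits) : (signM N mt n m).Linear :=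
  (QPTAlg.run_linear _ _ _).bind fun _ => (QPTAlg.run_linear _ _ _).bind fun _ =>
    (h _).bind fun _ => .pure _

theorem signM_total (N : RevocableSignature) {mt : Bits → QM Bits}
    (h : ∀ m (e : Env), e.Valid → QM.total (mt m) e = e.weight) (n m : Bits) {e : Env}
    (he : e.Valid) : QM.total (signM N mt n m) e = e.weight := by
  rw [signM, QM.total_bind_eq, N.keyGen.run_total he _ List.nodup_nil (by simp)]
  refine (N.keyGen.run_reach he [n] List.nodup_nil (by simp)).mono fun k e' ⟨h', _, _⟩ => ?_
  rw [QM.total_bind_eq, N.sign.run_total h'.valid _ List.nodup_nil (by simp)]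
  refine (N.sign.run_reach h'.valid _ List.nodup_nil (by simp)).mono fun k e' ⟨h', _, _⟩ => ?_
  rw [QM.total_bind_eq, h _ _ h'.valid]
  exact fun y _ => QM.total_pure _ _

/-- A bound for the length of one-time keys. -/
def keyLen (N : RevocableSignature) (x : ℕ) : ℕ := N.keyGen.outLen x

/-- The one-time signing key is among the inputs, hence the additional `keyLen N x`. -/
def oneTimeLen (N : RevocableSignature) (x : ℕ) : ℕ := N.sign.outLen (x + keyLen N x)

/-- A bound for the length of strings that are certified. -/
def msgLen (N : RevocableSignature) (x : ℕ) : ℕ := 2 * keyLen N x + 1 + x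

/-- A bound for the length of signatures, if certificates have length at most `L`. -/
def sigLen (N : RevocableSignature) (x L : ℕ) : ℕ :=
  2 * keyLen N x + 1 + (2 * L + 1 + oneTimeLen N x)

/-- A bound for the number of steps of `signProg`, if certification takes `p` steps. -/
def signCost (N : RevocableSignature) (x L p : ℕ) : ℕ :=
  N.keyGen.callCost 1 x + N.sign.callCost 3 (x + keyLen N x) + (1 + keyLen N x + x) + p +
    (1 + L + oneTimeLen N x) + (1 + keyLen N x + (2 * L + 1 + oneTimeLen N x))

/-- Certification is a parameter so that one proof serves the scheme and the no-query adversary, who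
know the long-term key, as well as the forger, who asks its oracle. -/
theorem signProg_cov (N : RevocableSignature) {O : Oracle} {P : Prog} {mt : Bits → QM Bits}
    {upd : Bits → List Bits → List Bits} {n k m : Bits} {x L p : ℕ} (hmt : ∀ m, (mt m).Linear)
    (hP : ∀ s D e, e.Valid → s.c 0 = n → s.c 1 = k → s.c 15 = [] → s.q 15 = [] →
      (s.c 3).length ≤ msgLen N x → D + p ≤ s.fuel →
      Cov (CertPost upd s D L) (mt (s.c 3) e) (P.exec O s e))
    {s : Config} {D : ℕ} {e : Env} (he : e.Valid) (h0 : s.c 0 = n) (h1 : s.c 1 = k)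
    (h2 : s.c 2 = m) (hc15 : s.c 15 = []) (hq15 : s.q 15 = []) (hx : n.length + m.length ≤ x)
    (hf : D + signCost N x L p ≤ s.fuel) :
    Cov (SignPost upd m s D (sigLen N x L)) (signM N mt n m e) ((signProg N P).exec O s e) := by
  simp only [signCost] at hf
  have b15 : blk 15 = 8 := blk_small (by omega)
  have b0 : blk 0 = 8 := blk_small (by omega)
  have b2 : blk 2 = 8 := blk_small (by omega)
  have hk : ∀ {i r}, i < 8 → blk (reg i r) = i := fun h => blk_reg h _
  rw [signM, signProg, Prog.exec_seq]
  have c1 := N.keyGen.call_cov_nil O (k := 1) (by omega) (ins := [0]) (by simp [b0]) (s := s) (e := e)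
    (D := D + (N.sign.callCost 3 (x + keyLen N x) + (1 + keyLen N x + x) + p +
    (1 + L + oneTimeLen N x) + (1 + keyLen N x + (2 * L + 1 + oneTimeLen N x)))) (x := x)
    hc15 hq15 (by simp [h0]; omega) (by simp only [List.length_cons, List.length_nil, Nat.reduceAdd]; omega) he
  simp only [List.map_cons, List.map_nil, h0] at c1
  refine c1.bind (fun k => (QPTAlg.run_linear _ _ _).bind fun _ => (hmt _).bind fun _ => .pure _)
    fun kk s₁ e₁ hkk _ p1 => ?_
  have he₁ : e₁.Valid := (N.keyGen.run_reach he _ List.nodup_nil (by simp) _ hkk).1.valid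
  have hl1 : (kk.c 1).length ≤ keyLen N x := p1.len1
  have hl0 : (kk.c 0).length ≤ keyLen N x := p1.len0
  have f1 := p1.fuel
  have a0 : s₁.c 0 = n := by rw [p1.c 0 (by omega), h0]
  have a2 : s₁.c 2 = m := by rw [p1.c 2 (by omega), h2]
  have a15 : s₁.c 15 = [] := by rw [p1.c 15 (by omega), hc15]
  have c2 := N.sign.call_cov_nil O (k := 2) (by omega) (ins := [0, reg 1 0, 2])
    (by simp [b0, b2, hk]) (s := s₁) (e := e₁)
    (D := D + ((1 + keyLen N x + x) + p + (1 + L + oneTimeLen N x) +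
      (1 + keyLen N x + (2 * L + 1 + oneTimeLen N x)))) (x := x + keyLen N x)
    a15 p1.qp (by simp [a0, a2, p1.c0]; omega)
    (by simp only [List.length_cons, List.length_nil, Nat.reduceAdd]; omega) he₁
  simp only [List.map_cons, List.map_nil, a0, a2, p1.c0] at c2
  rw [Prog.exec_seq]
  refine c2.bind (fun k => (hmt _).bind fun _ => .pure _) fun ψ s₂ e₂ hψ _ p2 => ?_
  have he₂ : e₂.Valid := (N.sign.run_reach he₁ _ List.nodup_nil (by simp) _ hψ).1.valid
  have hl2 : (ψ.c 0).length ≤ oneTimeLen N x := p2.len0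
  have f2 := p2.fuel
  have d1 : s₂.c (reg 1 1) = kk.c 1 := by rw [p2.c _ (by rw [hk] <;> omega), p1.c1]
  have d2 : s₂.c 2 = m := by rw [p2.c 2 (by omega), a2]
  obtain ⟨s₃, g3, f3, c3, q3, l3⟩ := exec_pair O (s := s₂) (r₁ := reg 1 1) (r₂ := 2) (r' := 3)
    (by rw [d1, d2]; omega)
  rw [d1, d2] at f3 c3
  rw [Prog.exec_seq_pure g3, Prog.exec_seq]
  have d3 : s₃.c 3 = pairCode (kk.c 1) m := by rw [c3, Function.update_self]
  have d3' : ∀ r, r ≠ 3 → s₃.c r = s₂.c r := fun r hr => by rw [c3, Function.update_of_ne hr]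
  have c4 := hP s₃ (D + ((1 + L + oneTimeLen N x) +
      (1 + keyLen N x + (2 * L + 1 + oneTimeLen N x)))) e₂ he₂
    (by rw [d3' 0 (by omega), p2.c 0 (by omega), a0])
    (by rw [d3' 1 (by omega), p2.c 1 (by rw [blk_small] <;> omega),
      p1.c 1 (by rw [blk_small] <;> omega), h1])
    (by rw [d3' 15 (by omega), p2.c 15 (by omega), a15]) (by rw [q3, p2.qp])
    (by rw [d3, pairCode_length, msgLen]; omega) (by omega)
  rw [d3] at c4
  refine c4.bind (fun _ => .pure _) fun σ s₄ e₄ _ _ p4 => ?_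
  have f4 := p4.fuel
  have hσ := p4.len
  have i1 : s₄.c (reg 2 0) = ψ.c 0 := by
    rw [p4.c _ (by simp [reg]) (by simp [reg]) (by rw [hk] <;> omega), d3' _ (by simp [reg]), p2.c0]
  obtain ⟨s₅, g5, f5, c5, q5, l5⟩ := exec_pair O (s := s₄) (r₁ := 4) (r₂ := reg 2 0) (r' := 5)
    (by rw [p4.c4, i1]; omega)
  rw [p4.c4, i1] at f5 c5
  have i2 : s₅.c (reg 1 1) = kk.c 1 := by
    rw [c5, Function.update_of_ne (by simp [reg]), p4.c _ (by simp [reg]) (by simp [reg])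
      (by rw [hk] <;> omega), d3' _ (by simp [reg]), d1]
  have i3 : s₅.c 5 = pairCode σ (ψ.c 0) := by rw [c5, Function.update_self]
  have hpl := pairCode_length σ (ψ.c 0)
  obtain ⟨s₆, g6, f6, c6, q6, l6⟩ := exec_pair O (s := s₅) (r₁ := reg 1 1) (r₂ := 5) (r' := 6)
    (by rw [i2, i3]; omega)
  rw [i2, i3] at f6 c6
  rw [Prog.exec_seq_pure g5, g6]
  have lenψ : oneTimeLen N x ≤ sigLen N x L := by unfold sigLen; omega
  refine .cons ⟨?_, ?_, ?_, ?_, ?_, ?_, ?_, ?_, p2.len1.trans lenψ, p2.lenq.trans lenψ⟩ (.nil _)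
  · rw [c6, Function.update_self]; rfl
  · rw [c6, Function.update_of_ne (by simp [reg]), c5, Function.update_of_ne (by simp [reg]),
      p4.c _ (by simp [reg]) (by simp [reg]) (by rw [hk] <;> omega), d3' _ (by simp [reg]), p2.c1]
  · rw [q6, q5, p4.q _ (by simp [reg]) (by rw [hk] <;> omega), q3, p2.q0]
  · intro r hr hb1 hb2 hb3
    rw [c6, Function.update_of_ne (by omega), c5, Function.update_of_ne (by omega),
      p4.c r (by omega) (by omega) hb3, d3' r (by omega), p2.c r hb2, p1.c r hb1]
  · intro r hr hb1 hb2 hb3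
    rw [q6, q5, p4.q r hr hb3, q3]
    by_cases h15 : r = 15
    · rw [h15, p2.qp, hq15]
    · rw [p2.q r hb2 h15, p1.q r hb1 h15]
  · rw [l6, l5, p4.log, d3, l3, p2.log, p1.log]
  · omega
  · rw [c6, Function.update_self, pairCode_length, sigLen]
    omega

/-- Sign the string in register `3` with the key in register `1`. -/
def certProg (S : Signature) : Prog :=
  .seq (S.sign.call 3 [0, 1, 3] 15) (.instr (.copy (reg 3 0) 4))

/-- The classical signature of `m`. -/
def certM (S : Signature) (n k m : Bits) : QM Bits := do
  let σ ← S.sign.run [n, k, m] []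
  return σ.c 0

theorem certM_linear (S : Signature) (n k m : Bits) : (certM S n k m).Linear :=
  (QPTAlg.run_linear _ _ _).bind fun _ => .pure _

theorem certM_total (S : Signature) (n k m : Bits) (e : Env) (he : e.Valid) :
    QM.total (certM S n k m) e = e.weight := by
  rw [certM, QM.total_bind_eq, S.sign.run_total he _ List.nodup_nil (by simp)]
  exact fun y _ => QM.total_pure _ _

def certCost (S : Signature) (y : ℕ) : ℕ := S.sign.callCost 3 y + (1 + S.sign.outLen y)

theorem certProg_cov (S : Signature) {O : Oracle} {n k : Bits} {y x : ℕ}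
    (hy : n.length + k.length + x ≤ y) {s : Config} {D : ℕ} {e : Env} (he : e.Valid)
    (h0 : s.c 0 = n) (h1 : s.c 1 = k) (hc15 : s.c 15 = []) (hq15 : s.q 15 = [])
    (hx : (s.c 3).length ≤ x) (hf : D + certCost S y ≤ s.fuel) :
    Cov (CertPost (fun _ l => l) s D (S.sign.outLen y)) (certM S n k (s.c 3) e)
      ((certProg S).exec O s e) := by
  simp only [certCost] at hf
  have b15 : blk 15 = 8 := blk_small (by omega)
  rw [certM, certProg, Prog.exec_seq]
  have c1 := S.sign.call_cov_nil O (k := 3) (by omega) (ins := [0, 1, 3])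
    (by simp [blk_small]) (s := s) (e := e) (D := D + (1 + S.sign.outLen y)) (x := y)
    hc15 hq15 (by simp [h0, h1]; omega) (by simp only [List.length_cons, List.length_nil, Nat.reduceAdd]; omega) he
  simp only [List.map_cons, List.map_nil, h0, h1] at c1
  refine c1.bind (fun k => .pure _) fun σ s₁ e₁ _ _ p1 => ?_
  have f1 := p1.fuel
  have hl := p1.len0
  obtain ⟨s₂, g2, f2, c2, q2, l2⟩ := exec_copy O (s := s₁) (r := reg 3 0) (r' := 4)
    (by rw [p1.c0]; omega)
  rw [p1.c0] at f2 c2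
  rw [g2]
  refine .cons ⟨by rw [c2, Function.update_self], hl, fun r hr _ hb => ?_, fun r hr hb => ?_,
    by rw [l2, p1.log], by omega⟩ (.nil _)
  · rw [c2, Function.update_of_ne hr, p1.c r hb]
  · rw [q2]
    by_cases h15 : r = 15
    · rw [h15, p1.qp, hq15]
    · rw [p1.q r hb h15]

/-! ### Polynomial bounds for signing with a known long-term key. -/

/-- A bound for the number of steps of signing. -/
def fullSignCost (S : Signature) (N : RevocableSignature) (x : ℕ) : ℕ :=
  signCost N x (S.sign.outLen (x + msgLen N x)) (certCost S (x + msgLen N x))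

def fullSigLen (S : Signature) (N : RevocableSignature) (x : ℕ) : ℕ :=
  sigLen N x (S.sign.outLen (x + msgLen N x))

theorem isPoly_keyLen (N : RevocableSignature) : IsPoly (keyLen N) := IsPoly.id.outLen _

theorem isPoly_oneTimeLen (N : RevocableSignature) : IsPoly (oneTimeLen N) :=
  (IsPoly.id.add (isPoly_keyLen N)).outLen _

theorem isPoly_msgLen (N : RevocableSignature) : IsPoly (msgLen N) :=
  (((IsPoly.const 2).mul (isPoly_keyLen N)).add (.const 1)).add .id

theorem isPoly_sigLen (N : RevocableSignature) {f g : ℕ → ℕ} (hf : IsPoly f) (hg : IsPoly g) :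
    IsPoly fun x => sigLen N (f x) (g x) :=
  (((IsPoly.const 2).mul ((isPoly_keyLen N).comp hf)).add (.const 1)).add
    ((((IsPoly.const 2).mul hg).add (.const 1)).add ((isPoly_oneTimeLen N).comp hf))

theorem isPoly_signCost (N : RevocableSignature) {f g h : ℕ → ℕ} (hf : IsPoly f) (hg : IsPoly g)
    (hh : IsPoly h) : IsPoly fun x => signCost N (f x) (g x) (h x) :=
  have hk := (isPoly_keyLen N).comp hf
  have ho := (isPoly_oneTimeLen N).comp hf
  ((((((hf.callCost _ _).add ((hf.add hk).callCost _ _)).add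
    (((IsPoly.const 1).add hk).add hf)).add hh).add (((IsPoly.const 1).add hg).add ho)).add
    (((IsPoly.const 1).add hk).add ((((IsPoly.const 2).mul hg).add (.const 1)).add ho)))

theorem isPoly_certCost (S : Signature) {g : ℕ → ℕ} (hg : IsPoly g) :
    IsPoly fun x => certCost S (g x) :=
  (hg.callCost _ _).add ((IsPoly.const 1).add (hg.outLen _))

theorem isPoly_fullSignCost (S : Signature) (N : RevocableSignature) :
    IsPoly (fullSignCost S N) :=
  isPoly_signCost N .id ((IsPoly.id.add (isPoly_msgLen N)).outLen _)
    (isPoly_certCost S (IsPoly.id.add (isPoly_msgLen N)))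

theorem isPoly_fullSigLen (S : Signature) (N : RevocableSignature) : IsPoly (fullSigLen S N) :=
  isPoly_sigLen N .id ((IsPoly.id.add (isPoly_msgLen N)).outLen _)

theorem fullSign_cov (S : Signature) (N : RevocableSignature) {O : Oracle} {n k m : Bits} {x : ℕ}
    {s : Config} {D : ℕ} {e : Env} (he : e.Valid) (h0 : s.c 0 = n) (h1 : s.c 1 = k)
    (h2 : s.c 2 = m) (hc15 : s.c 15 = []) (hq15 : s.q 15 = [])
    (hx : n.length + k.length + m.length ≤ x) (hf : D + fullSignCost S N x ≤ s.fuel) :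
    Cov (SignPost (fun _ l => l) m s D (fullSigLen S N x)) (signM N (certM S n k) n m e)
      ((signProg N (certProg S)).exec O s e) :=
  signProg_cov N (certM_linear S n k) (fun _ _ _ he h0 h1 hc hq hx' hf =>
    certProg_cov S (y := x + msgLen N x) (by omega) he h0 h1 hc hq hx' hf) he h0 h1 h2 hc15 hq15
    (by omega) hf

/-! ### Programs for the algorithms of the many-time scheme. -/

/-- Clear the registers `15`. -/
def init : Prog := .instr (.query 15 15 14 15)

/-- An algorithm has to halt on input lists of any length, so register `15` may be occupied at the
start. The steps are only estimated, because its content is bounded by the whole input. -/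
theorem exec_init (ins : List Bits) (qs : List ℕ) {T : ℕ} (hT : 1 + inputSize ins qs ≤ T) :
    ∃ s', init.exec nullOracle (Config.start ins qs T) = pure s' ∧
      T ≤ s'.fuel + (1 + inputSize ins qs) ∧ s'.c 15 = [] ∧ s'.q 15 = [] ∧
      (∀ r, r < 14 → s'.c r = ins.getD r []) ∧ s'.q 0 = qs := by
  have hl : ((Config.start ins qs T).c 15).length ≤ inputSize ins qs :=
    (length_getD_le ins 15).trans (Nat.le_add_right _ _)
  obtain ⟨s', h1, f1, c1, q1⟩ := exec_query_null (s := Config.start ins qs T) (r := 15) (r₁ := 15)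
    (r₂ := 14) (p := 15) ((Nat.add_le_add_left hl 1).trans hT)
  refine ⟨s', h1, ?_, ?_, ?_, fun r hr => ?_, ?_⟩
  · have : (Config.start ins qs T).fuel = T := rfl
    omega
  · simp [c1]
  · simp [q1]
  · rw [c1, Function.update_of_ne (by omega), Function.update_of_ne (by omega)]
    rfl
  · rw [q1, Function.update_of_ne (by omega)]
    rfl

theorem getD_lengths_le (ins : List Bits) : (ins.getD 0 []).length + (ins.getD 1 []).length +
    (ins.getD 2 []).length + (ins.getD 3 []).length ≤ (ins.map List.length).sum := by
  rcases ins with _ | ⟨a, _ | ⟨b, _ | ⟨c, _ | ⟨d, l⟩⟩⟩⟩ <;> simp <;> omega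

/-- The signing algorithm. -/
def mtSignProg (S : Signature) (N : RevocableSignature) : Prog :=
  .seq init <| .seq (signProg N (certProg S)) <| .seq (.instr (.copy 6 0)) <|
    .seq (.instr (.copy (reg 2 1) 1)) (.instr (.moveAll (reg 2 0) 0))

/-- The three summands of the time pay for `init`, for `signProg`, and for moving the three results
to their places. -/
theorem mtSign_implements (S : Signature) (N : RevocableSignature) :
    Implements (mtSignProg S N)
      (fun x => (1 + x) + fullSignCost S N x + (3 * fullSigLen S N x + 3))
      (fun t s => s.c 0 = sigCode t.1 t.2.2 (t.2.1.c 0) ∧ s.c 1 = t.2.1.c 1 ∧ s.q 0 = t.2.1.q 0)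
      (fun ins _ => signM N (certM S (ins.getD 0 []) (ins.getD 1 [])) (ins.getD 0 [])
        (ins.getD 2 [])) := by
  intro ins qs e he _ _
  refine ⟨signM_total N (certM_total S _ _) _ _ he, ?_⟩
  set x := inputSize ins qs with hx
  set T := (1 + x) + fullSignCost S N x + (3 * fullSigLen S N x + 3) with hT
  obtain ⟨s₁, g1, f1, c15, q15, c1, -⟩ := exec_init ins qs (T := T) (by omega)
  rw [mtSignProg, Prog.exec_seq_pure g1, Prog.exec_seq]
  have hlen := getD_lengths_le ins
  have hx' : (ins.map List.length).sum ≤ x := Nat.le_add_right _ _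
  have h2 := fullSign_cov S N (O := nullOracle) (x := x) (D := 3 * fullSigLen S N x + 3) he
    (c1 0 (by omega)) (c1 1 (by omega)) (c1 2 (by omega)) c15 q15 (by omega) (by omega)
  have h3 : ∀ t s', SignPost (fun _ l => l) (ins.getD 2 []) s₁ (3 * fullSigLen S N x + 3)
      (fullSigLen S N x) t s' → ∀ e', Cov (fun t s => s.c 0 = sigCode t.1 t.2.2 (t.2.1.c 0) ∧
        s.c 1 = t.2.1.c 1 ∧ s.q 0 = t.2.1.q 0) ((pure t : QM _) e')
        ((Prog.seq (.instr (.copy 6 0)) (.seq (.instr (.copy (reg 2 1) 1))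
          (.instr (.moveAll (reg 2 0) 0)))).exec nullOracle s' e') := by
    intro t s₂ p2 e'
    have f2 := p2.fuel
    have l6 := p2.len6
    have lck := p2.lenck
    have lq := p2.lenq
    obtain ⟨s₃, g3, f3, c3, q3, -⟩ := exec_copy nullOracle (s := s₂) (r := 6) (r' := 0) (by omega)
    have hck : s₃.c (reg 2 1) = t.2.1.c 1 := by
      rw [c3, Function.update_of_ne (by simp [reg]), p2.ck]
    obtain ⟨s₄, g4, f4, c4, q4, -⟩ := exec_copy nullOracle (s := s₃) (r := reg 2 1) (r' := 1)
      (by rw [hck]; omega)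
    rw [hck] at f4
    have hq : s₄.q (reg 2 0) = t.2.1.q 0 := by rw [q4, q3, p2.q2]
    obtain ⟨s₅, g5, f5, c5, q5, -⟩ := exec_moveAll nullOracle (s := s₄) (p := reg 2 0) (p' := 0)
      (by rw [hq]; omega)
    rw [Prog.exec_seq_pure g3, Prog.exec_seq_pure g4, g5]
    refine .cons ⟨?_, ?_, ?_⟩ (.nil _)
    · rw [c5, c4, Function.update_of_ne (by omega), c3, Function.update_self, p2.c6]
    · rw [c5, c4, Function.update_self, hck]
    · rw [q5, Function.update_self, hq]
  -- The experiment has nothing left to do after signing; a trivial continuation is added so that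
  -- the final moves can be appended on the other side.
  have h4 := h2.bind (f := fun t => (pure t : QM _)) (fun _ => .pure _)
    fun t s' e' _ _ p => h3 t s' p e'
  rwa [bind_pure] at h4

/-- Is the certificate of the one-time key in the signature `c` valid, and is the one-time signature
valid? -/
def verM (S : Signature) (N : RevocableSignature) (n k c m : Bits) (qs : List ℕ) : QM Prop := do
  let v ← S.ver.run [n, k, (unpairCode (unpairCode c).2).1, pairCode (unpairCode c).1 m] []
  let w ← N.ver.run [n, (unpairCode c).1, (unpairCode (unpairCode c).2).2, m] qs
  return v.accepts ∧ w.accepts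

/-- The verification algorithm. -/
def mtVerProg (S : Signature) (N : RevocableSignature) : Prog :=
  .seq init <| .seq (.instr (.unpair 2 4 5)) <| .seq (.instr (.unpair 5 5 6)) <|
  .seq (.instr (.pair 4 3 7)) <| .seq (S.ver.call 1 [0, 1, 5, 7] 15) <|
  .seq (N.ver.call 2 [0, 4, 6, 3] 0) <|
  .ite (.head (reg 1 0)) (.seq (.instr (.pop (reg 1 0)))
    (.ite (.nonempty (reg 1 0)) (.instr (.copy 15 0)) (.instr (.copy (reg 2 0) 0))))
    (.instr (.copy 15 0))

def mtVerCost (S : Signature) (N : RevocableSignature) (x : ℕ) : ℕ :=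
  (1 + x) + (1 + x) + (1 + x) + (1 + x + x) + S.ver.callCost 4 (6 * x + 1) +
    N.ver.callCost 4 (6 * x + 1) + (N.ver.outLen (6 * x + 1) + 4)

theorem mtVer_implements (S : Signature) (N : RevocableSignature) :
    Implements (mtVerProg S N) (mtVerCost S N) (fun p s => s.accepts ↔ p)
      (fun ins qs => verM S N (ins.getD 0 []) (ins.getD 1 []) (ins.getD 2 []) (ins.getD 3 []) qs) := by
  intro ins qs e he hn hl
  beta_reduce
  constructor
  · rw [verM, QM.total_bind_eq, S.ver.run_total he _ List.nodup_nil (by simp)]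
    refine (S.ver.run_reach he _ List.nodup_nil (by simp)).mono fun v e' ⟨h', h2, _⟩ => ?_
    rw [QM.total_bind_eq, N.ver.run_total h'.valid _ hn fun a ha => (hl a ha).trans_le h2]
    exact fun y _ => QM.total_pure _ _
  set x := inputSize ins qs with hx
  -- The bound `6 * x + 1` for the inputs of the two calls is generous; it leaves room for the code
  -- of a pair, which doubles its first component.
  have hT : mtVerCost S N x = (1 + x) + (1 + x) + (1 + x) + (1 + x + x) +
    S.ver.callCost 4 (6 * x + 1) + N.ver.callCost 4 (6 * x + 1) +
    (N.ver.outLen (6 * x + 1) + 4) := rfl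
  generalize mtVerCost S N x = T at hT
  obtain ⟨s₁, g1, f1, c15, q15, c1, q1⟩ := exec_init ins qs (T := T) (by omega)
  have hlen := getD_lengths_le ins
  have hx' : (ins.map List.length).sum + qs.length = x := rfl
  have a0 := c1 0 (by omega)
  have a1 := c1 1 (by omega)
  have a2 := c1 2 (by omega)
  have a3 := c1 3 (by omega)
  rw [mtVerProg, Prog.exec_seq_pure g1]
  generalize ins.getD 0 [] = n at *
  generalize ins.getD 1 [] = k at *
  generalize ins.getD 2 [] = c at *
  generalize ins.getD 3 [] = m at *
  have u1 := unpairCode_length c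
  have u2 := unpairCode_length (unpairCode c).2
  obtain ⟨s₂, g2, f2, c2, q2, -⟩ := exec_unpair nullOracle (s := s₁) (r := 2) (r₁ := 4) (r₂ := 5)
    (by rw [a2]; omega)
  rw [a2] at f2 c2
  have b5 : s₂.c 5 = (unpairCode c).2 := by rw [c2, Function.update_self]
  obtain ⟨s₃, g3, f3, c3, q3, -⟩ := exec_unpair nullOracle (s := s₂) (r := 5) (r₁ := 5) (r₂ := 6)
    (by rw [b5]; omega)
  rw [b5] at f3 c3
  have d4 : s₃.c 4 = (unpairCode c).1 := by simp [c3, c2]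
  have d3 : s₃.c 3 = m := by simp [c3, c2, a3]
  obtain ⟨s₄, g4, f4, c4, q4, -⟩ := exec_pair nullOracle (s := s₃) (r₁ := 4) (r₂ := 3) (r' := 7)
    (by rw [d4, d3]; omega)
  rw [d4, d3] at f4 c4
  rw [Prog.exec_seq_pure g2, Prog.exec_seq_pure g3, Prog.exec_seq_pure g4, Prog.exec_seq]
  have i0 : s₄.c 0 = n := by simp [c4, c3, c2, a0]
  have i1 : s₄.c 1 = k := by simp [c4, c3, c2, a1]
  have i3 : s₄.c 3 = m := by simp [c4, c3, c2, a3]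
  have i4 : s₄.c 4 = (unpairCode c).1 := by simp [c4, c3, c2]
  have i5 : s₄.c 5 = (unpairCode (unpairCode c).2).1 := by simp [c4, c3]
  have i6 : s₄.c 6 = (unpairCode (unpairCode c).2).2 := by simp [c4, c3]
  have i7 : s₄.c 7 = pairCode (unpairCode c).1 m := by simp [c4]
  have i15 : s₄.c 15 = [] := by simp [c4, c3, c2, c15]
  have j15 : s₄.q 15 = [] := by rw [q4, q3, q2, q15]
  have j0 : s₄.q 0 = qs := by rw [q4, q3, q2, q1]
  have hpl := pairCode_length (unpairCode c).1 m
  have k5 := S.ver.call_cov_nil nullOracle (k := 1) (by omega) (ins := [0, 1, 5, 7])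
    (by simp [blk_small]) (s := s₄) (e := e) (D := N.ver.callCost 4 (6 * x + 1) +
      (N.ver.outLen (6 * x + 1) + 4)) (x := 6 * x + 1)
    i15 j15 (by simp [i0, i1, i5, i7]; omega)
    (by simp only [List.length_cons, List.length_nil, Nat.reduceAdd]; omega) he
  simp only [List.map_cons, List.map_nil, i0, i1, i5, i7] at k5
  refine k5.bind (fun _ => (QPTAlg.run_linear _ _ _).bind fun _ => .pure _)
    fun v s₅ e₅ hv _ p5 => ?_
  obtain ⟨he₅, hn₅, -⟩ := S.ver.run_reach he _ List.nodup_nil (by simp) _ hv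
  rw [Prog.exec_seq]
  have o15 : s₅.c 15 = [] := by rw [p5.c 15 (by simp [blk_small]), i15]
  have o0 : s₅.q 0 = qs := by rw [p5.q 0 (by simp [blk_small]) (by omega), j0]
  have f5 := p5.fuel
  have k6 := N.ver.call_cov nullOracle (k := 2) (by omega) (ins := [0, 4, 6, 3]) (p := 0)
    (by simp [blk_small]) (by simp [blk_small]) (s := s₅) (e := e₅)
    (D := N.ver.outLen (6 * x + 1) + 4) (x := 6 * x + 1) o15 p5.qp
    (by simp [p5.c, blk_small, i0, i4, i6, i3, o0, inputSize]; omega)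
    (by simp only [List.length_cons, List.length_nil, Nat.reduceAdd]; omega) he₅.valid (by rw [o0]; exact hn)
    (by rw [o0]; exact fun a ha => (hl a ha).trans_le hn₅)
  simp only [List.map_cons, List.map_nil, p5.c 0 (by simp [blk_small]),
    p5.c 4 (by simp [blk_small]), p5.c 6 (by simp [blk_small]), p5.c 3 (by simp [blk_small]),
    i0, i4, i6, i3, o0] at k6
  refine k6.bind (fun _ => .pure _) fun w s₆ e₆ _ _ p6 => ?_
  have f6 := p6.fuel
  have l6 := p6.len0
  have z15 : s₆.c 15 = [] := by rw [p6.c 15 (by simp [blk_small]), o15]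
  have hv1 : s₆.c (reg 1 0) = v.c 0 := by rw [p6.c _ (by rw [blk_reg] <;> omega), p5.c0]
  -- To reject, the empty string is copied to register `0`.
  have copy0 : ∀ s : Config, s.c 15 = [] → 1 ≤ s.fuel → ¬v.accepts →
      Cov (fun p s => s.accepts ↔ p) ((pure (v.accepts ∧ w.accepts) : QM Prop) e₆)
        ((Prog.instr (.copy 15 0)).exec nullOracle s e₆) := by
    intro s hs hsf hva
    obtain ⟨s', g', f', c', -⟩ := exec_copy nullOracle (s := s) (r := 15) (r' := 0)
      (by rw [hs, List.length_nil]; omega)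
    rw [g']
    refine .cons ?_ (.nil _)
    simp [Config.accepts, c', hs] at hva ⊢
    exact fun h => absurd h hva
  -- Acceptance means that the output is exactly `[true]`: its head is `true`, and nothing is left
  -- after removing it. If the classical check accepts in this sense, the output of the one-time
  -- verification is passed on.
  obtain ⟨s₇, g7, f7, c7, q7, -⟩ := exec_ite nullOracle (s := s₆) (t := .head (reg 1 0))
    (P := .seq (.instr (.pop (reg 1 0)))
      (.ite (.nonempty (reg 1 0)) (.instr (.copy 15 0)) (.instr (.copy (reg 2 0) 0))))
    (Q := .instr (.copy 15 0)) (by omega)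
  rw [g7]
  simp only [Test.eval, hv1]
  split_ifs with ht
  · obtain ⟨s₈, g8, f8, c8, q8, -⟩ := exec_pop nullOracle (s := s₇) (r := reg 1 0) (by omega)
    rw [Prog.exec_seq_pure g8]
    obtain ⟨s₉, g9, f9, c9, q9, -⟩ := exec_ite nullOracle (s := s₈) (t := .nonempty (reg 1 0))
      (P := .instr (.copy 15 0)) (Q := .instr (.copy (reg 2 0) 0)) (by omega)
    rw [g9]
    have ht1 : s₈.c (reg 1 0) = (v.c 0).tail := by rw [c8, Function.update_self, c7, hv1]
    simp only [Test.eval, ht1]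
    split_ifs with ht2
    · refine copy0 s₉ ?_ (by omega) ?_
      · rw [c9, c8, Function.update_of_ne (by simp [reg]), c7, z15]
      · intro hva
        rw [Config.accepts] at hva
        simp [hva] at ht2
    · have hw0 : s₉.c (reg 2 0) = w.c 0 := by
        rw [c9, c8, Function.update_of_ne (by simp [reg]), c7, p6.c0]
      obtain ⟨s', g', f', c', -⟩ := exec_copy nullOracle (s := s₉) (r := reg 2 0) (r' := 0)
        (by rw [hw0]; omega)
      rw [g']
      refine .cons ?_ (.nil _)
      have hva : v.c 0 = [true] := by
        cases hvc : v.c 0 with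
        | nil => simp [hvc] at ht
        | cons b l =>
          simp [hvc] at ht ht2
          rw [ht, ht2]
      simp [Config.accepts, c', hw0, hva]
  · refine copy0 s₇ (by rw [c7, z15]) (by omega) ?_
    intro hva
    rw [Config.accepts] at hva
    simp [hva] at ht

/-- The deletion algorithm. -/
def mtDelProg (N : RevocableSignature) : Prog :=
  .seq init <| .seq (.instr (.unpair 1 2 3)) <| .seq (.instr (.unpair 3 3 4)) <|
  .seq (N.del.call 1 [0, 4] 0) (.instr (.copy (reg 1 0) 0))

def mtDelCost (N : RevocableSignature) (x : ℕ) : ℕ :=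
  (1 + x) + (1 + x) + (1 + x) + N.del.callCost 2 x + (1 + N.del.outLen x)

theorem mtDel_implements (N : RevocableSignature) :
    Implements (mtDelProg N) (mtDelCost N) (fun a s => s.c 0 = a.c 0)
      (fun ins qs => N.del.run [ins.getD 0 [],
        (unpairCode (unpairCode (ins.getD 1 [])).2).2] qs) := by
  intro ins qs e he hn hl
  beta_reduce
  refine ⟨N.del.run_total he _ hn hl, ?_⟩
  set x := inputSize ins qs with hx
  have hT : mtDelCost N x = (1 + x) + (1 + x) + (1 + x) + N.del.callCost 2 x +
    (1 + N.del.outLen x) := rfl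
  generalize mtDelCost N x = T at hT
  obtain ⟨s₁, g1, f1, c15, q15, c1, q1⟩ := exec_init ins qs (T := T) (by omega)
  have hlen := getD_lengths_le ins
  have hx' : (ins.map List.length).sum + qs.length = x := rfl
  have a0 := c1 0 (by omega)
  have a1 := c1 1 (by omega)
  rw [mtDelProg, Prog.exec_seq_pure g1]
  generalize ins.getD 0 [] = n at *
  generalize ins.getD 1 [] = c at *
  have u1 := unpairCode_length c
  have u2 := unpairCode_length (unpairCode c).2
  obtain ⟨s₂, g2, f2, c2, q2, -⟩ := exec_unpair nullOracle (s := s₁) (r := 1) (r₁ := 2) (r₂ := 3)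
    (by rw [a1]; omega)
  rw [a1] at f2 c2
  have b3 : s₂.c 3 = (unpairCode c).2 := by rw [c2, Function.update_self]
  obtain ⟨s₃, g3, f3, c3, q3, -⟩ := exec_unpair nullOracle (s := s₂) (r := 3) (r₁ := 3) (r₂ := 4)
    (by rw [b3]; omega)
  rw [b3] at f3 c3
  rw [Prog.exec_seq_pure g2, Prog.exec_seq_pure g3, Prog.exec_seq]
  have i0 : s₃.c 0 = n := by simp [c3, c2, a0]
  have i4 : s₃.c 4 = (unpairCode (unpairCode c).2).2 := by simp [c3]
  have i15 : s₃.c 15 = [] := by simp [c3, c2, c15]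
  have j15 : s₃.q 15 = [] := by rw [q3, q2, q15]
  have j0 : s₃.q 0 = qs := by rw [q3, q2, q1]
  have k5 := N.del.call_cov nullOracle (k := 1) (by omega) (ins := [0, 4]) (p := 0)
    (by simp [blk_small]) (by simp [blk_small]) (s := s₃) (e := e) (D := 1 + N.del.outLen x) (x := x)
    i15 j15 (by simp [i0, i4, j0, inputSize]; omega)
    (by simp only [List.length_cons, List.length_nil, Nat.reduceAdd]; omega) he (by rw [j0]; exact hn)
    (by rw [j0]; exact hl)
  simp only [List.map_cons, List.map_nil, i0, i4, j0] at k5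
  have k6 := k5.bind (f := fun a => (pure a : QM Config))
    (g := (Prog.instr (.copy (reg 1 0) 0)).exec nullOracle) (R' := fun a s => s.c 0 = a.c 0)
    (fun _ => .pure _) fun a s e' _ _ p => by
      have f4 := p.fuel
      have l4 := p.len0
      obtain ⟨s', g', f', c', -⟩ := exec_copy nullOracle (s := s) (r := reg 1 0) (r' := 0)
        (by rw [p.c0]; omega)
      rw [g']
      exact .cons (by rw [c', Function.update_self, p.c0]) (.nil _)
  rwa [bind_pure] at k6

theorem isPoly_mtVerCost (S : Signature) (N : RevocableSignature) : IsPoly (mtVerCost S N) := by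
  have h : IsPoly fun x => 1 + x := (IsPoly.const 1).add .id
  have h6 : IsPoly fun x => 6 * x + 1 := ((IsPoly.const 6).mul .id).add (.const 1)
  exact (((((h.add h).add h).add (h.add .id)).add (h6.callCost _ _)).add (h6.callCost _ _)).add
    ((h6.outLen _).add (.const 4))

theorem isPoly_mtDelCost (N : RevocableSignature) : IsPoly (mtDelCost N) := by
  have h : IsPoly fun x => 1 + x := (IsPoly.const 1).add .id
  exact (((h.add h).add h).add (IsPoly.id.callCost _ _)).add ((IsPoly.const 1).add (IsPoly.id.outLen _))

/-- The scheme with certified one-time keys. -/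
theorem exists_scheme (S : Signature) (N : RevocableSignature) : ∃ R : RevocableSignature,
    R.keyGen = S.keyGen ∧ R.cert = N.cert ∧
    (∀ (n k m : Bits) (e : Env), e.Valid →
      Cov (fun t s => s.c 0 = sigCode t.1 t.2.2 (t.2.1.c 0) ∧ s.c 1 = t.2.1.c 1 ∧ s.q 0 = t.2.1.q 0)
        (signM N (certM S n k) n m e) (R.sign.run [n, k, m] [] e) ∧
      Cov (fun s t => s.c 0 = sigCode t.1 t.2.2 (t.2.1.c 0) ∧ s.c 1 = t.2.1.c 1 ∧ s.q 0 = t.2.1.q 0)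
        (R.sign.run [n, k, m] [] e) (signM N (certM S n k) n m e)) ∧
    (∀ (n k c m : Bits) (qs : List ℕ) (e : Env), e.Valid → qs.Nodup → (∀ a ∈ qs, a < e.next) →
      Cov (fun p s => s.accepts ↔ p) (verM S N n k c m qs e) (R.ver.run [n, k, c, m] qs e) ∧
      Cov (fun s p => s.accepts ↔ p) (R.ver.run [n, k, c, m] qs e) (verM S N n k c m qs e)) ∧
    (∀ (n c : Bits) (qs : List ℕ) (e : Env), e.Valid → qs.Nodup → (∀ a ∈ qs, a < e.next) →
      Cov (fun a s => s.c 0 = a.c 0) (N.del.run [n, (unpairCode (unpairCode c).2).2] qs e)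
        (R.del.run [n, c] qs e)) := by
  obtain ⟨As, hs⟩ := (mtSign_implements S N).exists_alg
    ((((IsPoly.const 1).add .id).add (isPoly_fullSignCost S N)).add
      (((IsPoly.const 3).mul (isPoly_fullSigLen S N)).add (.const 3)))
  obtain ⟨Av, hv⟩ := (mtVer_implements S N).exists_alg (isPoly_mtVerCost S N)
  obtain ⟨Ad, hd⟩ := (mtDel_implements N).exists_alg (isPoly_mtDelCost N)
  exact ⟨⟨S.keyGen, As, Av, Ad, N.cert⟩, rfl, rfl,
    fun n k m e he => hs [n, k, m] [] e he List.nodup_nil (by simp),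
    fun n k c m qs e he hn hl => hv [n, k, c, m] qs e he hn hl,
    fun n c qs e he hn hl => (hd [n, c] qs e he hn hl).1⟩

/-! ### Correctness -/

/-- Qubits allocated before keep their addresses when others are inserted behind them. -/
theorem map_shift_eq {N d : ℕ} {l : List ℕ} (h : ∀ a ∈ l, a < N) : l.map (shift N d) = l := by
  conv_rhs => rw [← List.map_id l]
  exact List.map_congr_left fun a ha => if_pos (h a ha)

theorem QM.Framed.id_pure {N d : ℕ} {J : Finset ℕ → ℂ} {α : Type} (a : α) :
    QM.Framed N d J id (Pure.pure a : QM α) (Pure.pure a) := .pure rfl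

/-- A continuation that sees only the classical results hands no addresses on, so the whole
experiment behaves identically in every memory. -/
theorem QPTAlg.run_closed_bind {β : Type} (A : QPTAlg) (ins : List Bits) {f : (ℕ → Bits) → QM β}
    (hf : ∀ c N d J, QM.Framed N d J id (f c) (f c))
    (hv : ∀ c (e : Env), e.Valid → (f c).All e fun _ e' => e'.Valid) :
    (A.run ins [] >>= fun s => f s.c).Closed :=
  ⟨fun N d J => (A.run_framed_nil ins).bind fun s => hf s.c N d J,
    (A.run_reach Env.vac_valid ins List.nodup_nil (by simp)).bind fun s e h => hv s.c e h.1.valid⟩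

/-- The classical results of an algorithm. -/
def QPTAlg.runC (A : QPTAlg) (ins : List Bits) : QM (ℕ → Bits) := do
  let s ← A.run ins []
  return s.c

theorem QPTAlg.run_bind (A : QPTAlg) (ins : List Bits) {β : Type} (f : (ℕ → Bits) → QM β) :
    (A.run ins [] >>= fun s => f s.c) = A.runC ins >>= f := by
  simp [QPTAlg.runC]

theorem QPTAlg.runC_closed (A : QPTAlg) (ins : List Bits) : (A.runC ins).Closed :=
  A.run_closed_bind ins (fun _ _ _ _ => .id_pure _) fun _ _ h => .pure h

theorem QPTAlg.runC_total (A : QPTAlg) (ins : List Bits) {e : Env} (he : e.Valid) :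
    QM.total (A.runC ins) e = e.weight := by
  rw [QPTAlg.runC, QM.total_bind_eq, A.run_total he ins List.nodup_nil (by simp)]
  exact fun y _ => QM.total_pure _ _

/-- The product rule for independent events: `H` uses qubits of its own, and `z` only those that
existed before. -/
theorem QM.val_closed_and {H z : QM Prop} (hH : H.Closed) {e : Env} (he : e.Valid)
    (hz : ∀ d J, QM.Framed e.next d J id z z) :
    QM.val (H >>= fun p => z >>= fun q => pure (p ∧ q)) e = QM.val H Env.vac * QM.val z e := by
  classical
  rw [QM.val_closed_bind hH he fun p _ => fun d J =>
    (hz d J).bind (f := fun q => pure (p.1 ∧ q)) (f' := fun q => pure (p.1 ∧ q)) fun q => .id_pure _]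
  rw [QM.val, mul_comm, ← List.sum_map_mul_left]
  congr 1
  refine List.map_congr_left fun b _ => ?_
  by_cases hb : b.1
  · rw [if_pos hb, mul_comm]
    congr 2
    conv_rhs => rw [← bind_pure z]
    simp [hb]
  · rw [if_neg hb, QM.val_bind]
    simp [hb, QM.val, QM.pure_apply]

/-- An independent experiment whose result is ignored contributes its total probability, which is
`1` for honest algorithms. -/
theorem QM.val_closed_const {β : Type} {y : QM β} (hy : y.Closed) {z : QM Prop} {e : Env}
    (he : e.Valid) (hz : ∀ d J, QM.Framed e.next d J id z z) :
    QM.val (y >>= fun _ => z) e = QM.total y Env.vac * QM.val z e := by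
  rw [QM.val_closed_bind hy he fun _ _ => hz, QM.total, mul_comm, ← List.sum_map_mul_left]
  congr 1
  exact List.map_congr_left fun b _ => mul_comm _ _

section
variable {S : Signature} {N : RevocableSignature}

theorem certM_framed (n k m : Bits) (M d : ℕ) (J : Finset ℕ → ℂ) :
    QM.Framed M d J id (certM S n k m) (certM S n k m) :=
  (QPTAlg.run_framed_nil _ _).bind fun _ => .pure rfl

theorem certM_valid (n k m : Bits) (e : Env) (he : e.Valid) :
    (certM S n k m).All e fun _ e' => e'.Valid :=
  (S.sign.run_reach he _ List.nodup_nil (by simp)).bind fun _ _ h => .pure h.1.valid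

/-- An independent key can be generated after the one-time key and the one-time signature. -/
theorem val_swap_key (S : Signature) (N : RevocableSignature) (n m : Bits)
    {f : (ℕ → Bits) → (ℕ → Bits) → (ℕ → Bits) → List ℕ → QM Prop}
    (hf : ∀ k kk c q M d J, QM.Framed M d J id (f k kk c q) (f k kk c (q.map (shift M d)))) :
    QM.val (do
      let k ← S.keyGen.run [n] []
      let kk ← N.keyGen.run [n] []
      let ψ ← N.sign.run [n, kk.c 0, m] []
      f k.c kk.c ψ.c (ψ.q 0)) Env.vac =
    QM.val (do
      let kk ← N.keyGen.run [n] []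
      let ψ ← N.sign.run [n, kk.c 0, m] []
      let k ← S.keyGen.run [n] []
      f k.c kk.c ψ.c (ψ.q 0)) Env.vac := by
  -- Key generation is reduced to its classical results to make it closed, and the one-time key and
  -- signature are bundled into one experiment.
  have h := QM.val_comm (x := (do
      let kk ← N.keyGen.run [n] []
      let ψ ← N.sign.run [n, kk.c 0, m] []
      pure (kk.c, ψ.c, ψ.q 0) : QM ((ℕ → Bits) × (ℕ → Bits) × List ℕ)))
    (y := S.keyGen.runC [n]) (S.keyGen.runC_closed _) (f := fun a k => f k a.1 a.2.1 a.2.2)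
    Env.vac_valid ?_ ?_
  · simpa [QPTAlg.runC] using h.symm
  · refine (N.keyGen.run_reach Env.vac_valid _ List.nodup_nil (by simp)).bind fun kk e h => ?_
    refine (N.sign.run_reach h.1.valid _ List.nodup_nil (by simp)).bind fun ψ e' h' => ?_
    refine .pure ⟨h'.1.valid, fun b _ d J => ?_⟩
    have h2 := hf b.1 kk.c ψ.c (ψ.q 0) e'.next d J
    rwa [map_shift_eq (h'.1.lt 0)] at h2
  · intro b _ d J
    refine QM.Framed.bind (φ := fun a => (a.1, a.2.1, a.2.2.map (shift Env.vac.next d)))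
      ((N.keyGen.run_framed_nil _).bind fun kk => (N.sign.run_framed_nil _).bind fun ψ =>
        .pure rfl) fun a => hf _ _ _ _ _ _ _

theorem honest_closed (S : Signature) (n : ℕ) (m : Bits) :
    (S.honest n m >>= fun s => pure s.accepts).Closed := by
  simp only [Signature.honest, bind_assoc]
  refine S.keyGen.run_closed_bind _ (f := fun k => S.sign.run [unary n, k 0, m] [] >>= fun σ =>
    S.ver.run [unary n, k 1, σ.c 0, m] [] >>= fun s => pure s.accepts) (fun k M d J => ?_)
    fun k e he => ?_
  · exact (S.sign.run_framed_nil _).bind fun σ => (S.ver.run_framed_nil _).bind fun s => .pure rfl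
  · exact (S.sign.run_reach he _ List.nodup_nil (by simp)).bind fun σ e h =>
      (S.ver.run_reach h.1.valid _ List.nodup_nil (by simp)).bind fun s e h => .pure h.1.valid

theorem QM.val_le_weight {x : QM Prop} {e : Env} (h : QM.total x e ≤ e.weight) :
    QM.val x e ≤ e.weight := (QM.val_le_total x e).trans h

theorem length_unary (n : ℕ) : (unary n).length = n := List.length_replicate

theorem Negligible.add {f g : ℕ → ℝ} (hf : Negligible f) (hg : Negligible g) :
    Negligible fun n => f n + g n := Asymptotics.SuperpolynomialDecay.add hf hg

theorem Negligible.abs {f : ℕ → ℝ} (hf : Negligible f) : Negligible fun n => |f n| :=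
  hf.trans_abs_le fun n => by simp

theorem Negligible.mono {f g : ℕ → ℝ} (hf : Negligible f) (h0 : ∀ n, 0 ≤ g n)
    (h : ∀ n, g n ≤ f n) : Negligible g :=
  hf.trans_abs_le fun n => by
    rw [abs_of_nonneg (h0 n), abs_of_nonneg ((h0 n).trans (h n))]
    exact h n

/-! ### Correctness of the scheme from the specifications of its algorithms. -/

variable {R : RevocableSignature}

/-- The properties of the signing algorithm of the scheme with certified one-time keys. -/
def SignSpec (S : Signature) (N R : RevocableSignature) : Prop :=
  ∀ (n k m : Bits) (e : Env), e.Valid →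
    Cov (fun t s => s.c 0 = sigCode t.1 t.2.2 (t.2.1.c 0) ∧ s.c 1 = t.2.1.c 1 ∧ s.q 0 = t.2.1.q 0)
      (signM N (certM S n k) n m e) (R.sign.run [n, k, m] [] e) ∧
    Cov (fun s t => s.c 0 = sigCode t.1 t.2.2 (t.2.1.c 0) ∧ s.c 1 = t.2.1.c 1 ∧ s.q 0 = t.2.1.q 0)
      (R.sign.run [n, k, m] [] e) (signM N (certM S n k) n m e)

def VerSpec (S : Signature) (N R : RevocableSignature) : Prop :=
  ∀ (n k c m : Bits) (qs : List ℕ) (e : Env), e.Valid → qs.Nodup → (∀ a ∈ qs, a < e.next) →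
    Cov (fun p s => s.accepts ↔ p) (verM S N n k c m qs e) (R.ver.run [n, k, c, m] qs e) ∧
    Cov (fun s p => s.accepts ↔ p) (R.ver.run [n, k, c, m] qs e) (verM S N n k c m qs e)

def DelSpec (N R : RevocableSignature) : Prop :=
  ∀ (n c : Bits) (qs : List ℕ) (e : Env), e.Valid → qs.Nodup → (∀ a ∈ qs, a < e.next) →
    Cov (fun a s => s.c 0 = a.c 0) (N.del.run [n, (unpairCode (unpairCode c).2).2] qs e)
      (R.del.run [n, c] qs e)

theorem signM_reach (N : RevocableSignature) {mt : Bits → QM Bits}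
    (hmt : ∀ m (e : Env), e.Valid → (mt m).All e fun _ e' => e'.Valid ∧ e.next ≤ e'.next)
    (n m : Bits) {e : Env} (he : e.Valid) : (signM N mt n m).All e fun t e' =>
      e'.Valid ∧ e.next ≤ e'.next ∧ (t.2.1.q 0).Nodup ∧
        ∀ a ∈ t.2.1.q 0, e.next ≤ a ∧ a < e'.next := by
  refine (N.keyGen.run_reach he _ List.nodup_nil (by simp)).bind fun kk e₁ h₁ => ?_
  refine (N.sign.run_reach h₁.1.valid _ List.nodup_nil (by simp)).bind fun ψ e₂ h₂ => ?_
  refine (hmt _ _ h₂.1.valid).bind fun σ e₃ h₃ => .pure ⟨h₃.1, h₁.2.1.trans (h₂.2.1.trans h₃.2),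
    h₂.1.nodup 0, fun a ha => ⟨?_, (h₂.1.lt 0 a ha).trans_le h₃.2⟩⟩
  rcases h₂.2.2 0 a ha with h | h
  · exact h₁.2.1.trans h
  · simp at h

theorem certM_reach (S : Signature) (n k m : Bits) (e : Env) (he : e.Valid) :
    (certM S n k m).All e fun _ e' => e'.Valid ∧ e.next ≤ e'.next :=
  (S.sign.run_reach he _ List.nodup_nil (by simp)).bind fun _ _ h => .pure ⟨h.1.valid, h.2.1⟩

theorem verM_linear (n k c m : Bits) (qs : List ℕ) : (verM S N n k c m qs).Linear :=
  (QPTAlg.run_linear _ _ _).bind fun _ => (QPTAlg.run_linear _ _ _).bind fun _ => .pure _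

/-- After the long-term key has been moved behind the one-time signature, checking the certificate
is the honest experiment of `S` for the fixed string `pairCode vk' m`, independent of the one-time
verification. So the acceptance probability is at least `(1 - |δ|) P`, where `P` is that of `N`. -/
theorem correct_of_spec (hk : R.keyGen = S.keyGen) (hs : SignSpec S N R) (hv : VerSpec S N R)
    {M : ℕ → Set Bits} (hS : S.Correct) (hN : N.Correct M) : R.Correct M := by
  intro p
  obtain ⟨ε, hε, h1⟩ := hN p
  -- The string to be certified is the code of the one-time key and the message; its length is at
  -- most twice the key length plus `1` plus the message length.
  obtain ⟨q, hq⟩ := ((isPoly_keyLen N).add (isPoly_keyLen N)).add ((IsPoly.const 1).add (IsPoly.id.eval p))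
  obtain ⟨δ, hδ, h2⟩ := hS q
  -- The absolute value is needed for `|δ| P ≤ |δ|`, from which `(1 - |δ|) P ≥ 1 - |δ| - ε`.
  refine ⟨fun n => |δ n| + ε n, hδ.abs.add hε, fun n m hm hmp => ?_⟩
  have hN1 := h1 n m hm hmp
  rw [QM.prob_eq_val] at hN1 ⊢
  -- the verification result of the one-time scheme
  set z : (ℕ → Bits) → (ℕ → Bits) → List ℕ → QM Prop := fun kk ψ qs =>
    N.ver.run [unary n, kk 1, ψ 0, m] qs >>= fun w => pure w.accepts with hz
  have hzf : ∀ kk ψ qs M d J, QM.Framed M d J id (z kk ψ qs) (z kk ψ (qs.map (shift M d))) :=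
    fun kk ψ qs M d J => (N.ver.run_framed _ _).bind fun _ => .pure rfl
  let f : (ℕ → Bits) → (ℕ → Bits) → (ℕ → Bits) → List ℕ → QM Prop := fun k kk ψ qs =>
    S.sign.run [unary n, k 0, pairCode (kk 1) m] [] >>= fun σ =>
    S.ver.run [unary n, k 1, σ.c 0, pairCode (kk 1) m] [] >>= fun v =>
    z kk ψ qs >>= fun w => pure (v.accepts ∧ w)
  have hff : ∀ k kk c q M d J, QM.Framed M d J id (f k kk c q) (f k kk c (q.map (shift M d))) :=
    fun k kk c q M d J => (S.sign.run_framed_nil _).bind fun σ => (S.ver.run_framed_nil _).bind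
      fun v => (hzf _ _ _ _ _ _).bind fun w => .pure rfl
  have e1 : QM.val (do
      let k ← S.keyGen.run [unary n] []
      let kk ← N.keyGen.run [unary n] []
      let ψ ← N.sign.run [unary n, kk.c 0, m] []
      f k.c kk.c ψ.c (ψ.q 0)) Env.vac ≤
      QM.val (R.honestVer n m >>= fun s => pure s.accepts) Env.vac := by
    refine Cov.val_le ?_
    have e2 : (do
      let k ← S.keyGen.run [unary n] []
      let kk ← N.keyGen.run [unary n] []
      let ψ ← N.sign.run [unary n, kk.c 0, m] []
      f k.c kk.c ψ.c (ψ.q 0)) = (do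
      let k ← S.keyGen.run [unary n] []
      let t ← signM N (certM S (unary n) (k.c 0)) (unary n) m
      verM S N (unary n) (k.c 1) (sigCode t.1 t.2.2 (t.2.1.c 0)) m (t.2.1.q 0)) := by
      simp [signM, certM, verM, sigCode, unpairCode_pairCode, f, z]
    rw [e2, RevocableSignature.honestVer, hk, bind_assoc]
    refine Cov.bind_refl (fun k => (signM_linear N (certM_linear _ _ _) _ _).bind fun t =>
      verM_linear _ _ _ _ _) fun k e₁ hk₁ => ?_
    have he₁ := (S.keyGen.run_reach Env.vac_valid _ List.nodup_nil (by simp) _ hk₁).1.valid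
    rw [bind_assoc]
    refine ((hs _ _ m e₁ he₁).1).bind (fun t => verM_linear _ _ _ _ _) fun t s e₂ ht _ hts => ?_
    obtain ⟨he₂, _, hn, hl⟩ := signM_reach N (certM_reach S _ _) _ _ he₁ _ ht
    rw [hts.1, hts.2.2, ← bind_pure (verM _ _ _ _ _ _ _)]
    exact ((hv _ _ _ _ _ _ he₂ hn fun a ha => (hl a ha).2).1).bind (fun _ => .pure _)
      fun a b e' _ _ hab => .cons hab.2 (.nil _)
  rw [val_swap_key S N (unary n) m hff] at e1
  refine le_trans ?_ e1
  -- The bound for the certificate holds for each one-time key and signature separately, and is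
  -- summed over their branches.
  have e3 : (1 - |δ n|) * QM.val (N.honestVer n m >>= fun s => pure s.accepts) Env.vac ≤
      QM.val (do
      let kk ← N.keyGen.run [unary n] []
      let ψ ← N.sign.run [unary n, kk.c 0, m] []
      let k ← S.keyGen.run [unary n] []
      f k.c kk.c ψ.c (ψ.q 0)) Env.vac := by
    rw [RevocableSignature.honestVer, bind_assoc, QM.val_bind, QM.val_bind, ← List.sum_map_mul_left]
    refine List.sum_le_sum fun kk hkk => ?_
    have he₁ := (N.keyGen.run_reach Env.vac_valid _ List.nodup_nil (by simp) _ hkk).1.valid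
    have hlen := (N.keyGen.run_length _ _ _ _ hkk).1 1
    rw [bind_assoc, QM.val_bind, QM.val_bind, ← List.sum_map_mul_left]
    refine List.sum_le_sum fun ψ hψ => ?_
    have hg := (N.sign.run_reach he₁ _ List.nodup_nil (by simp) _ hψ).1
    have e4 : (S.keyGen.run [unary n] [] >>= fun k => f k.c kk.1.c ψ.1.c (ψ.1.q 0)) =
        (S.honest n (pairCode (kk.1.c 1) m) >>= fun s => pure s.accepts) >>= fun p =>
          z kk.1.c ψ.1.c (ψ.1.q 0) >>= fun q => pure (p ∧ q) := by
      simp [Signature.honest, f]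
    rw [e4, QM.val_closed_and (honest_closed S n _) hg.valid (fun d J => by
      have := hzf kk.1.c ψ.1.c (ψ.1.q 0) ψ.2.next d J
      rwa [map_shift_eq (hg.lt 0)] at this)]
    refine mul_le_mul_of_nonneg_right ?_ (QM.val_nonneg _ _)
    have h3 := h2 n (pairCode (kk.1.c 1) m) (by
      have hi : inputSize [unary n] [] = n := by simp [inputSize, length_unary]
      rw [hi] at hlen
      rw [hq, pairCode_length]
      simp only [keyLen, QPTAlg.outLen]
      omega)
    rw [QM.prob_eq_val] at h3
    have := le_abs_self (δ n)
    linarith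
  refine le_trans ?_ e3
  set P := QM.val (N.honestVer n m >>= fun s => pure s.accepts) Env.vac
  have hP1 : P ≤ 1 := by
    rw [← Env.weight_vac]
    refine QM.val_le_weight ?_
    rw [RevocableSignature.honestVer]
    simp only [bind_assoc]
    refine QM.total_bind_le_weight (N.keyGen.run_total Env.vac_valid _ List.nodup_nil (by simp)).le ?_
    refine (N.keyGen.run_reach Env.vac_valid _ List.nodup_nil (by simp)).mono fun k e h => ?_
    refine QM.total_bind_le_weight (N.sign.run_total h.1.valid _ List.nodup_nil (by simp)).le ?_
    refine (N.sign.run_reach h.1.valid _ List.nodup_nil (by simp)).mono fun k e h => ?_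
    exact QM.total_bind_le_weight (N.ver.run_total h.1.valid _ (h.1.nodup 0) (h.1.lt 0)).le
      fun _ _ => (QM.total_pure _ _).le
  have := abs_nonneg (δ n)
  nlinarith

/-- Deletion ignores the classical certificate. The generation of the long-term key and the
certification form an independent experiment of total probability one, and drop out. -/
theorem deletionCorrect_of_spec (hk : R.keyGen = S.keyGen) (hc : R.cert = N.cert)
    (hs : SignSpec S N R) (hd : DelSpec N R)
    {M : ℕ → Set Bits} (hN : N.DeletionCorrect M) : R.DeletionCorrect M := by
  intro p
  obtain ⟨ε, hε, h1⟩ := hN p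
  refine ⟨ε, hε, fun n m hm hmp => (h1 n m hm hmp).trans ?_⟩
  rw [QM.prob_eq_val, QM.prob_eq_val]
  set z : (ℕ → Bits) → List ℕ → QM Prop := fun ψ qs =>
    N.del.run [unary n, ψ 0] qs >>= fun d => N.cert.run [unary n, ψ 1, d.c 0] [] >>= fun w =>
      pure w.accepts with hz
  have hzf : ∀ ψ qs M d J, QM.Framed M d J id (z ψ qs) (z ψ (qs.map (shift M d))) :=
    fun ψ qs M d J => (N.del.run_framed _ _).bind fun _ => (N.cert.run_framed_nil _).bind fun _ =>
      .pure rfl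
  have hzl : ∀ ψ qs, (z ψ qs).Linear := fun ψ qs => (QPTAlg.run_linear _ _ _).bind fun _ =>
    (QPTAlg.run_linear _ _ _).bind fun _ => .pure _
  let f : (ℕ → Bits) → (ℕ → Bits) → (ℕ → Bits) → List ℕ → QM Prop := fun k kk ψ qs =>
    certM S (unary n) (k 0) (pairCode (kk 1) m) >>= fun _ => z ψ qs
  have hff : ∀ k kk c q M d J, QM.Framed M d J id (f k kk c q) (f k kk c (q.map (shift M d))) :=
    fun k kk c q M d J => (certM_framed _ _ _ _ _ _).bind fun σ => hzf _ _ _ _ _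
  have e1 : QM.val (do
      let k ← S.keyGen.run [unary n] []
      let kk ← N.keyGen.run [unary n] []
      let ψ ← N.sign.run [unary n, kk.c 0, m] []
      f k.c kk.c ψ.c (ψ.q 0)) Env.vac ≤
      QM.val (R.honestDel n m >>= fun s => pure s.accepts) Env.vac := by
    refine Cov.val_le ?_
    have e2 : (do
      let k ← S.keyGen.run [unary n] []
      let kk ← N.keyGen.run [unary n] []
      let ψ ← N.sign.run [unary n, kk.c 0, m] []
      f k.c kk.c ψ.c (ψ.q 0)) = (do
      let k ← S.keyGen.run [unary n] []
      let t ← signM N (certM S (unary n) (k.c 0)) (unary n) m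
      z t.2.1.c (t.2.1.q 0)) := by
      simp [signM, f]
    rw [e2, RevocableSignature.honestDel, hk, hc, bind_assoc]
    refine Cov.bind_refl (fun k => (signM_linear N (certM_linear _ _ _) _ _).bind fun t =>
      hzl _ _) fun k e₁ hk₁ => ?_
    have he₁ := (S.keyGen.run_reach Env.vac_valid _ List.nodup_nil (by simp) _ hk₁).1.valid
    rw [bind_assoc]
    refine ((hs _ _ m e₁ he₁).1).bind (fun t => hzl _ _) fun t s e₂ ht _ hts => ?_
    obtain ⟨he₂, _, hn, hl⟩ := signM_reach N (certM_reach S _ _) _ _ he₁ _ ht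
    rw [hts.1, hts.2.1, hts.2.2, bind_assoc]
    have h3 := hd (unary n) (sigCode t.1 t.2.2 (t.2.1.c 0)) _ _ he₂ hn fun a ha => (hl a ha).2
    simp only [sigCode, unpairCode_pairCode] at h3
    refine h3.bind (fun _ => (QPTAlg.run_linear _ _ _).bind fun _ => .pure _)
      fun a b e' _ _ hab => ?_
    rw [sigCode] at *
    rw [hab]
    exact Cov.refl _ fun y _ => id
  rw [val_swap_key S N (unary n) m hff] at e1
  refine le_trans (le_of_eq ?_) e1
  rw [RevocableSignature.honestDel, bind_assoc]
  refine QM.val_bind_congr fun kk hkk => ?_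
  beta_reduce
  have he₁ := (N.keyGen.run_reach Env.vac_valid _ List.nodup_nil (by simp) _ hkk).1.valid
  rw [bind_assoc]
  refine QM.val_bind_congr fun ψ hψ => ?_
  beta_reduce
  have hg := (N.sign.run_reach he₁ _ List.nodup_nil (by simp) _ hψ).1
  have hcl : (S.keyGen.run [unary n] [] >>= fun k =>
      certM S (unary n) (k.c 0) (pairCode (kk.1.c 1) m)).Closed :=
    S.keyGen.run_closed_bind _ (f := fun k => certM S (unary n) (k 0) (pairCode (kk.1.c 1) m))
      (fun _ _ _ _ => certM_framed _ _ _ _ _ _) fun _ e he => certM_valid _ _ _ e he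
  have e4 : (S.keyGen.run [unary n] [] >>= fun k => f k.c kk.1.c ψ.1.c (ψ.1.q 0)) =
      (S.keyGen.run [unary n] [] >>= fun k =>
        certM S (unary n) (k.c 0) (pairCode (kk.1.c 1) m)) >>= fun _ => z ψ.1.c (ψ.1.q 0) := by
    simp [f]
  rw [e4, QM.val_closed_const hcl hg.valid (fun d J => by
      have := hzf ψ.1.c (ψ.1.q 0) ψ.2.next d J
      rwa [map_shift_eq (hg.lt 0)] at this), QM.total_bind_eq, S.keyGen.run_total Env.vac_valid _
      List.nodup_nil (by simp), Env.weight_vac, one_mul]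
  · simp [z]
  · exact (S.keyGen.run_reach Env.vac_valid _ List.nodup_nil (by simp)).mono fun k e h =>
      certM_total _ _ _ _ _ h.1.valid

end

/-! ### The two ways to win the deletion game -/

theorem QM.val_bind_add {α : Type} {x : QM α} {f g h : α → QM Prop} {e : Env}
    (H : x.All e fun a e' => QM.val (f a) e' ≤ QM.val (g a) e' + QM.val (h a) e') :
    QM.val (x >>= f) e ≤ QM.val (x >>= g) e + QM.val (x >>= h) e := by
  rw [QM.val_bind, QM.val_bind, QM.val_bind, ← List.sum_map_add]
  exact List.sum_le_sum fun y hy => H y hy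

/-- Ignoring an additional experiment can only increase the probability of an event. -/
theorem QM.val_bind_pure_le {α : Type} {x : QM α} {P : α → Prop} {q : Prop} {e : Env}
    (hx : QM.total x e ≤ e.weight) (hP : ∀ a, P a → q) :
    QM.val (x >>= fun a => pure (P a)) e ≤ QM.val (pure q : QM Prop) e := by
  classical
  by_cases hq : q
  · refine (QM.val_le_total _ _).trans ?_
    rw [QM.val_pure, if_pos hq]
    exact QM.total_bind_le_weight hx fun _ _ => (QM.total_pure _ _).le
  · have h : ∀ a, P a = False := fun a => by simpa using fun h => hq (hP a h)
    rw [QM.val_bind]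
    simp [h, hq, QM.val_pure]

theorem QM.val_pure_mono {p q : Prop} (h : p → q) (e : Env) :
    QM.val (pure p : QM Prop) e ≤ QM.val (pure q : QM Prop) e := by
  simpa using QM.val_bind_pure_le (x := (pure () : QM Unit)) (P := fun _ => p)
    (QM.total_pure _ e).le fun _ => h

/-- The configuration in which the second part of an adversary starts. -/
def chal (s : Config) (c : Bits) (q : List ℕ) (t : ℕ) : Config :=
  { ((s.setC 0 c).setQ 0 q) with fuel := t }

theorem Good.chal {s : Config} {e e' : Env} (h : Good s e) (he : e'.Valid)
    (hn : e.next ≤ e'.next) {q : List ℕ} (hq : q.Nodup)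
    (hl : ∀ a ∈ q, e.next ≤ a ∧ a < e'.next) (c : Bits) (t : ℕ) : Good (chal s c q t) e' :=
  (h.setQ_fresh he hn hq hl 0).good.of_q rfl

theorem chal_mapQ (s : Config) (c : Bits) (q : List ℕ) (t : ℕ) (f : ℕ → ℕ) :
    (chal s c q t).mapQ f = chal (s.mapQ f) c (q.map f) t := by
  simp only [chal, Config.mapQ, Config.setC, Config.setQ, Config.mk.injEq, true_and, and_true]
  funext r
  by_cases hr : r = 0
  · subst hr; simp
  · simp [hr]

section
variable {S : Signature} {N R : RevocableSignature}

theorem RevocableSignature.oracle_fresh (R : RevocableSignature) (n : ℕ) (k : Bits) :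
    (R.oracle n k).Fresh := fun m e he =>
  (R.sign.run_reach he _ List.nodup_nil (by simp)).bind fun ψ e' h => .pure
    ⟨h.1.valid, h.2.1, h.1.nodup 0, fun a ha =>
      ⟨(h.2.2 0 a ha).resolve_right (by simp), h.1.lt 0 a ha⟩⟩

theorem RevocableSignature.oracle_linear (R : RevocableSignature) (n : ℕ) (k m : Bits) :
    (R.oracle n k m).Linear := (QPTAlg.run_linear _ _ _).bind fun _ => .pure _

theorem RevocableSignature.oracle_framed (R : RevocableSignature) (n : ℕ) (k : Bits) (M d : ℕ)
    (J : Finset ℕ → ℂ) : Oracle.Framed M d J (R.oracle n k) := fun _ =>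
  (QPTAlg.run_framed_nil _ _).bind fun _ => .pure rfl

/-- The first part of the deletion game, with the signature on the challenge message as in
`signM`: key generation, first part of the adversary, challenge signature, second part of the
adversary. -/
def attack (S : Signature) (N R : RevocableSignature) (A₁ A₂ : Prog) (t : ℕ) (z : Bits) (n : ℕ)
    {α : Type} (f : Config → Config → Bits × Config × Bits → Config → QM α) : QM α := do
  let k ← S.keyGen.run [unary n] []
  let s₁ ← A₁.exec (R.oracle n (k.c 0)) (Config.start [unary n, z, k.c 1] [] t)
  let u ← signM N (certM S (unary n) (k.c 0)) (unary n) (s₁.c 0)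
  let s₂ ← A₂.exec (R.oracle n (k.c 0)) (chal s₁ (sigCode u.1 u.2.2 (u.2.1.c 0)) (u.2.1.q 0) t)
  f k s₁ u s₂

/-- The adversary returns a valid certificate of another one-time key than that in the
challenge. -/
def forge (S : Signature) (N R : RevocableSignature) (A₁ A₂ : Prog) (t : ℕ) (z : Bits) (n : ℕ)
    (E : Bits → List Bits → Prop) : QM Prop :=
  attack S N R A₁ A₂ t z n fun k s₁ u s₂ => do
    let v ← S.ver.run [unary n, k.c 1, (unpairCode (unpairCode (s₂.c 1)).2).1,
      pairCode (unpairCode (s₂.c 1)).1 (s₁.c 0)] []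
    return v.accepts ∧ E (s₁.c 0) s₂.log ∧ (unpairCode (s₂.c 1)).1 ≠ u.1

/-- The adversary deletes the one-time signature in the challenge, and returns a valid one for the
same one-time key. -/
def reuse (S : Signature) (N R : RevocableSignature) (A₁ A₂ : Prog) (t : ℕ) (z : Bits) (n : ℕ)
    (E : Bits → List Bits → Prop) : QM Prop :=
  attack S N R A₁ A₂ t z n fun _ s₁ u s₂ => do
    let w ← N.ver.run [unary n, u.1, (unpairCode (unpairCode (s₂.c 1)).2).2, s₁.c 0] (s₂.q 0)
    let d ← N.cert.run [unary n, u.2.1.c 1, s₂.c 0] []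
    return w.accepts ∧ d.accepts ∧ E (s₁.c 0) s₂.log

theorem attack_le_add {A₁ A₂ : Prog} {t : ℕ} {z : Bits} {n : ℕ}
    {f g h : Config → Config → Bits × Config × Bits → Config → QM Prop}
    (H : ∀ k s₁ u s₂ e, Good s₂ e → QM.val (f k s₁ u s₂) e ≤
      QM.val (g k s₁ u s₂) e + QM.val (h k s₁ u s₂) e) :
    QM.val (attack S N R A₁ A₂ t z n f) Env.vac ≤
      QM.val (attack S N R A₁ A₂ t z n g) Env.vac + QM.val (attack S N R A₁ A₂ t z n h) Env.vac := by
  refine QM.val_bind_add fun k hk => ?_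
  have he₁ := (S.keyGen.run_reach Env.vac_valid _ List.nodup_nil (by simp) _ hk).1.valid
  refine QM.val_bind_add fun s₁ hs₁ => ?_
  have h₁ := Prog.exec_reach (R.oracle_fresh n _) A₁ _ _ (Good.start he₁ _ List.nodup_nil (by simp) t)
    _ hs₁
  refine QM.val_bind_add fun u hu => ?_
  obtain ⟨he₂, hn, hd, hl⟩ := signM_reach N (certM_reach S _ _) _ _ h₁.good.valid _ hu
  refine QM.val_bind_add fun s₂ hs₂ => ?_
  exact H _ _ _ _ _ (Prog.exec_reach (R.oracle_fresh n _) A₂ _ _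
    (h₁.good.chal he₂ hn hd hl _ t) _ hs₂).good

/-- If `vk' = v`, the classical verification is forgotten, otherwise the two checks of `N` are. -/
theorem verify_le_add (n : ℕ) (k m vk' v c ck cert : Bits) (σ : Bits) (q : List ℕ) (E : Prop)
    {e : Env} (he : e.Valid) (hq : q.Nodup) (hl : ∀ a ∈ q, a < e.next) :
    QM.val (do
      let v' ← S.ver.run [unary n, k, σ, pairCode vk' m] []
      let w ← N.ver.run [unary n, vk', c, m] q
      let d ← N.cert.run [unary n, ck, cert] []
      return v'.accepts ∧ w.accepts ∧ d.accepts ∧ E) e ≤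
    QM.val (do
      let v' ← S.ver.run [unary n, k, σ, pairCode vk' m] []
      return v'.accepts ∧ E ∧ vk' ≠ v) e +
    QM.val (do
      let w ← N.ver.run [unary n, v, c, m] q
      let d ← N.cert.run [unary n, ck, cert] []
      return w.accepts ∧ d.accepts ∧ E) e := by
  by_cases hv : vk' = v
  · subst hv
    refine le_add_of_nonneg_of_le (QM.val_nonneg _ _) ?_
    set zz : QM Prop := do
      let w ← N.ver.run [unary n, vk', c, m] q
      let d ← N.cert.run [unary n, ck, cert] []
      return w.accepts ∧ d.accepts ∧ E with hzz
    have hf : ∀ d J, QM.Framed e.next d J id zz zz := fun d J => by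
      have := (N.ver.run_framed (N := e.next) (d := d) (J := J) [unary n, vk', c, m] q)
      rw [map_shift_eq hl] at this
      exact this.bind fun w => (N.cert.run_framed_nil _).bind fun _ => .pure rfl
    -- Although the classical verification runs first and leaves qubits in the memory, it is
    -- independent of `q` and halts with certainty, so removing it does not change the value.
    have h1 := QM.val_closed_const (S.ver.runC_closed [unary n, k, σ, pairCode vk' m]) he hf
    rw [S.ver.runC_total _ Env.vac_valid, Env.weight_vac, one_mul,
      ← QPTAlg.run_bind (f := fun _ => zz)] at h1
    rw [← h1]
    refine QM.val_bind_mono fun v' _ => QM.val_bind_mono fun w _ => QM.val_bind_mono fun d _ =>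
      QM.val_pure_mono (fun h => h.2) _
  · refine le_add_of_le_of_nonneg ?_ (QM.val_nonneg _ _)
    refine QM.val_bind_mono fun v' hv' => ?_
    have h' := S.ver.run_reach he _ List.nodup_nil (by simp) _ hv'
    beta_reduce
    rw [show (N.ver.run [unary n, vk', c, m] q >>= fun w =>
        N.cert.run [unary n, ck, cert] [] >>= fun d =>
          (pure (v'.1.accepts ∧ w.accepts ∧ d.accepts ∧ E) : QM Prop)) =
      (N.ver.run [unary n, vk', c, m] q >>= fun w =>
        N.cert.run [unary n, ck, cert] [] >>= fun d => pure (w, d)) >>= fun a =>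
          pure (v'.1.accepts ∧ a.1.accepts ∧ a.2.accepts ∧ E) by simp]
    have hl' : ∀ a ∈ q, a < v'.2.next := fun a ha => (hl a ha).trans_le h'.2.1
    refine QM.val_bind_pure_le ?_ fun a ha => ⟨ha.1, ha.2.2.2, hv⟩
    refine QM.total_bind_le_weight (N.ver.run_total h'.1.valid _ hq hl').le ?_
    refine (N.ver.run_reach h'.1.valid _ hq hl').mono fun w e' h2 => ?_
    exact QM.total_bind_le_weight (N.cert.run_total h2.1.valid _ List.nodup_nil (by simp)).le
      fun _ _ => (QM.total_pure _ _).le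

/-- Here an upper bound is sought, so the algorithms of `R` are replaced by the experiments that
they implement, using the reversed inclusions of `SignSpec` and `VerSpec`. The adversary still has
the oracle of `R`; that is simulated later. -/
theorem deletionGame_le_add (hk : R.keyGen = S.keyGen) (hc : R.cert = N.cert)
    (hs : SignSpec S N R) (hv : VerSpec S N R) (A₁ A₂ : Prog) (t : ℕ) (z : Bits) (n : ℕ)
    (E : Bits → List Bits → Prop) :
    (R.deletionGame A₁ A₂ t z n).prob (fun r =>
      r.cert.accepts ∧ r.ver.accepts ∧ E r.target r.queries) ≤
    QM.val (forge S N R A₁ A₂ t z n E) Env.vac + QM.val (reuse S N R A₁ A₂ t z n E) Env.vac := by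
  rw [QM.prob_eq_val]
  refine le_trans ?_ (attack_le_add (f := fun k s₁ u s₂ => do
    let v ← S.ver.run [unary n, k.c 1, (unpairCode (unpairCode (s₂.c 1)).2).1,
      pairCode (unpairCode (s₂.c 1)).1 (s₁.c 0)] []
    let w ← N.ver.run [unary n, (unpairCode (s₂.c 1)).1, (unpairCode (unpairCode (s₂.c 1)).2).2,
      s₁.c 0] (s₂.q 0)
    let d ← N.cert.run [unary n, u.2.1.c 1, s₂.c 0] []
    return v.accepts ∧ w.accepts ∧ d.accepts ∧ E (s₁.c 0) s₂.log)
    fun k s₁ u s₂ e h => verify_le_add n _ _ _ _ _ _ _ _ _ _ h.valid (h.nodup 0) (h.lt 0))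
  refine Cov.val_le ?_
  have lin : ∀ A s k, (Prog.exec (R.oracle n k) A s).Linear := fun A s k =>
    Prog.exec_linear (R.oracle_linear n k) A s
  have run : ∀ (A : QPTAlg) (ins : List Bits) (qs : List ℕ), (A.run ins qs).Linear :=
    fun A ins qs => A.run_linear ins qs
  simp only [RevocableSignature.deletionGame, bind_assoc, hk, hc, pure_bind]
  refine Cov.bind_refl (fun k => (lin _ _ _).bind fun _ => (run _ _ _).bind fun _ =>
    (lin _ _ _).bind fun _ => (run _ _ _).bind fun _ => (run _ _ _).bind fun _ => .pure _)
    fun k e₁ hk₁ => ?_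
  have he₁ := (S.keyGen.run_reach Env.vac_valid _ List.nodup_nil (by simp) _ hk₁).1.valid
  refine Cov.bind_refl (fun _ => (run _ _ _).bind fun _ =>
    (lin _ _ _).bind fun _ => (run _ _ _).bind fun _ => (run _ _ _).bind fun _ => .pure _)
    fun s₁ e₂ hs₁ => ?_
  have h₁ := Prog.exec_reach (R.oracle_fresh n _) A₁ _ _ (Good.start he₁ _ List.nodup_nil (by simp) t)
    _ hs₁
  refine ((hs _ _ _ _ h₁.good.valid).2).bind (fun _ =>
    (lin _ _ _).bind fun _ => (run _ _ _).bind fun _ => (run _ _ _).bind fun _ => .pure _)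
    fun ψ u e₃ _ hu hψ => ?_
  obtain ⟨he₃, hn, hd, hl⟩ := signM_reach N (certM_reach S _ _) _ _ h₁.good.valid _ hu
  rw [hψ.1, hψ.2.1, hψ.2.2]
  refine Cov.bind_refl (fun _ => (run _ _ _).bind fun _ => (run _ _ _).bind fun _ => .pure _)
    fun s₂ e₄ hs₂ => ?_
  have h₂ := (Prog.exec_reach (R.oracle_fresh n _) A₂ _ _
    (h₁.good.chal he₃ hn hd hl _ t) _ hs₂).good
  have h4 := ((hv (unary n) (k.c 1) (s₂.c 1) (s₁.c 0) _ e₄ h₂.valid (h₂.nodup 0) (h₂.lt 0)).2).bind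
    (R' := fun p q : Prop => p → q)
    (f := fun v => N.cert.run [unary n, u.2.1.c 1, s₂.c 0] [] >>= fun d =>
      (pure (d.accepts ∧ v.accepts ∧ E (s₁.c 0) s₂.log) : QM Prop))
    (g := fun p => N.cert.run [unary n, u.2.1.c 1, s₂.c 0] [] >>= fun d =>
      (pure (p ∧ d.accepts ∧ E (s₁.c 0) s₂.log) : QM Prop))
    (fun _ => (run _ _ _).bind fun _ => .pure _) fun v p e₅ _ _ hvp =>
      Cov.bind_refl (fun _ => .pure _) fun d e₆ _ => .cons
        (fun ⟨h1, h2, h3⟩ => ⟨hvp.1 h2, h1, h3⟩) (.nil _)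
  simpa only [verM, bind_assoc, pure_bind, and_assoc] using h4

end

/-! ### Simulation of the signing oracle -/

/-- Answer the query to the signing oracle of an adversary in the block `4`. -/
def simQuery (N : RevocableSignature) (P : Prog) (r r₁ r₂ p : ℕ) : Prog :=
  .seq (.instr (.copy (reg 4 r) 2)) <| .seq (signProg N P) <|
  .seq (.instr (.copy 6 (reg 4 r₁))) <| .seq (.instr (.copy (reg 2 1) (reg 4 r₂)))
    (.instr (.moveAll (reg 2 0) (reg 4 p)))

/-- The program `P` implements the experiment `mt` on strings of length at most `y`, with at most
`p` steps and results of length at most `L`; the strings `n`, `k` in the registers `0`, `1` are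
available. -/
def Certifies (P : Prog) (O : Oracle) (mt : Bits → QM Bits) (upd : Bits → List Bits → List Bits)
    (n k : Bits) (y L p : ℕ) : Prop :=
  ∀ (s : Config) (D : ℕ) (e : Env), e.Valid → s.c 0 = n → s.c 1 = k → s.c 15 = [] → s.q 15 = [] →
    (s.c 3).length ≤ y → D + p ≤ s.fuel →
    Cov (CertPost upd s D L) (mt (s.c 3) e) (P.exec O s e)

/-- Some registers have the contents `u`, and the log is related to that of the adversary. -/
structure SimInv (u : ℕ → Bits) (LI : List Bits → List Bits → Prop) (l : List Bits) (s : Config) :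
    Prop where
  c : ∀ r < 16, r < 2 ∨ 7 ≤ r → s.c r = u r
  q : s.q 15 = []
  log : LI l s.log

theorem outer_simInv (u : ℕ → Bits) (LI : List Bits → List Bits → Prop) :
    Outer (reg 4) (SimInv u LI) := by
  intro l s s' hc hq hl h
  have hne : ∀ r < 16, ∀ i, r ≠ reg 4 i := fun r hr => ne_reg_of_blk (by omega)
    (by rw [blk_small hr]; omega)
  exact ⟨fun r hr hr' => by rw [hc r (hne r hr), h.c r hr hr'],
    by rw [hq 15 (hne 15 (by omega)), h.q], by rw [hl]; exact h.log⟩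

/-- This is `(C - 1) * (c - 1) ≥ 0`: when the guest pays `c` steps, the host can pay the same amount
and `C - 1` further steps. -/
theorem cost_le {C c F a : ℕ} (hC : 1 ≤ C) (hc : 1 ≤ c) (h : C * (c + F) ≤ a) :
    C * F + (C - 1) + c ≤ a := by
  obtain ⟨C, rfl⟩ := Nat.exists_eq_add_of_le hC
  obtain ⟨c, rfl⟩ := Nat.exists_eq_add_of_le hc
  have : 0 ≤ C * c := Nat.zero_le _
  simp only [Nat.add_sub_cancel_left]
  nlinarith

section
variable {S : Signature} {N R : RevocableSignature}

/-- The guest pays for its query and for the length of the answer. The query frees at least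
`signCost + 3` host steps beyond its own cost, enough for signing and the fixed costs of the three
final moves; the lengths moved are paid with the answer. Queries have length at most `T`, as they
cost their length, so `n + T ≤ x` bounds the inputs of signing. -/
theorem simQuery_cov (hs : SignSpec S N R) {P : Prog} {O : Oracle}
    {upd : Bits → List Bits → List Bits} {n : ℕ} {k k' : Bits} {B D T x L p : ℕ} {u : ℕ → Bits}
    {LI : List Bits → List Bits → Prop}
    (hP : Certifies P O (certM S (unary n) k) upd (unary n) k' (msgLen N x) L p)
    (h0 : u 0 = unary n) (h1 : u 1 = k') (h15 : u 15 = [])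
    (hLI : ∀ l l' m v, LI l l' → LI (m :: l) (upd (pairCode v m) l')) (hx : n + T ≤ x)
    {s s' : Config} {e : Env} (r r₁ r₂ pq : ℕ) (hg : Good s e)
    (h : Hosts (reg 4) B (signCost N x L p + 4) D T (SimInv u LI) s s') (hr : r < B) :
    Cov (Hosts (reg 4) B (signCost N x L p + 4) D T (SimInv u LI))
      ((Instr.query r r₁ r₂ pq).exec (R.oracle n k) s e) ((simQuery N P r r₁ r₂ pq).exec O s' e) := by
  by_cases hfu : 1 + (s.c r).length ≤ s.fuel
  swap
  · simp only [Instr.exec, spend, if_neg hfu]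
    exact .nil _
  simp only [Instr.exec, spend_eq hfu, pure_bind, RevocableSignature.oracle, bind_assoc]
  have hfuel := h.fuel
  have hT := h.le
  set F := s.fuel - (1 + (s.c r).length) with hF
  have hfF : s.fuel = 1 + (s.c r).length + F := by omega
  have hc1 := cost_le (C := signCost N x L p + 4) (c := 1 + (s.c r).length) (F := F) (by omega)
    (by omega) (a := s'.fuel - D) (by rw [← hfF]; omega)
  obtain ⟨t₁, g1, f1, c1, q1, l1⟩ := exec_copy O (s := s') (r := reg 4 r) (r' := 2)
    (by rw [h.c r hr]; omega)
  rw [h.c r hr] at f1 c1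
  rw [simQuery, Prog.exec_seq_pure g1, Prog.exec_seq]
  have ne : ∀ i < 16, ∀ k < 8, blk i ≠ k := fun i hi k hk => by rw [blk_small hi]; omega
  have d : ∀ i < 16, i < 2 ∨ 7 ≤ i → t₁.c i = u i := fun i hi hi' => by
    rw [c1, Function.update_of_ne (by omega), h.inv.c i hi hi']
  -- Two inclusions are composed: from the signing algorithm of `R` to the experiment `signM`, and
  -- from there to its program.
  have cov := ((hs (unary n) k (s.c r) e hg.valid).2).trans
    (signProg_cov N (x := x) (s := t₁) (D := (signCost N x L p + 4) * F + D + 3) (m := s.c r)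
      (certM_linear S (unary n) k)
      hP hg.valid (by rw [d 0 (by omega) (by omega), h0]) (by rw [d 1 (by omega) (by omega), h1])
      (by rw [c1, Function.update_self]) (by rw [d 15 (by omega) (by omega), h15])
      (by rw [q1, h.inv.q]) (by rw [length_unary]; omega) (by omega))
  refine cov.bind (fun _ => (QM.Linear.spend _ _).bind fun _ => .pure _) fun ψ t₂ e₂ _ _ hψ => ?_
  obtain ⟨w, ⟨hw0, hw1, hwq⟩, p2⟩ := hψ
  -- If the adversary cannot pay for the answer, its branch is abandoned and needs no counterpart.
  by_cases hfu2 : (ψ.c 0).length + (ψ.c 1).length + (ψ.q 0).length ≤ F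
  swap
  · simp only [spend, if_neg hfu2]
    exact .nil _
  rw [spend_eq hfu2, pure_bind]
  have f2 := p2.fuel
  have m2 : (signCost N x L p + 4) * F = (signCost N x L p + 4) *
      ((ψ.c 0).length + (ψ.c 1).length + (ψ.q 0).length) + (signCost N x L p + 4) *
      (F - ((ψ.c 0).length + (ψ.c 1).length + (ψ.q 0).length)) := by
    rw [← Nat.mul_add, Nat.add_sub_cancel' hfu2]
  have m3 : (ψ.c 0).length + (ψ.c 1).length + (ψ.q 0).length ≤ (signCost N x L p + 4) *
    ((ψ.c 0).length + (ψ.c 1).length + (ψ.q 0).length) := Nat.le_mul_of_pos_left _ (by omega)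
  have e6 : t₂.c 6 = ψ.c 0 := by rw [p2.c6, hw0]
  have eck : t₂.c (reg 2 1) = ψ.c 1 := by rw [p2.ck, hw1]
  have eq : t₂.q (reg 2 0) = ψ.q 0 := by rw [p2.q2, hwq]
  have r42 : ∀ i j, reg 2 i ≠ reg 4 j := fun i j => by simp only [reg]; omega
  obtain ⟨t₃, g3, f3, c3, q3, l3⟩ := exec_copy O (s := t₂) (r := 6) (r' := reg 4 r₁)
    (by rw [e6]; omega)
  rw [e6] at f3 c3
  have eck3 : t₃.c (reg 2 1) = ψ.c 1 := by rw [c3, Function.update_of_ne (r42 _ _), eck]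
  obtain ⟨t₄, g4, f4, c4, q4, l4⟩ := exec_copy O (s := t₃) (r := reg 2 1) (r' := reg 4 r₂)
    (by rw [eck3]; omega)
  rw [eck3] at f4 c4
  have eq4 : t₄.q (reg 2 0) = ψ.q 0 := by rw [q4, q3, eq]
  obtain ⟨t₅, g5, f5, c5, q5, l5⟩ := exec_moveAll O (s := t₄) (p := reg 2 0) (p' := reg 4 pq)
    (by rw [eq4]; omega)
  rw [eq4] at f5 q5
  rw [Prog.exec_seq_pure g3, Prog.exec_seq_pure g4, g5]
  have b4 : ∀ i, blk (reg 4 i) = 4 := fun i => blk_reg (by omega) i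
  refine .cons ⟨fun i hi => ?_, fun i hi => ?_, ?_, ?_, fun i hi hi' => ?_, ?_, ?_⟩ (.nil _)
  · rw [c5, c4, c3]
    have : t₂.c (reg 4 i) = s.c i := by
      rw [p2.c _ (by simp only [reg]; omega) (by rw [b4]; omega) (by rw [b4]; omega)
        (by rw [b4]; omega), c1, Function.update_of_ne (by simp only [reg]; omega), h.c i hi]
    simp only [Config.setC, Config.setQ, Function.update_apply, (reg_injective 4).eq_iff, this]
  · rw [q5, q4, q3]
    have : t₂.q (reg 4 i) = s.q i := by
      rw [p2.q _ (by simp only [reg]; omega) (by rw [b4]; omega) (by rw [b4]; omega)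
        (by rw [b4]; omega), q1, h.q i hi]
    simp only [Config.setC, Config.setQ, Function.update_apply, (reg_injective 4).eq_iff,
      (r42 _ _).symm, this, if_false]
  · simp only [Config.setC, Config.setQ]
    omega
  · simp only [Config.setC, Config.setQ]
    omega
  · rw [c5, c4, Function.update_of_ne (ne_reg_of_blk (by omega) (ne i hi 4 (by omega)) _), c3,
      Function.update_of_ne (ne_reg_of_blk (by omega) (ne i hi 4 (by omega)) _),
      p2.c i (by omega) (ne i hi _ (by omega)) (ne i hi _ (by omega)) (ne i hi _ (by omega)),
      d i hi hi']
  · rw [q5, Function.update_of_ne (by simp only [reg]; omega),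
      Function.update_of_ne (by simp only [reg]; omega), q4, q3,
      p2.q 15 (by omega) (ne _ (by omega) _ (by omega)) (ne _ (by omega) _ (by omega))
        (ne _ (by omega) _ (by omega)), q1, h.inv.q]
  · rw [l5, l4, l3, p2.log, l1]
    exact hLI _ _ _ _ h.inv.log

/-- Simulation of an adversary with access to the signing oracle, in the block `4`. -/
theorem exec_sim (hs : SignSpec S N R) {P : Prog} {O : Oracle}
    {upd : Bits → List Bits → List Bits} {n : ℕ} {k k' : Bits} {B D T x L p : ℕ} {u : ℕ → Bits}
    {LI : List Bits → List Bits → Prop}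
    (hP : Certifies P O (certM S (unary n) k) upd (unary n) k' (msgLen N x) L p)
    (h0 : u 0 = unary n) (h1 : u 1 = k') (h15 : u 15 = [])
    (hLI : ∀ l l' m v, LI l l' → LI (m :: l) (upd (pairCode v m) l')) (hx : n + T ≤ x)
    (A : Prog) (hA : A.bound ≤ B) {s s' : Config} {e : Env} (hg : Good s e)
    (h : Hosts (reg 4) B (signCost N x L p + 4) D T (SimInv u LI) s s') :
    Cov (Hosts (reg 4) B (signCost N x L p + 4) D T (SimInv u LI))
      (A.exec (R.oracle n k) s e) ((A.inline (reg 4) (simQuery N P)).exec O s' e) :=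
  Prog.exec_inline (R.oracle_fresh n k) (R.oracle_linear n k) (reg_injective 4) (by omega)
    (outer_simInv u LI) (fun _ _ _ r r₁ r₂ pq hg h hr _ _ _ =>
      simQuery_cov hs hP h0 h1 h15 hLI hx r r₁ r₂ pq hg h hr) A hA s s' e hg h

end

/-! ### The forger -/

section
variable {S : Signature} {N R : RevocableSignature}

/-- The key `k` is held by the oracle; the content `k'` of register `1` is irrelevant. In the forger
it is the advice. -/
theorem certifies_query (S : Signature) {n : ℕ} {k k' : Bits} {y y' : ℕ}
    (hy : n + k.length + y ≤ y') :
    Certifies (.instr (.query 3 4 5 0)) (S.oracle n k) (certM S (unary n) k) List.cons (unary n) k'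
      y (S.sign.outLen y') (1 + y + S.sign.outLen y') := by
  intro s D e he _ _ _ _ h3 hf
  have h1 : 1 + (s.c 3).length ≤ s.fuel := by omega
  simp only [Prog.exec, Instr.exec, spend_eq h1, pure_bind, Signature.oracle, certM, bind_assoc]
  refine Cov.bind_refl (fun _ => .pure _) fun σ e' hσ => ?_
  have hl : (σ.c 0).length ≤ S.sign.outLen y' :=
    ((S.sign.run_length _ _ _ _ hσ).1 0).trans (S.sign.outLen_mono (by
      simp [inputSize, length_unary]; omega))
  rw [spend_eq (by simp only [List.length_nil]; omega), pure_bind]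
  refine .cons ⟨?_, hl, fun r hr hr' _ => ?_, fun r hr _ => ?_, rfl, ?_⟩ (.nil _)
  · simp [Config.setC, Config.setQ]
  · simp [Config.setC, Config.setQ, hr, hr']
  · simp [Config.setC, Config.setQ, hr]
  · simp only [Config.setC, Config.setQ, List.length_nil]
    omega

/-- Compute the challenge for the adversary in the block `4`. -/
def challenge (N : RevocableSignature) (P : Prog) : Prog :=
  .seq (.instr (.copy (reg 4 0) 2)) <| .seq (.instr (.copy (reg 4 0) 8)) <|
  .seq (signProg N P) <| .seq (.instr (.copy 6 (reg 4 0))) (.instr (.moveAll (reg 2 0) (reg 4 0)))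

/-- The second part of an adversary starts with `T` new steps, so `hD` keeps `C * T` host steps in
reserve besides the cost of signing and copying. The message is saved in register `8`, which
simulated queries leave alone. -/
theorem challenge_cov {mt : Bits → QM Bits} (hmt : ∀ m, (mt m).Linear) {P : Prog} {O : Oracle}
    {upd : Bits → List Bits → List Bits} {n : Bits} {k' : Bits} {B C D D' T x L p K : ℕ}
    {u : ℕ → Bits} {LI : List Bits → List Bits → Prop} {LI' : Bits → List Bits → List Bits → Prop}
    (hP : Certifies P O mt upd n k' (msgLen N x) L p)
    (h0 : u 0 = n) (h1 : u 1 = k') (h15 : u 15 = []) {s s' : Config} {e : Env} (hg : Good s e)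
    (hLI : ∀ v l', LI s.log l' → LI' v s.log (upd (pairCode v (s.c 0)) l'))
    (h : Hosts (reg 4) B C D T (SimInv u LI) s s') (hB : 0 < B) (hK : (s.c 0).length ≤ K)
    (hx : n.length + K ≤ x)
    (hD : C * T + D' + (4 + 2 * K + 2 * sigLen N x L + signCost N x L p) ≤ D) :
    Cov (fun w s' => Hosts (reg 4) B C D' T (SimInv (Function.update u 8 (s.c 0)) (LI' w.1))
          (chal s (sigCode w.1 w.2.2 (w.2.1.c 0)) (w.2.1.q 0) T) s' ∧
        (sigCode w.1 w.2.2 (w.2.1.c 0)).length ≤ sigLen N x L ∧ (w.2.1.q 0).length ≤ sigLen N x L)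
      (signM N mt n (s.c 0) e) ((challenge N P).exec O s' e) := by
  have hfuel := h.fuel
  have b4 : ∀ i, blk (reg 4 i) = 4 := fun i => blk_reg (by omega) i
  have ne : ∀ i < 16, ∀ k < 8, blk i ≠ k := fun i hi k hk => by rw [blk_small hi]; omega
  have n4 : ∀ i j, i < 16 → reg 4 j ≠ i := fun i j hi => by simp only [reg]; omega
  obtain ⟨t₁, g1, f1, c1, q1, l1⟩ := exec_copy O (s := s') (r := reg 4 0) (r' := 2)
    (by rw [h.c 0 hB]; omega)
  rw [h.c 0 hB] at f1 c1
  have d1 : t₁.c (reg 4 0) = s.c 0 := by rw [c1, Function.update_of_ne (n4 _ _ (by omega)), h.c 0 hB]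
  obtain ⟨t₂, g2, f2, c2, q2, l2⟩ := exec_copy O (s := t₁) (r := reg 4 0) (r' := 8)
    (by rw [d1]; omega)
  rw [d1] at f2 c2
  rw [challenge, Prog.exec_seq_pure g1, Prog.exec_seq_pure g2, Prog.exec_seq]
  have d2 : ∀ i < 16, i < 2 ∨ 7 ≤ i → t₂.c i = Function.update u 8 (s.c 0) i := fun i hi hi' => by
    rw [c2]
    by_cases h8 : i = 8
    · subst h8; simp
    · rw [Function.update_of_ne h8, Function.update_of_ne h8, c1, Function.update_of_ne (by omega),
        h.inv.c i hi hi']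
  have cov := signProg_cov N (x := x) (s := t₂) (D := C * T + D' + (2 + 2 * sigLen N x L))
    (m := s.c 0) hmt hP hg.valid
    (by rw [d2 0 (by omega) (by omega), Function.update_of_ne (by omega), h0])
    (by rw [d2 1 (by omega) (by omega), Function.update_of_ne (by omega), h1])
    (by rw [c2, Function.update_of_ne (by omega), c1, Function.update_self])
    (by rw [d2 15 (by omega) (by omega), Function.update_of_ne (by omega), h15])
    (by rw [q2, q1, h.inv.q]) (by omega) (by omega)
  have main : ∀ w t₃ e', SignPost upd (s.c 0) t₂ (C * T + D' + (2 + 2 * sigLen N x L))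
      (sigLen N x L) w t₃ → Cov (fun w s' =>
        Hosts (reg 4) B C D' T (SimInv (Function.update u 8 (s.c 0)) (LI' w.1))
          (chal s (sigCode w.1 w.2.2 (w.2.1.c 0)) (w.2.1.q 0) T) s' ∧
        (sigCode w.1 w.2.2 (w.2.1.c 0)).length ≤ sigLen N x L ∧ (w.2.1.q 0).length ≤ sigLen N x L)
        ((pure w : QM _) e') ((Prog.seq (.instr (.copy 6 (reg 4 0)))
          (.instr (.moveAll (reg 2 0) (reg 4 0)))).exec O t₃ e') := by
    intro w t₃ e' p3
    have f3 := p3.fuel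
    have l6 := p3.len6
    have lq := p3.lenq
    obtain ⟨t₄, g4, f4, c4, q4, l4⟩ := exec_copy O (s := t₃) (r := 6) (r' := reg 4 0) (by omega)
    rw [p3.c6] at c4
    have l6' : (sigCode w.1 w.2.2 (w.2.1.c 0)).length ≤ sigLen N x L := by rw [← p3.c6]; exact l6
    have eq4 : t₄.q (reg 2 0) = w.2.1.q 0 := by rw [q4, p3.q2]
    obtain ⟨t₅, g5, f5, c5, q5, l5⟩ := exec_moveAll O (s := t₄) (p := reg 2 0) (p' := reg 4 0)
      (by rw [eq4]; omega)
    rw [eq4] at f5 q5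
    rw [Prog.exec_seq_pure g4, g5]
    refine .cons ⟨⟨fun i hi => ?_, fun i hi => ?_, ?_, le_rfl, fun i hi hi' => ?_, ?_, ?_⟩, l6', lq⟩
      (.nil _)
    · have : t₃.c (reg 4 i) = s.c i := by
        rw [p3.c _ (by simp only [reg]; omega) (by rw [b4]; omega) (by rw [b4]; omega)
          (by rw [b4]; omega), c2, Function.update_of_ne (n4 _ _ (by omega)), c1,
          Function.update_of_ne (n4 _ _ (by omega)), h.c i hi]
      rw [c5, c4]
      simp only [chal, Config.setC, Config.setQ, Function.update_apply, (reg_injective 4).eq_iff, this]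
    · have : t₃.q (reg 4 i) = s.q i := by
        rw [p3.q _ (by simp only [reg]; omega) (by rw [b4]; omega) (by rw [b4]; omega)
          (by rw [b4]; omega), q2, q1, h.q i hi]
      have r42 : reg 4 i ≠ reg 2 0 := by simp only [reg]; omega
      rw [q5, q4]
      simp only [chal, Config.setC, Config.setQ, Function.update_apply, (reg_injective 4).eq_iff,
        this, r42, if_false]
    · simp only [chal]
      omega
    · rw [c5, c4, Function.update_of_ne (n4 _ _ hi).symm,
        p3.c i (by omega) (ne i hi _ (by omega)) (ne i hi _ (by omega)) (ne i hi _ (by omega)),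
        d2 i hi hi']
    · rw [q5, Function.update_of_ne (n4 _ _ (by omega)).symm,
        Function.update_of_ne (by simp only [reg]; omega), q4,
        p3.q 15 (by omega) (ne _ (by omega) _ (by omega)) (ne _ (by omega) _ (by omega))
          (ne _ (by omega) _ (by omega)), q2, q1, h.inv.q]
    · rw [l5, l4, p3.log, l2, l1]
      exact hLI _ _ h.inv.log
  have h4 := cov.bind (f := fun t => (pure t : QM _)) (fun _ => .pure _)
    fun t s' e' _ _ p => main t s' e' p
  rwa [bind_pure] at h4

theorem short_start {ins : List Bits} {t K : ℕ} (hK : (ins.map List.length).sum + 2 * t ≤ K) :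
    (Config.start ins [] t).Short K := by
  refine ⟨fun r => ?_, fun p => ?_⟩
  · have := length_getD_le ins r
    simp only [Config.start]
    omega
  · simp only [Config.start, ite_self, List.length_nil]
    omega

theorem Config.Short.c {K : ℕ} {s : Config} (h : s.Short K) (r : ℕ) : (s.c r).length ≤ K :=
  (Nat.le_add_right _ _).trans (h.1 r)

theorem Config.Short.q {K : ℕ} {s : Config} (h : s.Short K) (r : ℕ) : (s.q r).length ≤ K :=
  (Nat.le_add_right _ _).trans (h.2 r)

theorem Config.Short.chal {K M t : ℕ} {s : Config} (h : s.Short K) {c : Bits} {q : List ℕ}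
    (hc : c.length ≤ M) (hq : q.length ≤ M) : (chal s c q t).Short (K + M + 2 * t) := by
  refine ⟨fun r => ?_, fun r => ?_⟩
  · have := h.c r
    simp only [QSig.chal, Config.setC, Config.setQ, Function.update_apply]
    split_ifs <;> omega
  · have := h.q r
    simp only [QSig.chal, Config.setC, Config.setQ, Function.update_apply]
    split_ifs <;> omega

/-- The program that runs an adversary in the deletion game and forges a certificate. -/
def forger (N : RevocableSignature) (A₁ A₂ : Prog) : Prog :=
  .seq (copyIn 4 [0, 1, 2] 0) <|
  .seq (A₁.inline (reg 4) (simQuery N (.instr (.query 3 4 5 0)))) <|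
  .seq (challenge N (.instr (.query 3 4 5 0))) <|
  .seq (A₂.inline (reg 4) (simQuery N (.instr (.query 3 4 5 0)))) <|
  .seq (.instr (.unpair (reg 4 1) 2 3)) <| .seq (.instr (.unpair 3 1 4)) (.instr (.pair 2 8 0))

/-- The run of an adversary in the deletion game. -/
def attackRun (S : Signature) (N R : RevocableSignature) (A₁ A₂ : Prog) (t : ℕ) (z : Bits) (n : ℕ)
    (k : Config) : QM (Config × (Bits × Config × Bits) × Config) := do
  let s₁ ← A₁.exec (R.oracle n (k.c 0)) (Config.start [unary n, z, k.c 1] [] t)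
  let u ← signM N (certM S (unary n) (k.c 0)) (unary n) (s₁.c 0)
  let s₂ ← A₂.exec (R.oracle n (k.c 0)) (chal s₁ (sigCode u.1 u.2.2 (u.2.1.c 0)) (u.2.1.q 0) t)
  return (s₁, u, s₂)

/-- A bound for the length of the strings in the first part of an attack, where `Z` bounds the
advice, and `t` is the number of steps. -/
def attackLen (S : Signature) (n Z t : ℕ) : ℕ := n + Z + S.keyGen.outLen n + 2 * t

/-- A bound for the inputs of the signing algorithm for one-time keys. -/
def attackCertLen (S : Signature) (N : RevocableSignature) (n x : ℕ) : ℕ :=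
  n + S.keyGen.outLen n + msgLen N x

/-- The number of steps of the forger, for each step of the adversary. -/
def forgerRate (N : RevocableSignature) (x L : ℕ) : ℕ := signCost N x L (1 + msgLen N x + L) + 4

/-- The number of steps of the forger at the end. -/
def forgerEnd (N : RevocableSignature) (K x L t : ℕ) : ℕ := 3 + 4 * (K + sigLen N x L + 2 * t)

/-- The number of steps of the forger, where `K` bounds the strings of the adversary, `x` the
inputs of the signing algorithm, and `L` the certificates. -/
def forgerTime (N : RevocableSignature) (K x L t : ℕ) : ℕ :=
  3 + K + (forgerRate N x L * t + (forgerRate N x L * t + forgerEnd N K x L t +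
    (4 + 2 * K + 2 * sigLen N x L + signCost N x L (1 + msgLen N x + L))))

/-- What matters besides the output is the log: the forger asks for pairs whose message was queried
by the adversary, and for one more pair, that of the challenge key and `m*`. -/
theorem forger_cov (hs : SignSpec S N R) (A₁ A₂ : Prog) {n Z t : ℕ} {z : Bits} (hz : z.length ≤ Z)
    {k : Config} {e : Env} (he : e.Valid) (hk : ∀ r, (k.c r).length ≤ S.keyGen.outLen n)
    {K x L : ℕ} (hK : K = attackLen S n Z t) (hx : x = n + K)
    (hL : L = S.sign.outLen (attackCertLen S N n x)) :
    Cov (fun a s => s.c 0 = pairCode (unpairCode (a.2.2.c 1)).1 (a.1.c 0) ∧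
        s.c 1 = (unpairCode (unpairCode (a.2.2.c 1)).2).1 ∧
        ∀ y ∈ s.log, y = pairCode a.2.1.1 (a.1.c 0) ∨ ∃ v, ∃ m ∈ a.2.2.log, y = pairCode v m)
      (attackRun S N R A₁ A₂ t z n k e)
      ((forger N A₁ A₂).exec (S.oracle n (k.c 0))
        (Config.start [unary n, z, k.c 1] [] (forgerTime N K x L t)) e) := by
  have hk1 := hk 1
  have hK' : n + Z + S.keyGen.outLen n + 2 * t = K := hK.symm
  have lin : ∀ A s k, (Prog.exec (R.oracle n k) A s).Linear := fun A s k =>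
    Prog.exec_linear (R.oracle_linear n k) A s
  set O := S.oracle n (k.c 0)
  set ins := [unary n, z, k.c 1] with hins
  have hsum : (ins.map List.length).sum + 2 * t ≤ K := by
    simp [hins, length_unary]
    omega
  have hP : Certifies (.instr (.query 3 4 5 0)) O (certM S (unary n) (k.c 0)) List.cons (unary n) z
      (msgLen N x) L (1 + msgLen N x + L) := by
    rw [hL]
    refine certifies_query S ?_
    have := hk 0
    simp only [attackCertLen]
    omega
  set p := 1 + msgLen N x + L with hp
  set s0 := Config.start ins [] (forgerTime N K x L t) with hs0
  have hT : s0.fuel = 3 + K + ((signCost N x L p + 4) * t + ((signCost N x L p + 4) * t +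
    forgerEnd N K x L t + (4 + 2 * K + 2 * sigLen N x L + signCost N x L p))) := rfl
  have hend : forgerEnd N K x L t = 3 + 4 * (K + sigLen N x L + 2 * t) := rfl
  set C := signCost N x L p + 4 with hC
  obtain ⟨s1, g1, f1, c1, -, b1, q1, l1⟩ := exec_copyIn O (k := 4) (by omega) [0, 1, 2] 0 (s := s0)
    (by simp [blk_small]) (by
      have : (List.map List.length (List.map s0.c [0, 1, 2])).sum = (ins.map List.length).sum := rfl
      simp only [List.length_cons, List.length_nil]
      omega)
  have f1' : C * t + (C * t + forgerEnd N K x L t + (4 + 2 * K + 2 * sigLen N x L +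
      signCost N x L p)) ≤ s1.fuel := by
    have : (List.map List.length (List.map s0.c [0, 1, 2])).sum = (ins.map List.length).sum := rfl
    simp only [List.length_cons, List.length_nil] at f1
    omega
  set D := C * t + forgerEnd N K x L t + (4 + 2 * K + 2 * sigLen N x L + signCost N x L p) with hD
  set B := A₁.bound + A₂.bound + 2 with hB
  -- While the first part runs, each logged string is a one-time key paired with a message queried
  -- so far.
  let LI : List Bits → List Bits → Prop := fun l l' => ∀ y ∈ l', ∃ v, ∃ m ∈ l, y = pairCode v m
  have hH : Hosts (reg 4) B C D t (SimInv (fun r => ins.getD r []) LI)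
      (Config.start ins [] t) s1 := by
    refine ⟨fun r _ => ?_, fun r _ => ?_, f1', le_rfl, fun r hr _ => ?_, ?_, ?_⟩
    · rw [c1 r (Nat.zero_le _)]
      -- The forger has three inputs only, so the registers of block `4`, which start at `20`, are
      -- empty and read as the default value.
      have : s0.c (reg 4 r) = [] := by
        have : ins.length ≤ reg 4 r := by simp only [hins, reg, List.length_cons, List.length_nil]; omega
        change ins.getD (reg 4 r) [] = []
        exact List.getD_eq_default _ _ this
      rw [this]
      rfl
    · rw [q1]
      simp [hs0, Config.start]
    · rw [b1 r (by rw [blk_small hr]; omega)]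
      rfl
    · rw [q1]
      rfl
    · rw [l1]
      exact fun y hy => absurd hy (by simp [hs0, Config.start])
  have hg := Good.start he ins List.nodup_nil (by simp) t
  rw [attackRun, forger, Prog.exec_seq_pure g1, Prog.exec_seq]
  refine (exec_sim hs hP rfl rfl rfl (fun l l' m v h y hy => ?_) (by omega) A₁ (by omega) hg hH).bind
    (fun _ => (signM_linear N (certM_linear _ _ _) _ _).bind fun _ => (lin _ _ _).bind fun _ =>
      .pure _) fun a s2 e₂ ha _ h2 => ?_
  · rcases List.mem_cons.1 hy with rfl | hy
    · exact ⟨v, m, List.mem_cons_self, rfl⟩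
    · obtain ⟨v', m', hm', h'⟩ := h y hy
      exact ⟨v', m', List.mem_cons_of_mem _ hm', h'⟩
  have hg2 := (Prog.exec_reach (R.oracle_fresh n _) A₁ _ _ hg _ ha).good
  have hsh2 : a.Short K := Prog.exec_short A₁ _ e (short_start hsum) _ ha
  have hK0 := hsh2.c 0
  -- The certificate of the challenge key is the only exception; this form of the invariant persists
  -- through the second part.
  let LI' : Bits → List Bits → List Bits → Prop := fun w l l' => ∀ y ∈ l',
    y = pairCode w (a.c 0) ∨ ∃ v, ∃ m ∈ l, y = pairCode v m
  rw [Prog.exec_seq]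
  refine (challenge_cov (certM_linear S (unary n) (k.c 0)) (K := K) (LI' := LI') hP rfl rfl rfl hg2
    (fun v l' h y hy => ?_) h2 (by omega) hK0
    (by rw [length_unary]; omega) le_rfl).bind (fun _ => (lin _ _ _).bind fun _ => .pure _)
    fun w s3 e₃ hw _ h3 => ?_
  · rcases List.mem_cons.1 hy with rfl | hy
    · exact .inl rfl
    · exact .inr (h y hy)
  obtain ⟨h3, hl1, hl2⟩ := h3
  obtain ⟨he₃, hn, hd, hl⟩ := signM_reach N (certM_reach S _ _) _ _ hg2.valid _ hw
  have hg3 := hg2.chal he₃ hn hd hl (sigCode w.1 w.2.2 (w.2.1.c 0)) t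
  rw [Prog.exec_seq]
  refine (exec_sim hs hP rfl rfl rfl (fun l l' m v h y hy => ?_) (by omega) A₂ (by omega) hg3 h3).bind
    (fun _ => .pure _) fun b s4 e₄ hb _ h4 => ?_
  · rcases List.mem_cons.1 hy with rfl | hy
    · exact .inr ⟨v, m, List.mem_cons_self, rfl⟩
    · refine (h y hy).imp_right ?_
      rintro ⟨v', m', hm', h'⟩
      exact ⟨v', m', List.mem_cons_of_mem _ hm', h'⟩
  have hsh4 : b.Short (K + sigLen N x L + 2 * t) :=
    Prog.exec_short A₂ _ e₃ (hsh2.chal hl1 hl2) _ hb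
  have hb1 := hsh4.c 1
  have hf4 := h4.fuel
  have u1 := unpairCode_length (b.c 1)
  have u2 := unpairCode_length (unpairCode (b.c 1)).2
  obtain ⟨t₁, g1, f1, c1, -, l1⟩ := exec_unpair O (s := s4) (r := reg 4 1) (r₁ := 2) (r₂ := 3)
    (by rw [h4.c 1 (by omega)]; omega)
  rw [h4.c 1 (by omega)] at f1 c1
  have d3 : t₁.c 3 = (unpairCode (b.c 1)).2 := by rw [c1, Function.update_self]
  obtain ⟨t₂, g2, f2, c2, -, l2⟩ := exec_unpair O (s := t₁) (r := 3) (r₁ := 1) (r₂ := 4)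
    (by rw [d3]; omega)
  rw [d3] at f2 c2
  have d2 : t₂.c 2 = (unpairCode (b.c 1)).1 := by simp [c2, c1]
  have d8 : t₂.c 8 = a.c 0 := by
    have := h4.inv.c 8 (by omega) (by omega)
    simpa [c2, c1] using this
  obtain ⟨t₃, g3, f3, c3, -, l3⟩ := exec_pair O (s := t₂) (r₁ := 2) (r₂ := 8) (r' := 0)
    (by rw [d2, d8]; omega)
  rw [d2, d8] at c3
  rw [Prog.exec_seq_pure g1, Prog.exec_seq_pure g2, g3]
  refine .cons ⟨by simp [c3], by simp [c3, c2], ?_⟩ (.nil _)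
  rw [l3, l2, l1]
  exact h4.inv.log

theorem isPoly_forgerTime (S : Signature) (N : RevocableSignature) {Z t : ℕ → ℕ} (hZ : IsPoly Z)
    (ht : IsPoly t) : IsPoly fun n => forgerTime N (attackLen S n (Z n) (t n))
      (n + attackLen S n (Z n) (t n))
      (S.sign.outLen (attackCertLen S N n (n + attackLen S n (Z n) (t n)))) (t n) := by
  have hK : IsPoly fun n => attackLen S n (Z n) (t n) :=
    ((IsPoly.id.add hZ).add (IsPoly.id.outLen _)).add ((IsPoly.const 2).mul ht)
  have hx : IsPoly fun n => n + attackLen S n (Z n) (t n) := IsPoly.id.add hK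
  have hL : IsPoly fun n => S.sign.outLen (attackCertLen S N n (n + attackLen S n (Z n) (t n))) :=
    ((IsPoly.id.add (IsPoly.id.outLen _)).add ((isPoly_msgLen N).comp hx)).outLen _
  have hc := isPoly_signCost N hx hL (((IsPoly.const 1).add ((isPoly_msgLen N).comp hx)).add hL)
  have hs := isPoly_sigLen N hx hL
  have hr := (hc.add (.const 4)).mul ht
  exact ((IsPoly.const 3).add hK).add (hr.add ((hr.add ((IsPoly.const 3).add ((IsPoly.const 4).mul
    ((hK.add hs).add ((IsPoly.const 2).mul ht))))).add ((((IsPoly.const 4).add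
    ((IsPoly.const 2).mul hK)).add ((IsPoly.const 2).mul hs)).add hc)))

/-- Codes of pairs are uniquely decodable. So if the returned pair were in the log, its key would be
that of the challenge, or its message would have been queried; the event excludes both. -/
theorem forge_le (hs : SignSpec S N R) (A₁ A₂ : Prog) {n Z t : ℕ} {z : Bits} (hz : z.length ≤ Z)
    {E : Bits → List Bits → Prop} (hE : ∀ m l, E m l → m ∉ l)
    {K x L : ℕ} (hK : K = attackLen S n Z t) (hx : x = n + K)
    (hL : L = S.sign.outLen (attackCertLen S N n x)) :
    QM.val (forge S N R A₁ A₂ t z n E) Env.vac ≤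
      (S.forgeryGame (forger N A₁ A₂) (forgerTime N K x L t) z n).prob fun r =>
        r.2.accepts ∧ r.1.c 0 ∉ r.1.log := by
  rw [QM.prob_eq_val]
  refine Cov.val_le ?_
  have e1 : forge S N R A₁ A₂ t z n E = S.keyGen.run [unary n] [] >>= fun k =>
      attackRun S N R A₁ A₂ t z n k >>= fun a =>
        S.ver.run [unary n, k.c 1, (unpairCode (unpairCode (a.2.2.c 1)).2).1,
          pairCode (unpairCode (a.2.2.c 1)).1 (a.1.c 0)] [] >>= fun v =>
        pure (v.accepts ∧ E (a.1.c 0) a.2.2.log ∧ (unpairCode (a.2.2.c 1)).1 ≠ a.2.1.1) := by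
    simp [forge, attack, attackRun]
  rw [e1]
  simp only [Signature.forgeryGame, bind_assoc, pure_bind]
  have lin : ∀ A s k, (Prog.exec (R.oracle n k) A s).Linear := fun A s k =>
    Prog.exec_linear (R.oracle_linear n k) A s
  have run : ∀ (A : QPTAlg) (ins : List Bits) (qs : List ℕ), (A.run ins qs).Linear :=
    fun A ins qs => A.run_linear ins qs
  refine Cov.bind_refl (fun k => ((lin _ _ _).bind fun _ =>
    (signM_linear N (certM_linear _ _ _) _ _).bind fun _ => (lin _ _ _).bind fun _ => .pure _).bind
      fun _ => (run _ _ _).bind fun _ => .pure _) fun k e₁ hk => ?_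
  have he₁ := (S.keyGen.run_reach Env.vac_valid _ List.nodup_nil (by simp) _ hk).1.valid
  have hkl : ∀ r, (k.c r).length ≤ S.keyGen.outLen n := fun r => by
    have := (S.keyGen.run_length _ _ _ _ hk).1 r
    simpa [inputSize, length_unary, QPTAlg.outLen] using this
  refine (forger_cov hs A₁ A₂ hz he₁ hkl hK hx hL).bind (fun _ => (run _ _ _).bind fun _ => .pure _)
    fun a s e₂ _ _ ⟨h0, h1, hl⟩ => ?_
  rw [h0, h1]
  refine Cov.bind_refl (fun _ => .pure _) fun v e₃ _ => .cons (fun ⟨h2, h3, h4⟩ => ⟨h2, fun h5 => ?_⟩)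
    (.nil _)
  have inj : ∀ {a b a' b' : Bits}, pairCode a b = pairCode a' b' → a = a' ∧ b = b' := fun h => by
    have := congrArg unpairCode h
    simpa [unpairCode_pairCode] using this
  -- The first case contradicts the new one-time key, the second that `m*` was not queried.
  rcases hl _ h5 with h6 | ⟨v, m, hm, h6⟩
  · exact h4 (inj h6).1
  · exact hE _ _ h3 ((inj h6).2 ▸ hm)

end

/-! ### The adversary without queries -/

/-- The first part of the adversary without queries. It generates the keys of the many-time scheme,
and runs the adversary, whose queries it answers, in the block `4`. -/
def noQueryFst (S : Signature) (N : RevocableSignature) (A₁ : Prog) : Prog :=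
  .seq (.instr (.copy 2 9)) <| .seq (S.keyGen.call 5 [0] 15) <|
  .seq (copyIn 4 [0, 1, reg 5 1] 0) <| .seq (.instr (.copy (reg 5 0) 1)) <|
  .seq (A₁.inline (reg 4) (simQuery N (certProg S))) <|
  .seq (.instr (.copy (reg 4 0) 8)) <| .seq (.instr (.copy 0 10)) (.instr (.copy (reg 4 0) 0))

/-- The second part of the adversary without queries. It certifies the key of its challenger. -/
def noQuerySnd (S : Signature) (N : RevocableSignature) (A₂ : Prog) : Prog :=
  .seq (.instr (.copy 0 11)) <| .seq (.instr (.copy 10 0)) <| .seq (.instr (.moveAll 0 (reg 4 0))) <|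
  .seq (.instr (.pair 9 8 3)) <| .seq (certProg S) <| .seq (.instr (.pair 4 11 5)) <|
  .seq (.instr (.pair 9 5 (reg 4 0))) <| .seq (A₂.inline (reg 4) (simQuery N (certProg S))) <|
  .seq (.instr (.copy (reg 4 0) 0)) <| .seq (.instr (.unpair (reg 4 1) 2 3)) <|
  .seq (.instr (.unpair 3 4 1)) (.instr (.moveAll (reg 4 0) 0))

/-- The configuration after the first part of the adversary without queries, with the key `k` of
the many-time scheme, the key `v` of the challenger, and the configuration `s` of the simulated
adversary. -/
structure Simulates (n k v : Bits) (B : ℕ) (s s' : Config) : Prop where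
  c : ∀ r < B, s'.c (reg 4 r) = s.c r
  q : ∀ r < B, s'.q (reg 4 r) = s.q r
  c0 : s'.c 0 = s.c 0
  c1 : s'.c 1 = k
  c8 : s'.c 8 = s.c 0
  c9 : s'.c 9 = v
  c10 : s'.c 10 = n
  c15 : s'.c 15 = []
  q15 : s'.q 15 = []
  log : s'.log = []

/-- The number of steps of the adversary without queries, for each step of the adversary. -/
def noQueryRate (S : Signature) (N : RevocableSignature) (x y : ℕ) : ℕ :=
  signCost N x (S.sign.outLen y) (certCost S y) + 4

/-- The number of steps of the adversary without queries, where `K` bounds the strings of the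
adversary, `x` the inputs of the signing algorithm, and `y` those of certification. -/
def noQueryTime (S : Signature) (N : RevocableSignature) (n K x y t : ℕ) : ℕ :=
  noQueryRate S N x y * t + (1 + keyLen N x) + S.keyGen.callCost 1 n + (7 + 5 * K) +
    (3 + 2 * oneTimeLen N x + K) + (1 + keyLen N x + K) + certCost S y +
    (1 + S.sign.outLen y + oneTimeLen N x) +
    (2 + keyLen N x + 2 * S.sign.outLen y + oneTimeLen N x) +
    (4 + 4 * (K + sigLen N x (S.sign.outLen y) + 2 * t))

section
variable {S : Signature} {N R : RevocableSignature}

theorem certifies_certProg (S : Signature) (O : Oracle) {n : ℕ} {k : Bits} {x y : ℕ}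
    (hy : n + k.length + x ≤ y) :
    Certifies (certProg S) O (certM S (unary n) k) (fun _ l => l) (unary n) k x
      (S.sign.outLen y) (certCost S y) := fun _ _ _ he h0 h1 hc hq hx hf =>
  certProg_cov S (by rw [length_unary]; exact hy) he h0 h1 hc hq hx hf

/-- The long-term signing key is part of the result because the second part needs it to certify the
challenger's key and to answer further queries. The challenger's key `v` is merely kept and not
shown to the adversary yet. -/
theorem noQueryFst_cov (hs : SignSpec S N R) (O : Oracle) (A₁ : Prog) {n Z t B T : ℕ} {z v : Bits}
    (hz : z.length ≤ Z) (hB : A₁.bound + 3 ≤ B) {e : Env} (he : e.Valid) {K x y : ℕ}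
    (hv : v.length ≤ keyLen N x)
    (hK : K = attackLen S n Z t) (hx : x = n + K) (hy : y = attackCertLen S N n x)
    (hT : noQueryTime S N n K x y t ≤ T) :
    Cov (fun a s' => Simulates (unary n) a.1 v B a.2 s')
      ((do
        let k ← S.keyGen.run [unary n] []
        let s ← A₁.exec (R.oracle n (k.c 0)) (Config.start [unary n, z, k.c 1] [] t)
        return (k.c 0, s) : QM (Bits × Config)) e)
      ((noQueryFst S N A₁).exec O (Config.start [unary n, z, v] [] T) e) := by
  have lin : ∀ A s k, (Prog.exec (R.oracle n k) A s).Linear := fun A s k =>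
    Prog.exec_linear (R.oracle_linear n k) A s
  have hK' : n + Z + S.keyGen.outLen n + 2 * t = K := hK.symm
  have hy' : n + S.keyGen.outLen n + msgLen N x = y := hy.symm
  simp only [noQueryTime, noQueryRate] at hT
  set L := S.sign.outLen y with hL
  set p := certCost S y with hp
  set C := signCost N x L p + 4 with hC
  set s0 := Config.start [unary n, z, v] [] T with hs0
  have hf0 : s0.fuel = T := rfl
  have b16 : ∀ i < 16, blk i = 8 := fun i hi => blk_small hi
  have b4 : ∀ i, blk (reg 4 i) = 4 := fun i => blk_reg (by omega) i
  have b5 : ∀ i, blk (reg 5 i) = 5 := fun i => blk_reg (by omega) i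
  have hempty : ∀ r, 3 ≤ r → s0.c r = [] := fun r hr => by
    change [unary n, z, v].getD r [] = []
    exact List.getD_eq_default _ _ hr
  have hq0 : ∀ r, s0.q r = [] := fun r => by simp [hs0, Config.start]
  obtain ⟨s1, g1, f1, c1, q1, l1⟩ := exec_copy O (s := s0) (r := 2) (r' := 9)
    (by change 1 + v.length ≤ T; omega)
  have f1' : s1.fuel + (1 + v.length) = T := f1
  rw [noQueryFst, Prog.exec_seq_pure g1, Prog.exec_seq]
  have a0 : s1.c 0 = unary n := by rw [c1, Function.update_of_ne (by omega)]; rfl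
  have a1 : s1.c 1 = z := by rw [c1, Function.update_of_ne (by omega)]; rfl
  have a9 : s1.c 9 = v := by rw [c1, Function.update_self]; rfl
  have ae : ∀ r, 3 ≤ r → r ≠ 9 → s1.c r = [] := fun r hr h9 => by
    rw [c1, Function.update_of_ne h9, hempty r hr]
  -- The reserve `7 + 5 * K` is made up of `3 + K` for the inputs of the adversary, `1 + K` for the
  -- signing key, and `3 + 3 * K` for the copies at the end.
  have cov := S.keyGen.call_cov_nil O (k := 5) (by omega) (ins := [0]) (by simp [blk_small]) (s := s1)
    (e := e) (D := C * t + (7 + 5 * K)) (x := n) (ae 15 (by omega) (by omega)) (by rw [q1, hq0])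
    (by simp [a0, length_unary]) (by simp only [List.length_cons, List.length_nil, Nat.reduceAdd]; omega) he
  simp only [List.map_cons, List.map_nil, a0] at cov
  refine cov.bind (fun _ => (lin _ _ _).bind fun _ => .pure _) fun k s2 e₂ hk _ p2 => ?_
  have he₂ := (S.keyGen.run_reach he _ List.nodup_nil (by simp) _ hk).1.valid
  have f2 := p2.fuel
  have hk0 := p2.len0
  have hk1 := p2.len1
  have d0 : s2.c 0 = unary n := by rw [p2.c 0 (by rw [b16] <;> omega), a0]
  have d1 : s2.c 1 = z := by rw [p2.c 1 (by rw [b16] <;> omega), a1]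
  have hmap : [0, 1, reg 5 1].map s2.c = [unary n, z, k.c 1] := by simp [d0, d1, p2.c1]
  have hsum : ([unary n, z, k.c 1].map List.length).sum + 2 * t ≤ K := by
    simp [length_unary]
    omega
  obtain ⟨s3, g3, f3, c3, -, e3, q3, l3⟩ := exec_copyIn O (k := 4) (by omega) [0, 1, reg 5 1] 0
    (s := s2) (by simp [blk_small, b5]) (by
      rw [hmap]
      simp only [List.length_cons, List.length_nil]
      omega)
  rw [hmap] at f3 c3
  simp only [List.length_cons, List.length_nil] at f3
  have d5 : s3.c (reg 5 0) = k.c 0 := by rw [e3 _ (by rw [b5]; omega), p2.c0]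
  obtain ⟨s4, g4, f4, c4, q4, l4⟩ := exec_copy O (s := s3) (r := reg 5 0) (r' := 1)
    (by rw [d5]; omega)
  rw [d5] at f4 c4
  rw [Prog.exec_seq_pure g3, Prog.exec_seq_pure g4, Prog.exec_seq]
  have i1 : s4.c 1 = k.c 0 := by rw [c4, Function.update_self]
  have i0 : s4.c 0 = unary n := by
    rw [c4, Function.update_of_ne (by omega), e3 0 (by rw [b16] <;> omega), d0]
  have i9 : s4.c 9 = v := by
    rw [c4, Function.update_of_ne (by omega), e3 9 (by rw [b16] <;> omega),
      p2.c 9 (by rw [b16] <;> omega), a9]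
  have i15 : s4.c 15 = [] := by
    rw [c4, Function.update_of_ne (by omega), e3 15 (by rw [b16] <;> omega),
      p2.c 15 (by rw [b16] <;> omega), ae 15 (by omega) (by omega)]
  have hq4 : ∀ r, blk r ≠ 5 → s4.q r = [] := fun r hr => by
    rw [q4, q3]
    by_cases h15 : r = 15
    · rw [h15, p2.qp]
    · rw [p2.q r hr h15, q1, hq0]
  have hH : Hosts (reg 4) B C (3 + 3 * K) t (SimInv s4.c fun _ l' => l' = [])
      (Config.start [unary n, z, k.c 1] [] t) s4 := by
    refine ⟨fun r _ => ?_, fun r _ => ?_, ?_, le_rfl, fun _ _ _ => rfl, ?_, ?_⟩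
    · rw [c4, Function.update_of_ne (by simp only [reg]; omega), c3 r (Nat.zero_le _), p2.c _ (by rw [b4]; omega),
        ae _ (by simp only [reg]; omega) (by simp only [reg]; omega)]
      rfl
    · rw [hq4 _ (by rw [b4]; omega)]
      simp [Config.start]
    · have : (Config.start [unary n, z, k.c 1] [] t).fuel = t := rfl
      rw [this]
      omega
    · rw [hq4 15 (by rw [b16] <;> omega)]
    · rw [l4, l3, p2.log, l1]
      rfl
  have hg := Good.start he₂ [unary n, z, k.c 1] List.nodup_nil (by simp) t
  have hP : Certifies (certProg S) O (certM S (unary n) (k.c 0)) (fun _ l => l) (unary n) (k.c 0)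
    (msgLen N x) L p := certifies_certProg S O (by omega)
  refine (exec_sim hs hP i0 i1 i15 (fun _ _ _ _ h => h) (by omega) A₁ (by omega) hg hH).bind
    (fun _ => .pure _) fun a s5 e₃ ha _ h5 => ?_
  have hsh : a.Short K := Prog.exec_short A₁ _ _ (short_start hsum) _ ha
  have hl := hsh.c 0
  have f5 := h5.fuel
  have n4 : ∀ i j, i < 16 → reg 4 j ≠ i := fun i j hi => by simp only [reg]; omega
  obtain ⟨s6, g6, f6, c6, q6, l6⟩ := exec_copy O (s := s5) (r := reg 4 0) (r' := 8)
    (by rw [h5.c 0 (by omega)]; omega)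
  rw [h5.c 0 (by omega)] at f6 c6
  have j0 : s6.c 0 = unary n := by
    rw [c6, Function.update_of_ne (by omega), h5.inv.c 0 (by omega) (by omega), i0]
  obtain ⟨s7, g7, f7, c7, q7, l7⟩ := exec_copy O (s := s6) (r := 0) (r' := 10)
    (by rw [j0, length_unary]; omega)
  rw [j0] at f7 c7
  rw [length_unary] at f7
  have j4 : s7.c (reg 4 0) = a.c 0 := by
    rw [c7, Function.update_of_ne (n4 _ _ (by omega)), c6, Function.update_of_ne (n4 _ _ (by omega)),
      h5.c 0 (by omega)]
  obtain ⟨s8, g8, f8, c8, q8, l8⟩ := exec_copy O (s := s7) (r := reg 4 0) (r' := 0)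
    (by rw [j4]; omega)
  rw [j4] at c8
  rw [Prog.exec_seq_pure g6, Prog.exec_seq_pure g7, g8]
  refine .cons ⟨fun r hr => ?_, fun r hr => ?_, ?_, ?_, ?_, ?_, ?_, ?_, ?_, ?_⟩ (.nil _)
  · rw [c8, Function.update_of_ne (n4 _ _ (by omega)), c7, Function.update_of_ne (n4 _ _ (by omega)),
      c6, Function.update_of_ne (n4 _ _ (by omega)), h5.c r hr]
  · rw [q8, q7, q6, h5.q r hr]
  · simp [c8]
  · simp [c8, c7, c6, h5.inv.c 1 (by omega) (by omega), i1]
  · simp [c8, c7, c6]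
  · simp [c8, c7, c6, h5.inv.c 9 (by omega) (by omega), i9]
  · simp [c8, c7]
  · simp [c8, c7, c6, h5.inv.c 15 (by omega) (by omega), i15]
  · rw [q8, q7, q6, h5.inv.q]
  · rw [l8, l7, l6]
    exact h5.inv.log

/-- With a certificate on `(v, m*)`, the challenger's signature becomes a challenge of the many-time
game. The order of operations agrees with `signM`, where certification comes after one-time signing,
so the memories coincide. At the end the one-time part is extracted from the returned signature. -/
theorem noQuerySnd_cov (hs : SignSpec S N R) (O : Oracle) (A₂ : Prog) {n t B T : ℕ} {v k : Bits}
    (hB : A₂.bound + 3 ≤ B) {e : Env} {K x y : ℕ} {s s' : Config} (hg : Good s e)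
    (hsh : s.Short K) (hsim : Simulates (unary n) k v B s s')
    {ψ : Bits} {q : List ℕ} (hψ : ψ.length ≤ oneTimeLen N x) (hql : q.length ≤ oneTimeLen N x)
    {e' : Env} (he' : e'.Valid) (hn : e.next ≤ e'.next) (hq : q.Nodup)
    (hqf : ∀ a ∈ q, e.next ≤ a ∧ a < e'.next)
    (hv : v.length ≤ keyLen N x) (hk : k.length ≤ S.keyGen.outLen n)
    (hK : n + t ≤ K) (hx : x = n + K) (hy : y = attackCertLen S N n x)
    (hT : noQueryTime S N n K x y t ≤ T) :
    Cov (fun a s' => s'.c 0 = a.c 0 ∧ s'.c 1 = (unpairCode (unpairCode (a.c 1)).2).2 ∧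
        s'.q 0 = a.q 0 ∧ s'.log = [])
      ((certM S (unary n) k (pairCode v (s.c 0)) >>= fun σ =>
        A₂.exec (R.oracle n k) (chal s (sigCode v σ ψ) q t)) e')
      ((noQuerySnd S N A₂).exec O (chal s' ψ q T) e') := by
  have lin : ∀ A s k, (Prog.exec (R.oracle n k) A s).Linear := fun A s k =>
    Prog.exec_linear (R.oracle_linear n k) A s
  have hy' : n + S.keyGen.outLen n + msgLen N x = y := hy.symm
  simp only [noQueryTime, noQueryRate] at hT
  have hsl : sigLen N x (S.sign.outLen y) = 2 * keyLen N x + 1 + (2 * S.sign.outLen y + 1 + oneTimeLen N x) :=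
    rfl
  have hml : msgLen N x = 2 * keyLen N x + 1 + x := rfl
  set L := S.sign.outLen y with hL
  set p := certCost S y with hp
  set C := signCost N x L p + 4 with hC
  set s0 := chal s' ψ q T with hs0
  have hf0 : s0.fuel = T := rfl
  have n4 : ∀ i j, i < 16 → reg 4 j ≠ i := fun i j hi => by simp only [reg]; omega
  have cs0 : ∀ r, r ≠ 0 → s0.c r = s'.c r := fun r hr => by
    simp [hs0, chal, Config.setC, Config.setQ, hr]
  have qs0 : ∀ r, r ≠ 0 → s0.q r = s'.q r := fun r hr => by
    simp [hs0, chal, Config.setC, Config.setQ, hr]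
  have cz : s0.c 0 = ψ := by simp [hs0, chal, Config.setC, Config.setQ]
  have qz : s0.q 0 = q := by simp [hs0, chal, Config.setC, Config.setQ]
  have hl0 := hsh.c 0
  obtain ⟨s1, g1, f1, c1, q1, l1⟩ := exec_copy O (s := s0) (r := 0) (r' := 11)
    (by rw [cz]; omega)
  rw [cz] at f1 c1
  have a10 : s1.c 10 = unary n := by
    rw [c1, Function.update_of_ne (by omega), cs0 10 (by omega), hsim.c10]
  obtain ⟨s2, g2, f2, c2, q2, l2⟩ := exec_copy O (s := s1) (r := 10) (r' := 0)
    (by rw [a10, length_unary]; omega)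
  rw [a10] at f2 c2
  rw [length_unary] at f2
  have aq : s2.q 0 = q := by rw [q2, q1, qz]
  obtain ⟨s3, g3, f3, c3, q3, l3⟩ := exec_moveAll O (s := s2) (p := 0) (p' := reg 4 0)
    (by rw [aq]; omega)
  rw [aq] at f3 q3
  have a9 : s3.c 9 = v := by simp [c3, c2, c1, cs0, hsim.c9]
  have a8 : s3.c 8 = s.c 0 := by simp [c3, c2, c1, cs0, hsim.c8]
  obtain ⟨s4, g4, f4, c4, q4, l4⟩ := exec_pair O (s := s3) (r₁ := 9) (r₂ := 8) (r' := 3)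
    (by rw [a9, a8]; omega)
  rw [a9, a8] at f4 c4
  rw [noQuerySnd, Prog.exec_seq_pure g1, Prog.exec_seq_pure g2, Prog.exec_seq_pure g3,
    Prog.exec_seq_pure g4, Prog.exec_seq]
  have d0 : s4.c 0 = unary n := by simp [c4, c3, c2]
  have d1 : s4.c 1 = k := by simp [c4, c3, c2, c1, cs0, hsim.c1]
  have d3 : s4.c 3 = pairCode v (s.c 0) := by simp [c4]
  have d9 : s4.c 9 = v := by simp [c4, a9]
  have d11 : s4.c 11 = ψ := by simp [c4, c3, c2, c1]
  have d15 : s4.c 15 = [] := by simp [c4, c3, c2, c1, cs0, hsim.c15]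
  have dq15 : s4.q 15 = [] := by
    rw [q4, q3, Function.update_of_ne (n4 _ _ (by omega)).symm, Function.update_of_ne (by omega), q2,
      q1, qs0 15 (by omega), hsim.q15]
  have hpl := pairCode_length v (s.c 0)
  have hP : Certifies (certProg S) O (certM S (unary n) k) (fun _ l => l) (unary n) k
    (msgLen N x) L p := certifies_certProg S O (by omega)
  have cov := hP s4 (C * t + (1 + L + oneTimeLen N x) + (2 + keyLen N x + 2 * L + oneTimeLen N x) +
    (4 + 4 * (K + sigLen N x L + 2 * t))) e' he' d0 d1 d15 dq15 (by rw [d3]; omega) (by omega)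
  rw [d3] at cov
  refine cov.bind (fun _ => lin _ _ _) fun σ s5 e₁ hσ _ p5 => ?_
  obtain ⟨he₁, hn₁⟩ := certM_reach S _ _ _ _ he' _ hσ
  have f5 := p5.fuel
  have hσl := p5.len
  have b16 : ∀ i < 16, blk i ≠ 3 := fun i hi => by rw [blk_small hi]; omega
  have b4 : ∀ i, blk (reg 4 i) ≠ 3 := fun i => by rw [blk_reg] <;> omega
  have i11 : s5.c 11 = ψ := by rw [p5.c 11 (by omega) (by omega) (b16 _ (by omega)), d11]
  obtain ⟨s6, g6, f6, c6, q6, l6⟩ := exec_pair O (s := s5) (r₁ := 4) (r₂ := 11) (r' := 5)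
    (by rw [p5.c4, i11]; omega)
  rw [p5.c4, i11] at f6 c6
  have i9 : s6.c 9 = v := by
    rw [c6, Function.update_of_ne (by omega), p5.c 9 (by omega) (by omega) (b16 _ (by omega)), d9]
  have i5 : s6.c 5 = pairCode σ ψ := by rw [c6, Function.update_self]
  have hpl2 := pairCode_length σ ψ
  obtain ⟨s7, g7, f7, c7, q7, l7⟩ := exec_pair O (s := s6) (r₁ := 9) (r₂ := 5) (r' := reg 4 0)
    (by rw [i9, i5]; omega)
  rw [i9, i5] at f7 c7
  rw [Prog.exec_seq_pure g6, Prog.exec_seq_pure g7, Prog.exec_seq]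
  have hsc : (sigCode v σ ψ).length ≤ sigLen N x L := by
    rw [sigCode, pairCode_length]
    omega
  have k7 : ∀ i < 16, i < 3 ∨ 6 ≤ i → s7.c i = s4.c i := fun i hi hi' => by
    rw [c7, Function.update_of_ne (n4 _ _ hi).symm, c6, Function.update_of_ne (by omega),
      p5.c i (by omega) (by omega) (b16 _ hi)]
  have hH : Hosts (reg 4) B C (4 + 4 * (K + sigLen N x L + 2 * t)) t (SimInv s7.c fun _ l' => l' = [])
      (chal s (sigCode v σ ψ) q t) s7 := by
    refine ⟨fun r hr => ?_, fun r hr => ?_, ?_, le_rfl, fun _ _ _ => rfl, ?_, ?_⟩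
    · have : s6.c (reg 4 r) = s.c r := by
        rw [c6, Function.update_of_ne (n4 _ _ (by omega)), p5.c _ (n4 _ _ (by omega))
          (n4 _ _ (by omega)) (b4 _), c4, Function.update_of_ne (n4 _ _ (by omega)), c3, c2,
          Function.update_of_ne (n4 _ _ (by omega)), c1, Function.update_of_ne (n4 _ _ (by omega)),
          cs0 _ (n4 _ _ (by omega)), hsim.c r hr]
      rw [c7]
      simp only [chal, Config.setC, Config.setQ, Function.update_apply, (reg_injective 4).eq_iff, this]
      rfl
    · rw [q7, q6, p5.q _ (n4 _ _ (by omega)) (b4 _), q4, q3]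
      have : s2.q (reg 4 r) = s.q r := by rw [q2, q1, qs0 _ (n4 _ _ (by omega)), hsim.q r hr]
      simp only [chal, Config.setC, Config.setQ, Function.update_apply, (reg_injective 4).eq_iff,
        this, n4 0 r (by omega), if_false]
    · simp only [chal]
      omega
    · rw [q7, q6, p5.q 15 (by omega) (b16 _ (by omega)), dq15]
    · rw [l7, l6, p5.log, l4, l3, l2, l1]
      exact hsim.log
  have hg' := (hg.chal he' hn hq hqf (sigCode v σ ψ) t).env he₁ hn₁
  rw [← bind_pure (A₂.exec (R.oracle n k) (chal s (sigCode v σ ψ) q t))]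
  refine (exec_sim hs hP (by rw [k7 0 (by omega) (by omega), d0])
    (by rw [k7 1 (by omega) (by omega), d1]) (by rw [k7 15 (by omega) (by omega), d15])
    (fun _ _ _ _ h => h) (by omega) A₂ (by omega) hg' hH).bind (fun _ => .pure _)
    fun a s8 e₂ ha _ h8 => ?_
  have hsh8 : a.Short (K + sigLen N x L + 2 * t) :=
    Prog.exec_short A₂ _ _ (hsh.chal hsc (by omega)) _ ha
  have hf8 := h8.fuel
  have ha0 := hsh8.c 0
  have ha1 := hsh8.c 1
  have haq := hsh8.q 0
  have u1 := unpairCode_length (a.c 1)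
  have u2 := unpairCode_length (unpairCode (a.c 1)).2
  obtain ⟨t₁, g1, f1, c1, q1, l1⟩ := exec_copy O (s := s8) (r := reg 4 0) (r' := 0)
    (by rw [h8.c 0 (by omega)]; omega)
  rw [h8.c 0 (by omega)] at f1 c1
  have e1 : t₁.c (reg 4 1) = a.c 1 := by
    rw [c1, Function.update_of_ne (n4 _ _ (by omega)), h8.c 1 (by omega)]
  obtain ⟨t₂, g2, f2, c2, q2, l2⟩ := exec_unpair O (s := t₁) (r := reg 4 1) (r₁ := 2) (r₂ := 3)
    (by rw [e1]; omega)
  rw [e1] at f2 c2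
  have e3 : t₂.c 3 = (unpairCode (a.c 1)).2 := by rw [c2, Function.update_self]
  obtain ⟨t₃, g3, f3, c3, q3, l3⟩ := exec_unpair O (s := t₂) (r := 3) (r₁ := 4) (r₂ := 1)
    (by rw [e3]; omega)
  rw [e3] at f3 c3
  have eq : t₃.q (reg 4 0) = a.q 0 := by rw [q3, q2, q1, h8.q 0 (by omega)]
  obtain ⟨t₄, g4, f4, c4, q4, l4⟩ := exec_moveAll O (s := t₃) (p := reg 4 0) (p' := 0)
    (by rw [eq]; omega)
  rw [Prog.exec_seq_pure g1, Prog.exec_seq_pure g2, Prog.exec_seq_pure g3, g4]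
  refine .cons ⟨by simp [c4, c3, c2, c1], by simp [c4, c3], by simp [q4, eq], ?_⟩ (.nil _)
  rw [l4, l3, l2, l1]
  exact h8.inv.log

theorem isPoly_noQueryTime (S : Signature) (N : RevocableSignature) {K x y t : ℕ → ℕ}
    (hK : IsPoly K) (hx : IsPoly x) (hy : IsPoly y) (ht : IsPoly t) :
    IsPoly fun n => noQueryTime S N n (K n) (x n) (y n) (t n) := by
  have hk := (isPoly_keyLen N).comp hx
  have ho := (isPoly_oneTimeLen N).comp hx
  have hL := hy.outLen S.sign
  have hp := isPoly_certCost S hy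
  have hr := (isPoly_signCost N hx hL hp).add (.const 4)
  have hs := isPoly_sigLen N hx hL
  have h1 := IsPoly.const 1
  have h2 := IsPoly.const 2
  have h4 := IsPoly.const 4
  exact ((((((((hr.mul ht).add (h1.add hk)).add (IsPoly.id.callCost _ _)).add
    ((IsPoly.const 7).add ((IsPoly.const 5).mul hK))).add (((IsPoly.const 3).add (h2.mul ho)).add
    hK)).add ((h1.add hk).add hK)).add hp).add ((h1.add hL).add ho)).add
    (((h2.add hk).add (h2.mul hL)).add ho) |>.add
    (h4.add (h4.mul ((hK.add hs).add (h2.mul ht))))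

theorem start_mapQ (ins : List Bits) (t : ℕ) (f : ℕ → ℕ) :
    (Config.start ins [] t).mapQ f = Config.start ins [] t := by
  simp [Config.mapQ, Config.start]

theorem mapQ_shift_eq {M d : ℕ} {s : Config} (h : ∀ p, ∀ a ∈ s.q p, a < M) :
    s.mapQ (shift M d) = s := by
  have : (fun p => (s.q p).map (shift M d)) = s.q := funext fun p => map_shift_eq (h p)
  simp only [Config.mapQ, this]

/-- The reduction reproduces the many-time game exactly up to the moment at which the one-time key
of the challenge is drawn, and its own log stays empty because it certifies with a key of its own.
-/
theorem reuse_le (hs : SignSpec S N R) (A₁ A₂ : Prog) {n Z t T : ℕ} {z : Bits}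
    (hz : z.length ≤ Z) {E : Bits → List Bits → Prop} {M : Set Bits} (hE : ∀ m l, E m l → m ∈ M)
    {K x y : ℕ} (hK : K = attackLen S n Z t) (hx : x = n + K) (hy : y = attackCertLen S N n x)
    (hT : noQueryTime S N n K x y t ≤ T) :
    QM.val (reuse S N R A₁ A₂ t z n E) Env.vac ≤
      (N.deletionGame (noQueryFst S N A₁) (noQuerySnd S N A₂) T z n).prob fun r =>
        r.cert.accepts ∧ r.ver.accepts ∧ r.target ∈ M ∧ r.queries = [] := by
  have lin : ∀ A s k, (Prog.exec (R.oracle n k) A s).Linear := fun A s k =>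
    Prog.exec_linear (R.oracle_linear n k) A s
  have run : ∀ (A : QPTAlg) (ins : List Bits) (qs : List ℕ), (A.run ins qs).Linear :=
    fun A ins qs => A.run_linear ins qs
  -- `X` is what happens before the one-time key is drawn, `f` what happens afterwards; `X` does not
  -- depend on that key.
  let X : QM (Bits × Config) := do
    let k ← S.keyGen.run [unary n] []
    let s ← A₁.exec (R.oracle n (k.c 0)) (Config.start [unary n, z, k.c 1] [] t)
    return (k.c 0, s)
  let f : Bits × Config → (ℕ → Bits) → QM Prop := fun a b => do
    let ψ ← N.sign.run [unary n, b 0, a.2.c 0] []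
    let s₂ ← certM S (unary n) a.1 (pairCode (b 1) (a.2.c 0)) >>= fun σ =>
      A₂.exec (R.oracle n a.1) (chal a.2 (sigCode (b 1) σ (ψ.c 0)) (ψ.q 0) t)
    let w ← N.ver.run [unary n, b 1, (unpairCode (unpairCode (s₂.c 1)).2).2, a.2.c 0] (s₂.q 0)
    let d ← N.cert.run [unary n, ψ.c 1, s₂.c 0] []
    return w.accepts ∧ d.accepts ∧ E (a.2.c 0) s₂.log
  have hX : X.All Env.vac fun a e => Good a.2 e := by
    refine (S.keyGen.run_reach Env.vac_valid _ List.nodup_nil (by simp)).bind fun k e h => ?_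
    exact (Prog.exec_reach (R.oracle_fresh n _) A₁ _ _ (Good.start h.1.valid _ List.nodup_nil
      (by simp) t)).bind fun s e h => .pure h.good
  have hf : ∀ a b M d J, QM.Framed M d J id (f a b) (f (a.1, a.2.mapQ (shift M d)) b) := by
    intro a b M d J
    refine (N.sign.run_framed_nil _).bind fun ψ => QM.Framed.bind (φ := Config.mapQ (shift M d))
      ((certM_framed _ _ _ _ _ _).bind fun σ => ?_)
      fun s₂ => (N.ver.run_framed _ _).bind fun w => (N.cert.run_framed_nil _).bind fun _ => .pure rfl
    have h := Prog.exec_framed (R.oracle_framed n a.1 M d J) A₂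
      (chal a.2 (sigCode (b 1) σ (ψ.c 0)) (ψ.q 0) t)
    rw [chal_mapQ] at h
    exact h
  -- One-time key generation, reduced to its classical results, is a closed experiment and can be
  -- moved to the front, where the no-query game has it.
  have e1 : QM.val (reuse S N R A₁ A₂ t z n E) Env.vac =
      QM.val (N.keyGen.runC [unary n] >>= fun b => X >>= fun a => f a b) Env.vac := by
    rw [← QM.val_comm (N.keyGen.runC_closed _) Env.vac_valid]
    · simp [reuse, attack, signM, X, f, QPTAlg.runC]
    · refine hX.mono fun a e h => ⟨h.valid, fun b _ d J => ?_⟩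
      have := hf a b.1 e.next d J
      rwa [mapQ_shift_eq h.lt] at this
    · intro b _ d J
      refine QM.Framed.bind (φ := fun a => (a.1, a.2.mapQ (shift Env.vac.next d)))
        ((S.keyGen.run_framed_nil _).bind fun k => ?_) fun a => hf a _ _ _ _
      have h := Prog.exec_framed (R.oracle_framed n (k.c 0) Env.vac.next d J) A₁
        (Config.start [unary n, z, k.c 1] [] t)
      rw [start_mapQ] at h
      exact h.bind fun s => .pure rfl
  rw [e1, QM.prob_eq_val, ← QPTAlg.run_bind (f := fun b => X >>= fun a => f a b)]
  refine Cov.val_le ?_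
  simp only [RevocableSignature.deletionGame, bind_assoc, pure_bind]
  have hfl : ∀ a b, (f a b).Linear := fun a b => (run _ _ _).bind fun _ =>
    ((certM_linear _ _ _ _).bind fun _ => lin _ _ _).bind fun _ => (run _ _ _).bind fun _ =>
      (run _ _ _).bind fun _ => .pure _
  refine Cov.bind_refl (fun b => ((run _ _ _).bind fun _ => (lin _ _ _).bind fun _ => .pure _).bind
    fun a => hfl a _) fun b e₁ hb => ?_
  have he₁ := (N.keyGen.run_reach Env.vac_valid _ List.nodup_nil (by simp) _ hb).1.valid
  have hxn : n ≤ x := by omega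
  have hbl : ∀ r, (b.c r).length ≤ keyLen N x := fun r => by
    have := (N.keyGen.run_length _ _ _ _ hb).1 r
    refine le_trans ?_ (N.keyGen.outLen_mono hxn)
    simpa [inputSize, length_unary, QPTAlg.outLen] using this
  have hX' : X.All e₁ fun a e => Good a.2 e ∧ a.2.Short K ∧ a.1.length ≤ S.keyGen.outLen n := by
    refine ((S.keyGen.run_reach he₁ _ List.nodup_nil (by simp)).and
      (S.keyGen.run_length _ _ _)).bind fun k e h => ?_
    have hkl : ∀ r, (k.c r).length ≤ S.keyGen.outLen n := fun r => by
      simpa [inputSize, length_unary, QPTAlg.outLen] using h.2.1 r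
    have h1 := hkl 1
    have hsum : ([unary n, z, k.c 1].map List.length).sum + 2 * t ≤ K := by
      simp [length_unary, hK, attackLen]
      omega
    exact ((Prog.exec_reach (R.oracle_fresh n _) A₁ _ _ (Good.start h.1.1.valid _ List.nodup_nil
      (by simp) t)).and (Prog.exec_short A₁ _ _ (short_start hsum))).bind
        fun s e' h' => .pure ⟨h'.1.good, h'.2, hkl 0⟩
  set B := A₁.bound + A₂.bound + 3 with hB
  refine (noQueryFst_cov hs (N.oracle n (b.c 0)) A₁ (B := B) hz (by omega) he₁ (hbl 1) hK hx hy hT).bind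
    (fun a => hfl a _) fun a s e₂ ha _ hsim => ?_
  obtain ⟨hg, hsh, hkl⟩ := hX' _ ha
  -- The challenger signs the message that the simulated adversary has chosen.
  rw [hsim.c0]
  refine Cov.bind_refl (fun _ => ((certM_linear _ _ _ _).bind fun _ => lin _ _ _).bind fun _ =>
    (run _ _ _).bind fun _ => (run _ _ _).bind fun _ => .pure _) fun ψ e₃ hψ => ?_
  have hr := N.sign.run_reach hg.valid _ List.nodup_nil (by simp) _ hψ
  have hψl := N.sign.run_length _ _ _ _ hψ
  have hin : inputSize [unary n, b.c 0, a.2.c 0] [] ≤ x + keyLen N x := by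
    have h0 := hbl 0
    have : (a.2.c 0).length ≤ K := hsh.c 0
    simp [inputSize, length_unary]
    omega
  have hout := N.sign.outLen_mono hin
  refine (noQuerySnd_cov hs (N.oracle n (b.c 0)) A₂ (by omega) hg hsh hsim ((hψl.1 0).trans hout)
    ((hψl.2 0).trans hout) hr.1.valid hr.2.1 (hr.1.nodup 0) (fun q hq =>
      ⟨(hr.2.2 0 q hq).resolve_right (by simp), hr.1.lt 0 q hq⟩) (hbl 1) hkl
    (by simp only [hK, attackLen]; omega) hx hy hT).bind
    (fun _ => (run _ _ _).bind fun _ => (run _ _ _).bind fun _ => .pure _)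
    fun c s' e₄ _ _ ⟨h0, h1, hq, hl⟩ => ?_
  rw [h0, h1, hq]
  refine Cov.bind_refl (fun _ => (run _ _ _).bind fun _ => .pure _) fun w e₅ _ => ?_
  exact Cov.bind_refl (fun _ => .pure _) fun d e₆ _ => .cons
    (fun ⟨h2, h3, h4⟩ => ⟨h3, h2, hE _ _ h4, hl⟩) (.nil _)

end

/-! ### Security -/

/-- The running times of the reductions depend on the advice only through a polynomial bound on its
length, which both models provide. -/
theorem Model.Advice.length_le {μ : Model} {z : ℕ → Bits} (h : μ.Advice z) :
    ∃ p : Polynomial ℕ, ∀ n, (z n).length ≤ p.eval n := by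
  cases μ with
  | uniform => exact ⟨0, fun n => by simp [show z n = [] from h n]⟩
  | nonuniform => exact h

theorem QM.prob_nonneg {α : Type} (x : QM α) (E : α → Prop) : 0 ≤ x.prob E := by
  rw [QM.prob_eq_val]
  exact QM.val_nonneg _ _

theorem manyTimeSecure_of_spec {S : Signature} {N R : RevocableSignature} {M : ℕ → Set Bits}
    {μ : Model} (hk : R.keyGen = S.keyGen) (hc : R.cert = N.cert) (hs : SignSpec S N R)
    (hv : VerSpec S N R) (hS : S.EUFCMA μ) (hN : N.NoQuerySecure M μ) : R.ManyTimeSecure M μ := by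
  intro A₁ A₂ t z hz
  obtain ⟨Z, hZ⟩ := hz.length_le
  obtain ⟨T, hT⟩ := isPoly_forgerTime S N (IsPoly.id.eval Z) (IsPoly.id.eval t)
  have hK : IsPoly fun n => attackLen S n (Z.eval n) (t.eval n) :=
    ((IsPoly.id.add (IsPoly.id.eval Z)).add (IsPoly.id.outLen _)).add
      ((IsPoly.const 2).mul (IsPoly.id.eval t))
  have hx := IsPoly.id.add hK
  obtain ⟨T', hT'⟩ := isPoly_noQueryTime S N hK hx
    ((IsPoly.id.add (IsPoly.id.outLen S.keyGen)).add ((isPoly_msgLen N).comp hx)) (IsPoly.id.eval t)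
  refine ((hS (forger N A₁ A₂) T z hz).add (hN (noQueryFst S N A₁) (noQuerySnd S N A₂) T' z hz)).mono
    (fun n => QM.prob_nonneg _ _) fun n => ?_
  -- The side condition of the game is split between the two reductions: the forger uses that `m*`
  -- was not queried, the no-query adversary that `m*` lies in the message space.
  refine (deletionGame_le_add hk hc hs hv A₁ A₂ (t.eval n) (z n) n
    (fun m l => m ∈ M n ∧ ∀ m' ∈ l, m' ∈ M n ∧ m' ≠ m)).trans (add_le_add ?_ ?_)
  · rw [hT]
    exact forge_le hs A₁ A₂ (hZ n) (fun m l h hm => (h.2 m hm).2 rfl) rfl rfl rfl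
  · exact reuse_le hs A₁ A₂ (hZ n) (fun m l h => h.1) rfl rfl rfl (hT' n).ge

end QSig

end

theorem mainTheorem9 (μ : QSig.Model)
    (hMT : ∃ S : QSig.Signature, S.Correct ∧ S.EUFCMA μ)
    (M : ℕ → Set QSig.Bits)
    (hNQ : ∃ S : QSig.RevocableSignature,
      S.Correct M ∧ S.DeletionCorrect M ∧ S.NoQuerySecure M μ) :
    ∃ S : QSig.RevocableSignature,
      S.Correct M ∧ S.DeletionCorrect M ∧ S.ManyTimeSecure M μ := by
  obtain ⟨S, hS, hS'⟩ := hMT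
  obtain ⟨N, hN, hNd, hN'⟩ := hNQ
  obtain ⟨R, hk, hc, hs, hv, hd⟩ := QSig.exists_scheme S N
  exact ⟨R, QSig.correct_of_spec hk hs hv hS hN, QSig.deletionCorrect_of_spec hk hc hs hd hNd,
    QSig.manyTimeSecure_of_spec hk hc hs hv hS' hN'⟩
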